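/- Consider finite undirected graphs $G=(V,E)$ without multiple edges but with self loops allowed. For $A\subseteq V$ let $\mathrm{rk}(G[A])$ be the rank over $\mathbb{F}_2$ of the adjacency matrix of the induced subgraph $G[A]$, and let $$P(G;u,x)=\sum_{A\subseteq V}x^{|A|}\,u^{\mathrm{rk}(G[A])}$$ be the (bivariate) interlace polynomial. Let $\tilde{\mathbb{Q}}$ be a field with $\mathbb{Q}\subseteq\tilde{\mathbb{Q}}\subseteq\mathbb{R}$ that has finite degree over $\mathbb{Q}$, and let its elements be represented by their rational coordinates (in binary, in lowest terms) with respect to some fixed $\mathbb{Q}$-basis of $\tilde{\mathbb{Q}}$. For $u,\xi\in\tilde{\mathbb{Q}}$ write $P(u,\xi)$ for the computational problem: given a graph $G$, compute the number $P(G;u,\xi)\in\tilde{\mathbb{Q}}$. For an indeterminate $x$ write $P(u,x)$ for the computational problem: given a graph $G$, compute (the list of coefficients of) the polynomial $P(G;u,x)\in\tilde{\mathbb{Q}}[x]$. Then for all $u\in\tilde{\mathbb{Q}}$ and all $\xi\in\tilde{\mathbb{Q}}\setminus\{0,-1,-2\}$ there is a polynomial-time Turing reduction from $P(u,x)$ to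 $P(u,\xi)$, i.e. $P(u,x)\preceq_T P(u,\xi)$. -/

import Mathlib

open Polynomial

namespace Interlace

/-! ### Graphs and the interlace polynomial -/

/-- Undirected graphs without multiple edges, self loops allowed: `Adj a b` says that `{a, b}` is an
edge, and `Adj a a` that there is a self loop at `a`. -/
@[ext]
structure LoopGraph (V : Type*) where
  Adj : V → V → Prop
  symm : ∀ a b, Adj a b → Adj b a

namespace LoopGraph

variable {V : Type*}

/-- The subgraph `G[A]` induced by `A`. -/
def induce (G : LoopGraph V) (A : Finset V) : LoopGraph A where
  Adj a b := G.Adj a b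
  symm a b h := G.symm a b h

open Classical in
/-- The adjacency matrix over the field with two elements. -/
noncomputable def adjMatrix (G : LoopGraph V) : Matrix V V (ZMod 2) :=
  Matrix.of fun a b => if G.Adj a b then 1 else 0

/-- `rk G`, the rank of the adjacency matrix over the field with two elements. -/
noncomputable def rk [Fintype V] (G : LoopGraph V) : ℕ := G.adjMatrix.rank

/-- `P(G; u, x) = ∑_{A ⊆ V} x ^ |A| * u ^ rk(G[A])`, for `u`, `x` in any commutative ring. With `u`
and `x` in a field `K` it is the value at a point; with the constant `C u` and the indeterminate `X`
of `K[X]` it is a polynomial in `x` with coefficients in `K`. -/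
noncomputable def P [Fintype V] {R : Type*} [CommRing R] (G : LoopGraph V) (u x : R) : R :=
  ∑ A : Finset V, x ^ A.card * u ^ (G.induce A).rk

end LoopGraph

/-! ### Oracle machines

The machine model is the random access machine under the logarithmic cost criterion, equipped with
an oracle, and written with structured control flow. It works on integers in binary; every operation
is charged at least the number of bits that it handles, and multiplication and division are charged
the product of the bit lengths of their operands. Strings (inputs, outputs, queries and answers) are
finite lists of integers, measured by their total number of bits. -/

/-- The length of an integer in binary, including one more bit for its sign. -/
def bitLen (z : ℤ) : ℕ := z.natAbs.size + 1

/-- The total length of a list of integers. -/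
def bitSize (l : List ℤ) : ℕ := (l.map bitLen).sum

/-- The arithmetic operations of the machine. -/
inductive ArithOp where
  | plus
  | minus
  | times
  | quot

/-- Their meaning: `quot` is division with remainder (with quotient `0` if the divisor is `0`). -/
def ArithOp.apply : ArithOp → ℤ → ℤ → ℤ
  | .plus, x, y => x + y
  | .minus, x, y => x - y
  | .times, x, y => x * y
  | .quot, x, y => x / y

/-- Programs. Integer variables `v, w, …` and arrays of integers `a, b, …` are named by natural
numbers; a program mentions only finitely many of them. -/
inductive Prog where
  /-- do nothing -/
  | skip
  /-- first `p`, then `q` -/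
  | seq (p q : Prog)
  /-- `v := c`, a constant -/
  | const (v : ℕ) (c : ℤ)
  /-- `v := w₁ op w₂` -/
  | arith (op : ArithOp) (v w₁ w₂ : ℕ)
  /-- `v :=` the length of the array `a` -/
  | len (v a : ℕ)
  /-- `v := a[w]` (indirect addressing) -/
  | load (v a w : ℕ)
  /-- `a[w] := v` (indirect addressing) -/
  | store (a w v : ℕ)
  /-- append the value of `v` to the array `a` -/
  | push (a v : ℕ)
  /-- make the array `a` empty -/
  | clear (a : ℕ)
  /-- if `0 < v` then `p` else `q` -/
  | branch (v : ℕ) (p q : Prog)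
  /-- while `0 < v` do `p` -/
  | loop (v : ℕ) (p : Prog)
  /-- replace the contents of the array `b` by the oracle's answer to the query in the array `a` -/
  | query (a b : ℕ)

/-- The memory of a machine: the values of the variables and the contents of the arrays. -/
structure Memory where
  var : ℕ → ℤ
  arr : ℕ → List ℤ

namespace Memory

/-- `m` after the assignment of `z` to the variable `v`. -/
def setVar (m : Memory) (v : ℕ) (z : ℤ) : Memory := { m with var := Function.update m.var v z }

/-- `m` after the array `a` has received the contents `l`. -/
def setArr (m : Memory) (a : ℕ) (l : List ℤ) : Memory := { m with arr := Function.update m.arr a l }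

/-- The value of the array `a` at the index in the variable `w` (`0` beyond the end). -/
def read (m : Memory) (a w : ℕ) : ℤ := (m.arr a).getD (m.var w).toNat 0

/-- At the start the input is in array `0`, all other arrays are empty and all variables are `0`. -/
def start (input : List ℤ) : Memory where
  var _ := 0
  arr a := if a = 0 then input else []

end Memory

/-- `Exec O p m m' t`: the program `p` with oracle `O`, started on the memory `m`, halts with the
memory `m'` after time `t`. -/
inductive Exec (O : List ℤ → List ℤ) : Prog → Memory → Memory → ℕ → Prop
  | skip (m : Memory) : Exec O .skip m m 1
  | seq {p q : Prog} {m₁ m₂ m₃ : Memory} {s t : ℕ} :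
      Exec O p m₁ m₂ s → Exec O q m₂ m₃ t → Exec O (.seq p q) m₁ m₃ (s + t)
  | const (m : Memory) (v : ℕ) (c : ℤ) :
      Exec O (.const v c) m (m.setVar v c) (1 + bitLen c)
  | arith (m : Memory) (op : ArithOp) (v w₁ w₂ : ℕ) :
      Exec O (.arith op v w₁ w₂) m (m.setVar v (op.apply (m.var w₁) (m.var w₂)))
        (1 + bitLen (m.var w₁) * bitLen (m.var w₂))
  | len (m : Memory) (v a : ℕ) :
      Exec O (.len v a) m (m.setVar v ((m.arr a).length : ℤ)) (1 + bitLen ((m.arr a).length : ℤ))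
  | load (m : Memory) (v a w : ℕ) :
      Exec O (.load v a w) m (m.setVar v (m.read a w))
        (1 + bitLen (m.var w) + bitLen (m.read a w))
  | store (m : Memory) (a w v : ℕ) :
      Exec O (.store a w v) m (m.setArr a ((m.arr a).set (m.var w).toNat (m.var v)))
        (1 + bitLen (m.var w) + bitLen (m.var v))
  | push (m : Memory) (a v : ℕ) :
      Exec O (.push a v) m (m.setArr a (m.arr a ++ [m.var v])) (1 + bitLen (m.var v))
  | clear (m : Memory) (a : ℕ) :
      Exec O (.clear a) m (m.setArr a []) (1 + bitSize (m.arr a))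
  | branch_pos {m m' : Memory} {v : ℕ} {p q : Prog} {t : ℕ} :
      0 < m.var v → Exec O p m m' t → Exec O (.branch v p q) m m' (1 + bitLen (m.var v) + t)
  | branch_neg {m m' : Memory} {v : ℕ} {p q : Prog} {t : ℕ} :
      ¬ 0 < m.var v → Exec O q m m' t → Exec O (.branch v p q) m m' (1 + bitLen (m.var v) + t)
  | loop_pos {m₁ m₂ m₃ : Memory} {v : ℕ} {p : Prog} {s t : ℕ} :
      0 < m₁.var v → Exec O p m₁ m₂ s → Exec O (.loop v p) m₂ m₃ t →
        Exec O (.loop v p) m₁ m₃ (1 + bitLen (m₁.var v) + s + t)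
  | loop_neg {m : Memory} {v : ℕ} {p : Prog} :
      ¬ 0 < m.var v → Exec O (.loop v p) m m (1 + bitLen (m.var v))
  | query (m : Memory) (a b : ℕ) :
      Exec O (.query a b) m (m.setArr b (O (m.arr a)))
        (1 + bitSize (m.arr a) + bitSize (O (m.arr a)))

/-! ### Computational problems and reductions -/

/-- A computational problem: given an instance `x`, compute `answer x`. -/
structure Problem where
  Inst : Type
  Ans : Type
  answer : Inst → Ans
  encInst : Inst → List ℤ
  encAns : Ans → List ℤ
  encInst_injective : Function.Injective encInst
  encAns_injective : Function.Injective encAns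

/-- An oracle solves `Q` if it answers every (encoded) instance correctly. On lists that encode no
instance it may answer anything. -/
def Problem.SolvedBy (Q : Problem) (O : List ℤ → List ℤ) : Prop :=
  ∀ y : Q.Inst, O (Q.encInst y) = Q.encAns (Q.answer y)

/-- Polynomial-time Turing reducibility: one oracle program with a polynomial time bound solves `P`
(with its output in array `1`) whenever its oracle solves `Q`. -/
def PolyTimeTuringReducible (P Q : Problem) : Prop :=
  ∃ (M : Prog) (T : Polynomial ℕ), ∀ O : List ℤ → List ℤ, Q.SolvedBy O →
    ∀ x : P.Inst, ∃ (m : Memory) (t : ℕ),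
      Exec O M (Memory.start (P.encInst x)) m t ∧
      t ≤ T.eval (bitSize (P.encInst x)) ∧
      m.arr 1 = P.encAns (P.answer x)

/-! ### Encodings -/

theorem flatten_ofFn_injective {α : Type*} {n L : ℕ} {f g : Fin n → List α}
    (hf : ∀ i, (f i).length = L) (hg : ∀ i, (g i).length = L)
    (h : (List.ofFn f).flatten = (List.ofFn g).flatten) : f = g := by
  apply List.ofFn_injective
  rw [List.eq_iff_flatten_eq]
  refine ⟨h, ?_⟩
  simp only [List.map_ofFn]
  congr 1
  funext i
  simp [hf, hg]

/-- Finite graphs, with vertex set `{0, …, n - 1}`. -/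
abbrev FinGraph : Type := Σ n : ℕ, LoopGraph (Fin n)

open Classical in
/-- A graph is encoded by its number of vertices and the rows of its adjacency matrix. -/
noncomputable def encGraph (G : FinGraph) : List ℤ :=
  (G.1 : ℤ) :: (List.ofFn fun i => List.ofFn fun j => if G.2.Adj i j then (1 : ℤ) else 0).flatten

theorem encGraph_injective : Function.Injective encGraph := by
  rintro ⟨n, G⟩ ⟨n', H⟩ h
  simp only [encGraph, List.cons.injEq, Nat.cast_inj] at h
  obtain ⟨rfl, h⟩ := h
  have h2 := flatten_ofFn_injective (L := n) (by simp) (by simp) h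
  congr 1
  ext i j
  have h3 := congrFun (List.ofFn_injective (congrFun h2 i)) j
  by_cases h4 : G.Adj i j <;> by_cases h5 : H.Adj i j <;> simp_all

section Field

variable {K : IntermediateField ℚ ℝ} {d : ℕ} (b : Module.Basis (Fin d) ℚ K)

/-- An element of the field is encoded by its rational coordinates with respect to the basis `b`,
each of them as a numerator and a denominator in lowest terms. -/
noncomputable def encElem (z : K) : List ℤ :=
  (List.ofFn fun i => [(b.repr z i).num, ((b.repr z i).den : ℤ)]).flatten

/-- A polynomial is encoded by its coefficients, from the constant to the leading one. -/
noncomputable def encPoly (p : K[X]) : List ℤ :=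
  (List.ofFn fun k : Fin (p.natDegree + 1) => encElem b (p.coeff k)).flatten

theorem encElem_length (z : K) : (encElem b z).length = d * 2 := by
  simp [encElem, List.length_flatten, List.map_ofFn, List.sum_ofFn]

theorem encElem_injective : Function.Injective (encElem b) := by
  intro z w h
  have h2 := flatten_ofFn_injective (L := 2) (by simp) (by simp) h
  apply b.repr.injective
  ext i
  have h3 := congrFun h2 i
  simp only [List.cons.injEq, Nat.cast_inj, and_true] at h3
  exact Rat.ext h3.1 h3.2

theorem encPoly_length (p : K[X]) : (encPoly b p).length = (p.natDegree + 1) * (d * 2) := by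
  simp only [encPoly, List.length_flatten, List.map_ofFn, List.sum_ofFn, Function.comp_def,
    encElem_length, Finset.sum_const, Finset.card_univ, Fintype.card_fin, smul_eq_mul]

theorem encPoly_injective : Function.Injective (encPoly b) := by
  intro p q h
  have hd : 0 < d := Fin.pos_iff_nonempty.2 b.index_nonempty
  have h1 : p.natDegree = q.natDegree := by
    have h2 := congrArg List.length h
    rw [encPoly_length, encPoly_length] at h2
    exact Nat.succ_injective (Nat.eq_of_mul_eq_mul_right (by omega) h2)
  unfold encPoly at h
  rw [← h1] at h
  have h2 := flatten_ofFn_injective (L := d * 2) (by simp [encElem_length])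
    (by simp [encElem_length]) h
  ext1 k
  by_cases hk : k ≤ p.natDegree
  · exact encElem_injective b (congrFun h2 ⟨k, by omega⟩)
  · rw [coeff_eq_zero_of_natDegree_lt (by omega), coeff_eq_zero_of_natDegree_lt (by omega)]

/-- The problem `P(u, ξ)`: given a graph `G`, compute the number `P(G; u, ξ)`. -/
noncomputable def evalProblem (u ξ : K) : Problem where
  Inst := FinGraph
  Ans := K
  answer G := G.2.P u ξ
  encInst := encGraph
  encAns := encElem b
  encInst_injective := encGraph_injective
  encAns_injective := encElem_injective b

/-- The problem `P(u, x)`: given a graph `G`, compute the polynomial `P(G; u, x)` in the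
indeterminate `x`. -/
noncomputable def polyProblem (u : K) : Problem where
  Inst := FinGraph
  Ans := K[X]
  answer G := G.2.P (C u) X
  encInst := encGraph
  encAns := encPoly b
  encInst_injective := encGraph_injective
  encAns_injective := encPoly_injective b

end Field

end Interlace

namespace Interlace

/-! ### Lengths of integers -/

/-! Replace every vertex of `G` by `k` copies with the same adjacencies. Repeating rows and columns
of a matrix does not change its rank, so the rank on a set `A` of copies depends only on the set `B`
of vertices that `A` covers (`rk_induce_comap`). The sum of `x ^ |A|` over all `A` that cover
exactly `B` is `((1 + x) ^ k - 1) ^ |B|` (`sum_image_eq`). Hence the clone has at `x` the value that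
`G` has at `(1 + x) ^ k - 1` (`P_clone`). An oracle for the single point `ξ` thus yields the values
of the polynomial of `G` at all points `(1 + ξ) ^ k - 1` with `k ≥ 1`. These are distinct because `1
+ ξ` is a real number of absolute value neither `0` nor `1` (`node_ne`), and `n + 1` of them
determine a polynomial of degree at most `n`.

The rest shows that querying and interpolating take polynomial time on the machine. Interpolation is
Newton's, with two vectors: the coefficients of the interpolating polynomial so far and those of the
product of the linear factors so far. The danger is the growth of the numbers. A Newton coefficient
is computed by a division, but it equals the value of an iterated quotient of the target polynomial
by monic linear factors (`newton_coeff`), which is a division-free expression in the coefficients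
and the nodes. The height `Ht` adds its exponents under multiplication and raises them by one under
addition, so every number in the computation has an exponent polynomial in `n`; `Ht.small` turns
exponents into bit lengths (`exists_interpolationBound`).

Programs are verified in two layers. `Runs` speaks about the memory and exact costs. `WP` speaks
about abstract states with genuine field elements, under one bound `b` for all sizes, and running
times are polynomials in `b`. The bridge is `exists_kexpr_prog`: each coordinate of a fixed field
expression is a quotient of two fixed integer expressions in the numerators and denominators of its
arguments (`KExpr.fieldComputable`), and Euclid's algorithm brings it to lowest terms. Finally `b`
is chosen as a polynomial in `n`, and `n` is at most the input length. -/

theorem one_le_bitLen (z : ℤ) : 1 ≤ bitLen z := by simp [bitLen]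

theorem bitLen_le_succ_iff {z : ℤ} {n : ℕ} : bitLen z ≤ n + 1 ↔ z.natAbs < 2 ^ n := by
  simp [bitLen, Nat.size_le]

theorem natAbs_lt_two_pow_bitLen (z : ℤ) : z.natAbs < 2 ^ (bitLen z - 1) := by
  simpa [bitLen] using Nat.lt_size_self z.natAbs

theorem bitLen_mono {x y : ℤ} (h : x.natAbs ≤ y.natAbs) : bitLen x ≤ bitLen y :=
  Nat.succ_le_succ (Nat.size_le_size h)

theorem bitLen_le_of_natAbs_lt {z : ℤ} {n : ℕ} (h : z.natAbs < n) : bitLen z ≤ n := by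
  obtain ⟨n, rfl⟩ : ∃ k, n = k + 1 := ⟨n - 1, by omega⟩
  rw [bitLen_le_succ_iff]
  exact lt_of_le_of_lt (by omega) n.lt_two_pow_self

theorem bitLen_add_le (x y : ℤ) : bitLen (x + y) ≤ bitLen x + bitLen y := by
  have hx := natAbs_lt_two_pow_bitLen x
  have hy := natAbs_lt_two_pow_bitLen y
  obtain ⟨a, ha⟩ : ∃ a, bitLen x = a + 1 := ⟨bitLen x - 1, by have := one_le_bitLen x; omega⟩
  obtain ⟨c, hc⟩ : ∃ c, bitLen y = c + 1 := ⟨bitLen y - 1, by have := one_le_bitLen y; omega⟩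
  rw [ha, hc]
  rw [ha] at hx
  rw [hc] at hy
  rw [show a + 1 + (c + 1) = (a + c + 1) + 1 by ring, bitLen_le_succ_iff]
  have h1 : 2 ^ a ≤ 2 ^ (a + c) := Nat.pow_le_pow_right (by norm_num) (by omega)
  have h2 : 2 ^ c ≤ 2 ^ (a + c) := Nat.pow_le_pow_right (by norm_num) (by omega)
  have h3 := Int.natAbs_add_le x y
  simp only [Nat.add_sub_cancel] at hx hy
  rw [pow_succ]
  omega

theorem bitLen_neg (x : ℤ) : bitLen (-x) = bitLen x := by simp [bitLen]

theorem bitLen_sub_le (x y : ℤ) : bitLen (x - y) ≤ bitLen x + bitLen y := by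
  rw [sub_eq_add_neg, ← bitLen_neg y]
  exact bitLen_add_le _ _

theorem bitLen_mul_le (x y : ℤ) : bitLen (x * y) ≤ bitLen x + bitLen y := by
  have hx := natAbs_lt_two_pow_bitLen x
  have hy := natAbs_lt_two_pow_bitLen y
  obtain ⟨a, ha⟩ : ∃ a, bitLen x = a + 1 := ⟨bitLen x - 1, by have := one_le_bitLen x; omega⟩
  obtain ⟨c, hc⟩ : ∃ c, bitLen y = c + 1 := ⟨bitLen y - 1, by have := one_le_bitLen y; omega⟩
  rw [ha, hc]
  rw [ha] at hx
  rw [hc] at hy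
  refine le_trans ((bitLen_le_succ_iff (n := a + c)).2 ?_) (by omega)
  rw [Int.natAbs_mul, pow_add]
  exact Nat.mul_lt_mul'' hx hy

theorem bitLen_ediv_le (x y : ℤ) : bitLen (x / y) ≤ bitLen x :=
  bitLen_mono (Int.natAbs_ediv_le_natAbs x y)

/-- One additive bound for all four operations is what makes `ZExpr.weight` a valid factor. -/
theorem bitLen_apply_le (o : ArithOp) (x y : ℤ) : bitLen (o.apply x y) ≤ bitLen x + bitLen y := by
  cases o
  · exact bitLen_add_le x y
  · exact bitLen_sub_le x y
  · exact bitLen_mul_le x y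
  · exact (bitLen_ediv_le x y).trans (Nat.le_add_right _ _)

/-! ### Partial correctness with a time bound, on the memory of the machine -/

/-- Started on `m`, the program `p` halts within time `T` on a memory with the property `Q`. -/
def Runs (O : List ℤ → List ℤ) (p : Prog) (m : Memory) (T : ℕ) (Q : Memory → Prop) : Prop :=
  ∃ m' t, Exec O p m m' t ∧ t ≤ T ∧ Q m'

section Runs

variable {O : List ℤ → List ℤ} {p q : Prog} {m : Memory} {T T' : ℕ} {Q R : Memory → Prop}

theorem Runs.mono (h : Runs O p m T Q) (hT : T ≤ T') (hQ : ∀ m', Q m' → R m') :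
    Runs O p m T' R := by
  obtain ⟨m', t, h1, h2, h3⟩ := h
  exact ⟨m', t, h1, h2.trans hT, hQ _ h3⟩

/-- The postcondition of the first program is that the second one runs, so a long program is
verified forwards by nesting these rules. -/
theorem Runs.seq (h : Runs O p m T fun m' => Runs O q m' T' Q) :
    Runs O (.seq p q) m (T + T') Q := by
  obtain ⟨m', t, h1, h2, m'', t', h3, h4, h5⟩ := h
  exact ⟨m'', _, h1.seq h3, Nat.add_le_add h2 h4, h5⟩

theorem Runs.skip (hQ : Q m) : Runs O .skip m 1 Q := ⟨m, 1, .skip m, le_rfl, hQ⟩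

theorem Runs.const {v : ℕ} {c : ℤ} (hT : 1 + bitLen c ≤ T) (hQ : Q (m.setVar v c)) :
    Runs O (.const v c) m T Q := ⟨_, _, .const m v c, hT, hQ⟩

theorem Runs.arith {o : ArithOp} {v w₁ w₂ : ℕ}
    (hT : 1 + bitLen (m.var w₁) * bitLen (m.var w₂) ≤ T)
    (hQ : Q (m.setVar v (o.apply (m.var w₁) (m.var w₂)))) :
    Runs O (.arith o v w₁ w₂) m T Q := ⟨_, _, .arith m o v w₁ w₂, hT, hQ⟩

theorem Runs.load {v a w : ℕ} (hT : 1 + bitLen (m.var w) + bitLen (m.read a w) ≤ T)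
    (hQ : Q (m.setVar v (m.read a w))) : Runs O (.load v a w) m T Q :=
  ⟨_, _, .load m v a w, hT, hQ⟩

theorem Runs.store {a w v : ℕ} (hT : 1 + bitLen (m.var w) + bitLen (m.var v) ≤ T)
    (hQ : Q (m.setArr a ((m.arr a).set (m.var w).toNat (m.var v)))) :
    Runs O (.store a w v) m T Q := ⟨_, _, .store m a w v, hT, hQ⟩

theorem Runs.push {a v : ℕ} (hT : 1 + bitLen (m.var v) ≤ T)
    (hQ : Q (m.setArr a (m.arr a ++ [m.var v]))) :
    Runs O (.push a v) m T Q := ⟨_, _, .push m a v, hT, hQ⟩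

theorem Runs.clear {a : ℕ} (hT : 1 + bitSize (m.arr a) ≤ T) (hQ : Q (m.setArr a [])) :
    Runs O (.clear a) m T Q := ⟨_, _, .clear m a, hT, hQ⟩

theorem Runs.query {a b : ℕ} (hT : 1 + bitSize (m.arr a) + bitSize (O (m.arr a)) ≤ T)
    (hQ : Q (m.setArr b (O (m.arr a)))) : Runs O (.query a b) m T Q :=
  ⟨_, _, .query m a b, hT, hQ⟩

end Runs

/-! ### Updates of the memory and finite sequences of programs -/

@[simp] theorem Memory.setVar_var (m : Memory) (v : ℕ) (z : ℤ) (w : ℕ) :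
    (m.setVar v z).var w = if w = v then z else m.var w := by
  simp [Memory.setVar, Function.update_apply]

@[simp] theorem Memory.setVar_arr (m : Memory) (v : ℕ) (z : ℤ) : (m.setVar v z).arr = m.arr := rfl

@[simp] theorem Memory.setArr_arr (m : Memory) (a : ℕ) (l : List ℤ) (c : ℕ) :
    (m.setArr a l).arr c = if c = a then l else m.arr c := by
  simp [Memory.setArr, Function.update_apply]

@[simp] theorem Memory.setArr_var (m : Memory) (a : ℕ) (l : List ℤ) :
    (m.setArr a l).var = m.var := rfl

/-- The programs `f 0, …, f (n - 1)` one after the other. -/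
def progSeq (f : ℕ → Prog) : ℕ → Prog
  | 0 => .skip
  | n + 1 => .seq (progSeq f n) (f n)

/-- Meant for loops over the coordinates: their number is fixed with the field, so they are unrolled
into the program and need no counter. -/
theorem runs_progSeq {O : List ℤ → List ℤ} {f : ℕ → Prog} {n : ℕ} {m : Memory} {T : ℕ}
    (Inv : ℕ → Memory → Prop) (h0 : Inv 0 m)
    (hs : ∀ j < n, ∀ m, Inv j m → Runs O (f j) m T (Inv (j + 1))) :
    Runs O (progSeq f n) m (n * T + 1) (Inv n) := by
  induction n with
  | zero => exact (Runs.skip h0).mono (by simp) fun _ => id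
  | succ n ih =>
    refine Runs.mono (T := n * T + 1 + T) (Runs.seq ?_) (by ring_nf; rfl) fun _ => id
    exact (ih fun j hj => hs j (by omega)).mono le_rfl fun m' hm' => hs n (by omega) m' hm'

/-! ### Integer expressions -/

/-- Integer expressions in the variables of the machine. -/
inductive ZExpr where
  | var (i : ℕ)
  | const (c : ℤ)
  | op (o : ArithOp) (e₁ e₂ : ZExpr)

namespace ZExpr

@[simp] def eval (f : ℕ → ℤ) : ZExpr → ℤ
  | var i => f i
  | const c => c
  | op o e₁ e₂ => o.apply (e₁.eval f) (e₂.eval f)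

/-- All variables of the expression are below `M`. -/
@[simp] def Below (M : ℕ) : ZExpr → Prop
  | var i => i < M
  | const _ => True
  | op _ e₁ e₂ => e₁.Below M ∧ e₂.Below M

/-- The values of the expression are at most `weight` times as long as those of its variables. -/
@[simp] def weight : ZExpr → ℕ
  | var _ => 1
  | const c => bitLen c
  | op _ e₁ e₂ => e₁.weight + e₂.weight

/-- The value of the expression is assigned to the variable `t`; scratch variables are above. -/
@[simp] def compile (t : ℕ) : ZExpr → Prog
  | var i => .seq (.const t 0) (.arith .plus t t i)
  | const c => .const t c
  | op o e₁ e₂ => .seq (e₁.compile t) (.seq (e₂.compile (t + 1)) (.arith o t t (t + 1)))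

-- The argument is a common bound for the lengths of the variables. The product in the last case is
-- the cost of one operation on operands bounded by `bitLen_eval_le`; the summand `1` next to `X`
-- lets the same bound cover constants.
@[simp] noncomputable def time : ZExpr → ℕ[X]
  | var _ => C 10 + X
  | const c => C (1 + bitLen c)
  | op _ e₁ e₂ => e₁.time + (e₂.time + (1 + C e₁.weight * (X + 1) * (C e₂.weight * (X + 1))))

variable {M : ℕ} {f : ℕ → ℤ} {b : ℕ}

theorem bitLen_eval_le (e : ZExpr) (he : e.Below M) (hf : ∀ i < M, bitLen (f i) ≤ b) :
    bitLen (e.eval f) ≤ e.weight * (b + 1) := by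
  induction e with
  | var i => simpa using (hf i he).trans (by omega)
  | const c => exact Nat.le_mul_of_pos_right _ (by omega)
  | op o e₁ e₂ h₁ h₂ =>
    have := h₁ he.1
    have := h₂ he.2
    have := bitLen_apply_le o (e₁.eval f) (e₂.eval f)
    simp only [eval, weight, add_mul]
    omega

theorem eval_congr {g : ℕ → ℤ} (e : ZExpr) (he : e.Below M) (h : ∀ i < M, f i = g i) :
    e.eval f = e.eval g := by
  induction e with
  | var i => exact h i he
  | const c => rfl
  | op o e₁ e₂ h₁ h₂ => simp [h₁ he.1, h₂ he.2]

/-- The variables from `t` on serve as a stack: the second operand is compiled at `t + 1` and cannot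
destroy the first. -/
theorem runs_compile {O : List ℤ → List ℤ} (e : ZExpr) (he : e.Below M) {t : ℕ} (ht : M ≤ t)
    {m : Memory} (hm : ∀ i < M, bitLen (m.var i) ≤ b) :
    Runs O (e.compile t) m (e.time.eval b) fun m' =>
      m'.var t = e.eval m.var ∧ (∀ i < t, m'.var i = m.var i) ∧ m'.arr = m.arr := by
  induction e generalizing t m with
  | var i =>
    have hi : i < M := he
    refine Runs.mono (T := 8 + (1 + 1 * b)) (Runs.seq (Runs.const ?_ (Runs.arith ?_ ?_)))
      (by simp; omega) fun _ => id
    · simp [bitLen]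
    · have := hm i he
      have h2 : i ≠ t := by omega
      simpa [h2, bitLen] using this
    · refine ⟨?_, ?_, rfl⟩
      · simp [ArithOp.apply, show i ≠ t by omega]
      · intro j hj
        simp [show j ≠ t by omega]
  | const c =>
    refine Runs.const (by simp) ⟨by simp, ?_, rfl⟩
    intro j hj
    simp [show j ≠ t by omega]
  | op o e₁ e₂ h₁ h₂ =>
    simp only [time, eval_add, eval_one, eval_mul, eval_C, eval_X, compile]
    refine Runs.seq ((h₁ he.1 ht hm).mono le_rfl ?_)
    rintro m₁ ⟨hv₁, hf₁, ha₁⟩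
    have hm₁ : ∀ i < M, bitLen (m₁.var i) ≤ b := fun i hi => by
      rw [hf₁ i (by omega)]; exact hm i hi
    refine Runs.seq ((h₂ he.2 (t := t + 1) (by omega) hm₁).mono le_rfl ?_)
    rintro m₂ ⟨hv₂, hf₂, ha₂⟩
    have e2 : e₂.eval m₁.var = e₂.eval m.var :=
      e₂.eval_congr he.2 fun i hi => hf₁ i (by omega)
    have hvt : m₂.var t = e₁.eval m.var := by rw [hf₂ t (by omega), hv₁]
    refine Runs.arith ?_ ⟨?_, ?_, ?_⟩
    · rw [hvt, hv₂, e2]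
      exact Nat.add_le_add_left (Nat.mul_le_mul (e₁.bitLen_eval_le he.1 hm)
        (e₂.bitLen_eval_le he.2 hm)) 1
    · simp [hvt, hv₂, e2]
    · intro j hj
      simp [show j ≠ t by omega, hf₂ j (by omega), hf₁ j hj]
    · simp [ha₂, ha₁]

end ZExpr

/-! ### Reduction of fractions to lowest terms -/

/-- One step of Euclid's algorithm on the variables `t + 2` and `t + 3`. -/
def euclidStep (t : ℕ) : Prog :=
  .seq (.arith .quot (t + 4) (t + 2) (t + 3)) (.seq (.arith .times (t + 4) (t + 4) (t + 3))
    (.seq (.arith .minus (t + 5) (t + 2) (t + 4)) (.seq (.const (t + 4) 0)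
      (.seq (.arith .plus (t + 2) (t + 3) (t + 4)) (.arith .plus (t + 3) (t + 5) (t + 4))))))

/-- The remainder is formed as `a - a / c * c`, and the two final additions of zero are moves
between variables. -/
theorem runs_euclidStep {O : List ℤ → List ℤ} {t β : ℕ} {m : Memory}
    (ha : bitLen (m.var (t + 2)) ≤ β) (hc : bitLen (m.var (t + 3)) ≤ β)
    (h0 : 0 < m.var (t + 3)) :
    Runs O (euclidStep t) m (12 * (2 * β + 1) ^ 2) fun m' =>
      m'.var (t + 2) = m.var (t + 3) ∧ m'.var (t + 3) = m.var (t + 2) % m.var (t + 3) ∧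
      (∀ i < t + 2, m'.var i = m.var i) ∧ m'.arr = m.arr := by
  set a := m.var (t + 2) with hadef
  set c := m.var (t + 3) with hcdef
  have hq : bitLen (a / c) ≤ 2 * β := (bitLen_ediv_le a c).trans (by omega)
  have hqc : bitLen (a / c * c) ≤ 2 * β := by
    have := bitLen_mul_le (a / c) c
    have := bitLen_ediv_le a c
    omega
  have hmod : a - a / c * c = a % c := by
    have := Int.mul_ediv_add_emod a c
    linarith [mul_comm c (a / c)]
  have hr : bitLen (a % c) ≤ β := by
    refine (bitLen_mono ?_).trans hc
    have h1 := Int.emod_nonneg a h0.ne'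
    have h2 := Int.emod_lt_of_pos a h0
    omega
  have key : ∀ x y : ℕ, x ≤ 2 * β → y ≤ 2 * β → 1 + x * y ≤ 2 * (2 * β + 1) ^ 2 := by
    intro x y hx hy
    have := Nat.mul_le_mul hx hy
    nlinarith
  have hb0 : bitLen 0 = 1 := by simp [bitLen]
  have hβ : 1 ≤ β := (one_le_bitLen _).trans hc
  refine Runs.mono (T := 2 * (2 * β + 1) ^ 2 + (2 * (2 * β + 1) ^ 2 + (2 * (2 * β + 1) ^ 2 +
    (2 * (2 * β + 1) ^ 2 + (2 * (2 * β + 1) ^ 2 + 2 * (2 * β + 1) ^ 2))))) ?_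
    (by ring_nf; rfl) fun _ => id
  unfold euclidStep
  refine Runs.seq (Runs.arith ?_ <| Runs.seq <| Runs.arith ?_ <| Runs.seq <| Runs.arith ?_ <|
    Runs.seq <| Runs.const ?_ <| Runs.seq <| Runs.arith ?_ <| Runs.arith ?_ ⟨?_, ?_, ?_, ?_⟩)
  · exact key (bitLen a) (bitLen c) (by omega) (by omega)
  · simp only [Memory.setVar_var, ArithOp.apply, ← hadef, ← hcdef]
    simpa using key _ _ hq (by omega)
  · simp only [Memory.setVar_var, ArithOp.apply, ← hadef, ← hcdef]
    simpa [← hadef, ← hcdef] using key _ _ (by omega) hqc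
  · rw [hb0]; nlinarith
  · simpa [hb0, ← hadef, ← hcdef] using key (bitLen c) 1 (by omega) (by omega)
  · simpa [hb0, ← hadef, ← hcdef, ArithOp.apply, hmod] using
      key (bitLen (a % c)) 1 (by omega) (by omega)
  · simp [ArithOp.apply, ← hcdef]
  · simp [ArithOp.apply, ← hcdef, ← hadef, hmod]
  · intro i hi
    simp [show i ≠ t + 2 by omega, show i ≠ t + 3 by omega, show i ≠ t + 4 by omega,
      show i ≠ t + 5 by omega]
  · simp

/-- For `0 < c ≤ a` the quotient is at least `1`, so `a ≥ c + a % c ≥ 2 * (a % c)`, and the product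
of the pair at least halves in each round. A product below `1` means that the second entry is `0`.
-/
theorem runs_euclid_of_le {O : List ℤ → List ℤ} {t β : ℕ} (k : ℕ) {m : Memory}
    (ha : bitLen (m.var (t + 2)) ≤ β) (hc : bitLen (m.var (t + 3)) ≤ β)
    (h0 : 0 ≤ m.var (t + 3)) (hle : m.var (t + 3) ≤ m.var (t + 2))
    (hk : m.var (t + 2) * m.var (t + 3) < 2 ^ k) :
    Runs O (.loop (t + 3) (euclidStep t)) m ((k + 1) * (13 * (2 * β + 1) ^ 2)) fun m' =>
      m'.var (t + 2) = (Int.gcd (m.var (t + 2)) (m.var (t + 3)) : ℤ) ∧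
      (∀ i < t + 2, m'.var i = m.var i) ∧ m'.arr = m.arr := by
  have hover : ∀ x, x ≤ β → 1 + x ≤ (2 * β + 1) ^ 2 := fun x hx => by nlinarith
  have hdone : m.var (t + 3) = 0 →
      Runs O (.loop (t + 3) (euclidStep t)) m ((k + 1) * (13 * (2 * β + 1) ^ 2)) fun m' =>
      m'.var (t + 2) = (Int.gcd (m.var (t + 2)) (m.var (t + 3)) : ℤ) ∧
      (∀ i < t + 2, m'.var i = m.var i) ∧ m'.arr = m.arr := by
    intro hz
    refine ⟨m, _, .loop_neg (by omega), ?_, ?_, fun _ _ => rfl, rfl⟩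
    · have := hover _ hc
      nlinarith
    · rw [hz] at hle ⊢
      simp [abs_of_nonneg hle]
  induction k generalizing m with
  | zero =>
    apply hdone
    by_contra hz
    have h1 : 1 ≤ m.var (t + 3) := by omega
    have h2 : 1 ≤ m.var (t + 2) := by omega
    nlinarith
  | succ k ih =>
    by_cases hz : m.var (t + 3) = 0
    · exact hdone hz
    have hpos : 0 < m.var (t + 3) := by omega
    obtain ⟨m₁, t₁, hex, ht₁, h2, h3, hlow, harr⟩ := runs_euclidStep (O := O) ha hc hpos
    set a := m.var (t + 2)
    set c := m.var (t + 3)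
    have hr0 := Int.emod_nonneg a hpos.ne'
    have hr1 := Int.emod_lt_of_pos a hpos
    have hbr : bitLen (a % c) ≤ β := (bitLen_mono (by omega)).trans hc
    have hdm := Int.mul_ediv_add_emod a c
    have hq : 1 ≤ a / c := by
      rw [Int.le_ediv_iff_mul_le hpos]; omega
    have hsum : c + a % c ≤ a := by nlinarith
    have hk' : c * (a % c) < 2 ^ k := by
      rw [pow_succ] at hk
      nlinarith
    have hnext := ih (m := m₁) (by rw [h2]; exact hc) (by rw [h3]; exact hbr) (by rw [h3]; exact hr0)
      (by rw [h2, h3]; exact hr1.le) (by rw [h2, h3]; exact hk')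
      (by
        intro hz
        refine ⟨m₁, _, .loop_neg (by omega), ?_, ?_, fun _ _ => rfl, rfl⟩
        · have := hover (bitLen (m₁.var (t + 3))) (by rw [h3]; exact hbr)
          nlinarith
        · rw [hz, h2]
          simp [abs_of_pos hpos])
    obtain ⟨m₂, t₂, hex₂, ht₂, hg, hlow₂, harr₂⟩ := hnext
    refine ⟨m₂, _, .loop_pos hpos hex hex₂, ?_, ?_, fun i hi => (hlow₂ i hi).trans (hlow i hi),
      harr₂.trans harr⟩
    · have := hover _ hc
      nlinarith
    · rw [hg, h2, h3, Int.gcd_comm c, Int.gcd_emod]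

/-- The first round is treated separately: `a` may be negative or smaller than `c`, but after it the
pair is `c`, `a % c`, ordered and with product below `2 ^ (2 * β)`. -/
theorem runs_euclid {O : List ℤ → List ℤ} {t β : ℕ} {m : Memory}
    (ha : bitLen (m.var (t + 2)) ≤ β) (hc : bitLen (m.var (t + 3)) ≤ β)
    (h0 : 0 < m.var (t + 3)) :
    Runs O (.loop (t + 3) (euclidStep t)) m ((2 * β + 2) * (13 * (2 * β + 1) ^ 2)) fun m' =>
      m'.var (t + 2) = (Int.gcd (m.var (t + 2)) (m.var (t + 3)) : ℤ) ∧
      (∀ i < t + 2, m'.var i = m.var i) ∧ m'.arr = m.arr := by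
  obtain ⟨m₁, t₁, hex, ht₁, h2, h3, hlow, harr⟩ := runs_euclidStep (O := O) ha hc h0
  set a := m.var (t + 2)
  set c := m.var (t + 3)
  have hr0 := Int.emod_nonneg a h0.ne'
  have hr1 := Int.emod_lt_of_pos a h0
  have hbr : bitLen (a % c) ≤ β := (bitLen_mono (by omega)).trans hc
  have hk : c * (a % c) < 2 ^ (2 * β) := by
    have h4 := natAbs_lt_two_pow_bitLen c
    have h5 : c < 2 ^ β := by
      have : c.natAbs < 2 ^ β := h4.trans_le (Nat.pow_le_pow_right (by norm_num) (by omega))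
      zify at this
      rwa [abs_of_pos h0] at this
    have : (2 : ℤ) ^ (2 * β) = 2 ^ β * 2 ^ β := by rw [← pow_add]; ring_nf
    rw [this]
    nlinarith
  obtain ⟨m₂, t₂, hex₂, ht₂, hg, hlow₂, harr₂⟩ := runs_euclid_of_le (O := O) (β := β) (2 * β) (m := m₁)
    (by rw [h2]; exact hc) (by rw [h3]; exact hbr) (by rw [h3]; exact hr0)
    (by rw [h2, h3]; exact hr1.le) (by rw [h2, h3]; exact hk)
  refine ⟨m₂, _, .loop_pos h0 hex hex₂, ?_, ?_, fun i hi => (hlow₂ i hi).trans (hlow i hi),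
      harr₂.trans harr⟩
  · have : 1 + bitLen c ≤ (2 * β + 1) ^ 2 := by nlinarith
    nlinarith
  · rw [hg, h2, h3, Int.gcd_comm c, Int.gcd_emod]

/-- The fraction in the variables `t` and `t + 1` is reduced to lowest terms. -/
def reduceProg (t : ℕ) : Prog :=
  .seq (.const (t + 4) 0) (.seq (.arith .plus (t + 2) t (t + 4))
    (.seq (.arith .plus (t + 3) (t + 1) (t + 4)) (.seq (.loop (t + 3) (euclidStep t))
      (.seq (.arith .quot t t (t + 2)) (.arith .quot (t + 1) (t + 1) (t + 2))))))

theorem num_den_div {x y : ℤ} (hy : 0 < y) :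
    ((x : ℚ) / y).num = x / (Int.gcd x y : ℤ) ∧
      ((((x : ℚ) / y).den : ℕ) : ℤ) = y / (Int.gcd x y : ℤ) := by
  constructor
  · rw [← Rat.divInt_eq_div, Rat.num_divInt, Int.sign_eq_one_of_pos hy, one_mul, Int.gcd_comm]
  · rw [← Rat.divInt_eq_div, Rat.den_divInt, if_neg hy.ne', Int.gcd_comm]
    push_cast
    rw [abs_of_pos hy]

theorem runs_reduceProg {O : List ℤ → List ℤ} {t β : ℕ} {m : Memory}
    (ha : bitLen (m.var t) ≤ β) (hc : bitLen (m.var (t + 1)) ≤ β) (h0 : 0 < m.var (t + 1)) :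
    Runs O (reduceProg t) m ((2 * β + 8) * (13 * (2 * β + 1) ^ 2)) fun m' =>
      m'.var t = ((m.var t : ℚ) / m.var (t + 1)).num ∧
      m'.var (t + 1) = ((m.var t : ℚ) / m.var (t + 1)).den ∧
      (∀ i < t, m'.var i = m.var i) ∧ m'.arr = m.arr := by
  have hb0 : bitLen 0 = 1 := by simp [bitLen]
  have hβ : 1 ≤ β := (one_le_bitLen _).trans hc
  have key : ∀ x y : ℕ, x ≤ 2 * β → y ≤ 2 * β → 1 + x * y ≤ 13 * (2 * β + 1) ^ 2 := by
    intro x y hx hy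
    have := Nat.mul_le_mul hx hy
    nlinarith
  set a := m.var t with hadef
  set c := m.var (t + 1) with hcdef
  obtain ⟨hnum, hden⟩ := num_den_div (x := a) h0
  have hg0 : 0 < (Int.gcd a c : ℤ) := by
    have := Int.gcd_pos_of_ne_zero_right a h0.ne'
    exact_mod_cast this
  have hgc : (Int.gcd a c : ℤ) ≤ c := Int.le_of_dvd h0 (Int.gcd_dvd_right ..)
  have hgb : bitLen (Int.gcd a c : ℤ) ≤ β := (bitLen_mono (by omega)).trans hc
  unfold reduceProg
  set U := 13 * (2 * β + 1) ^ 2 with hU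
  refine Runs.mono (T := U + (U + (U + ((2 * β + 2) * U + (U + U)))))
    (Runs.seq <| Runs.const ?_ <| Runs.seq <| Runs.arith ?_ <| Runs.seq <| Runs.arith ?_ <|
      Runs.seq ?_) (by ring_nf; omega) fun _ => id
  · rw [hb0]; nlinarith
  · simpa [hb0, ← hadef] using key (bitLen a) 1 (by omega) (by omega)
  · simpa [hb0, ← hcdef] using key (bitLen c) 1 (by omega) (by omega)
  · refine (runs_euclid (β := β) ?_ ?_ ?_).mono (by rw [hU]) ?_
    · simpa [ArithOp.apply, ← hadef]
    · simpa [ArithOp.apply, ← hcdef]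
    · simpa [ArithOp.apply, ← hcdef]
    rintro m₁ ⟨hg, hlow, harr⟩
    simp only [Memory.setVar_var, ArithOp.apply, ← hadef, ← hcdef] at hg
    simp at hg
    have h1 : m₁.var t = a := by rw [hlow t (by omega)]; simp [← hadef]
    have h2 : m₁.var (t + 1) = c := by rw [hlow (t + 1) (by omega)]; simp [← hcdef]
    refine Runs.seq <| Runs.arith ?_ <| Runs.arith ?_ ⟨?_, ?_, ?_, ?_⟩
    · rw [h1, hg]; exact key _ _ (by omega) (by omega)
    · simp only [Memory.setVar_var, h2, hg]
      simpa [hg, h2] using key _ _ (by omega) (by omega)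
    · simp [h1, hg, ArithOp.apply, hnum]
    · simp [h2, hg, ArithOp.apply, hden]
    · intro i hi
      simp [show i ≠ t by omega, show i ≠ t + 1 by omega, hlow i (by omega),
        show i ≠ t + 2 by omega, show i ≠ t + 3 by omega, show i ≠ t + 4 by omega]
    · simp [harr]

/-! ### Rational functions of the variables -/

/-- On `dom`, the function `g` is a quotient of two expressions in the variables below `M`. -/
def RatComputable (M : ℕ) (dom : (ℕ → ℤ) → Prop) (g : (ℕ → ℤ) → ℚ) : Prop :=
  ∃ N D : ZExpr, N.Below M ∧ D.Below M ∧
    ∀ f, dom f → D.eval f ≠ 0 ∧ g f = (N.eval f : ℚ) / D.eval f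

namespace RatComputable

variable {M : ℕ} {dom : (ℕ → ℤ) → Prop} {g h : (ℕ → ℤ) → ℚ}

theorem mono {dom' : (ℕ → ℤ) → Prop} (hg : RatComputable M dom g) (hd : ∀ f, dom' f → dom f) :
    RatComputable M dom' g := by
  obtain ⟨N, D, hN, hD, hv⟩ := hg
  exact ⟨N, D, hN, hD, fun f hf => hv f (hd f hf)⟩

theorem const (q : ℚ) : RatComputable M dom fun _ => q :=
  ⟨.const q.num, .const q.den, trivial, trivial, fun _ _ => ⟨by simp, by simp [Rat.num_div_den]⟩⟩

theorem add (hg : RatComputable M dom g) (hh : RatComputable M dom h) :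
    RatComputable M dom fun f => g f + h f := by
  obtain ⟨N, D, hN, hD, hv⟩ := hg
  obtain ⟨N', D', hN', hD', hv'⟩ := hh
  refine ⟨.op .plus (.op .times N D') (.op .times N' D), .op .times D D',
    ⟨⟨hN, hD'⟩, hN', hD⟩, ⟨hD, hD'⟩, fun f hf => ?_⟩
  obtain ⟨h1, h2⟩ := hv f hf
  obtain ⟨h3, h4⟩ := hv' f hf
  refine ⟨mul_ne_zero h1 h3, ?_⟩
  simp only [ZExpr.eval, ArithOp.apply, h2, h4]
  push_cast
  rw [div_add_div _ _ (by exact_mod_cast h1) (by exact_mod_cast h3)]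
  ring

theorem mul (hg : RatComputable M dom g) (hh : RatComputable M dom h) :
    RatComputable M dom fun f => g f * h f := by
  obtain ⟨N, D, hN, hD, hv⟩ := hg
  obtain ⟨N', D', hN', hD', hv'⟩ := hh
  refine ⟨.op .times N N', .op .times D D', ⟨hN, hN'⟩, ⟨hD, hD'⟩, fun f hf => ?_⟩
  obtain ⟨h1, h2⟩ := hv f hf
  obtain ⟨h3, h4⟩ := hv' f hf
  refine ⟨mul_ne_zero h1 h3, ?_⟩
  simp only [ZExpr.eval, ArithOp.apply, h2, h4]
  push_cast
  rw [div_mul_div_comm]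

theorem sub (hg : RatComputable M dom g) (hh : RatComputable M dom h) :
    RatComputable M dom fun f => g f - h f := by
  simpa [sub_eq_add_neg] using hg.add ((const (-1)).mul hh)

theorem inv (hg : RatComputable M dom g) (h0 : ∀ f, dom f → g f ≠ 0) :
    RatComputable M dom fun f => (g f)⁻¹ := by
  obtain ⟨N, D, hN, hD, hv⟩ := hg
  refine ⟨D, N, hD, hN, fun f hf => ⟨fun hz => h0 f hf ?_, ?_⟩⟩
  · rw [(hv f hf).2, hz]; simp
  · simp only [(hv f hf).2, inv_div]

theorem sum {ι : Type*} (s : Finset ι) {g : ι → (ℕ → ℤ) → ℚ}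
    (hg : ∀ i, RatComputable M dom (g i)) : RatComputable M dom fun f => ∑ i ∈ s, g i f := by
  classical
  induction s using Finset.induction_on with
  | empty => simpa using const 0
  | insert a s ha ih => simpa [Finset.sum_insert ha] using (hg a).add ih

theorem prod {ι : Type*} (s : Finset ι) {g : ι → (ℕ → ℤ) → ℚ}
    (hg : ∀ i, RatComputable M dom (g i)) : RatComputable M dom fun f => ∏ i ∈ s, g i f := by
  classical
  induction s using Finset.induction_on with
  | empty => simpa using const 1
  | insert a s ha ih => simpa [Finset.prod_insert ha] using (hg a).mul ih

/-- The size of the matrix does not depend on the memory, so the `n!` terms of the Leibniz formula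
still make up one fixed expression. -/
theorem det {n : ℕ} {A : (ℕ → ℤ) → Matrix (Fin n) (Fin n) ℚ}
    (hA : ∀ i j, RatComputable M dom fun f => A f i j) :
    RatComputable M dom fun f => (A f).det := by
  simp only [Matrix.det_apply']
  exact sum _ fun σ => (const _).mul (prod _ fun i => hA _ _)

theorem adjugate {n : ℕ} {A : (ℕ → ℤ) → Matrix (Fin n) (Fin n) ℚ}
    (hA : ∀ i j, RatComputable M dom fun f => A f i j) (i j : Fin n) :
    RatComputable M dom fun f => (A f).adjugate i j := by
  simp only [Matrix.adjugate_apply]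
  refine det fun k l => ?_
  by_cases h : k = j
  · subst h
    simpa using const _
  · simpa [Matrix.updateRow_ne h] using hA k l

end RatComputable

/-! ### Registers for elements of the field -/

/-- The variable that holds the numerator of coordinate `j` of the register `r`. -/
def numVar (r : Fin 10) (j : ℕ) : ℕ := 20 + 20 * j + 2 * r

/-- The variable that holds the denominator of coordinate `j` of the register `r`. -/
def denVar (r : Fin 10) (j : ℕ) : ℕ := 20 + 20 * j + 2 * r + 1

/-- Expressions with values in the field, in ten registers. -/
inductive KExpr (K : Type*) where
  | reg (r : Fin 10)
  | const (z : K)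
  | add (e₁ e₂ : KExpr K)
  | sub (e₁ e₂ : KExpr K)
  | mul (e₁ e₂ : KExpr K)
  | div (e₁ e₂ : KExpr K)

namespace KExpr

variable {K : Type*} [Field K]

@[simp] def eval (ρ : Fin 10 → K) : KExpr K → K
  | reg r => ρ r
  | const z => z
  | add e₁ e₂ => e₁.eval ρ + e₂.eval ρ
  | sub e₁ e₂ => e₁.eval ρ - e₂.eval ρ
  | mul e₁ e₂ => e₁.eval ρ * e₂.eval ρ
  | div e₁ e₂ => e₁.eval ρ / e₂.eval ρ

/-- No division by zero occurs in the expression. -/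
@[simp] def Defined (ρ : Fin 10 → K) : KExpr K → Prop
  | reg _ => True
  | const _ => True
  | add e₁ e₂ => e₁.Defined ρ ∧ e₂.Defined ρ
  | sub e₁ e₂ => e₁.Defined ρ ∧ e₂.Defined ρ
  | mul e₁ e₂ => e₁.Defined ρ ∧ e₂.Defined ρ
  | div e₁ e₂ => e₁.Defined ρ ∧ e₂.Defined ρ ∧ e₂.eval ρ ≠ 0

end KExpr

section Field

variable {K : Type*} [Field K] [Algebra ℚ K] {d : ℕ} (bas : Module.Basis (Fin d) ℚ K)

/-- The elements of the field in the registers. -/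
noncomputable def regVal (f : ℕ → ℤ) (r : Fin 10) : K :=
  bas.equivFun.symm fun j => (f (numVar r j) : ℚ) / f (denVar r j)

theorem repr_regVal (f : ℕ → ℤ) (r : Fin 10) (j : Fin d) :
    bas.repr (regVal bas f r) j = (f (numVar r j) : ℚ) / f (denVar r j) := by
  rw [regVal, ← Module.Basis.equivFun_apply, LinearEquiv.apply_symm_apply]

/-- Multiplication is bilinear, with the coordinates of products of basis elements as structure
constants. Both the programs and the heights rest on this formula. -/
theorem repr_mul_eq (z w : K) (i : Fin d) :
    bas.repr (z * w) i =
      ∑ k, ∑ l, bas.repr z k * bas.repr w l * bas.repr (bas k * bas l) i := by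
  conv_lhs => rw [← bas.sum_repr z, ← bas.sum_repr w, Finset.sum_mul_sum]
  rw [map_sum, Finsupp.finsetSum_apply]
  refine Finset.sum_congr rfl fun k _ => ?_
  rw [map_sum, Finsupp.finsetSum_apply]
  refine Finset.sum_congr rfl fun l _ => ?_
  rw [smul_mul_smul_comm, map_smul, Finsupp.smul_apply, smul_eq_mul]

/-- Cramer's rule for the linear system that says that `z` times the unknown is `1`. -/
theorem repr_inv_eq {z : K} (hz : z ≠ 0) (i : Fin d) :
    bas.repr z⁻¹ i = ((Algebra.leftMulMatrix bas z).det)⁻¹ *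
      ∑ j, (Algebra.leftMulMatrix bas z).adjugate i j * bas.repr 1 j := by
  have h1 : Algebra.leftMulMatrix bas z * Algebra.leftMulMatrix bas z⁻¹ = 1 := by
    rw [← map_mul, mul_inv_cancel₀ hz, map_one]
  have h2 := Algebra.leftMulMatrix_mulVec_repr bas z⁻¹ 1
  rw [mul_one] at h2
  rw [← h2, ← Matrix.inv_eq_right_inv h1, Matrix.inv_def, Matrix.smul_mulVec, Ring.inverse_eq_inv']
  rfl

theorem det_leftMulMatrix_ne_zero {z : K} (hz : z ≠ 0) :
    (Algebra.leftMulMatrix bas z).det ≠ 0 := by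
  have h1 : Algebra.leftMulMatrix bas z * Algebra.leftMulMatrix bas z⁻¹ = 1 := by
    rw [← map_mul, mul_inv_cancel₀ hz, map_one]
  have := Matrix.isUnit_det_of_right_inverse h1
  exact this.ne_zero

/-- All coordinates of `F` are quotients of expressions in the variables below `M`. -/
def FieldComputable (M : ℕ) (dom : (ℕ → ℤ) → Prop) (F : (ℕ → ℤ) → K) : Prop :=
  ∀ j, RatComputable M dom fun f => bas.repr (F f) j

variable {bas}

namespace FieldComputable

variable {M : ℕ} {dom : (ℕ → ℤ) → Prop} {F G : (ℕ → ℤ) → K}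

theorem mul (hF : FieldComputable bas M dom F) (hG : FieldComputable bas M dom G) :
    FieldComputable bas M dom fun f => F f * G f := by
  intro j
  simp only [repr_mul_eq bas (F _)]
  exact RatComputable.sum _ fun k => RatComputable.sum _ fun l => ((hF k).mul (hG l)).mul (.const _)

theorem inv (hF : FieldComputable bas M dom F) (h0 : ∀ f, dom f → F f ≠ 0) :
    FieldComputable bas M dom fun f => (F f)⁻¹ := by
  intro j
  -- The matrix entries are coordinates of products of `F f` with basis elements.
  have hent : ∀ i k, RatComputable M dom fun f => Algebra.leftMulMatrix bas (F f) i k := by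
    intro i k
    simp only [Algebra.leftMulMatrix_eq_repr_mul, repr_mul_eq bas (F _)]
    exact RatComputable.sum _ fun k => RatComputable.sum _ fun l => ((hF k).mul (.const _)).mul (.const _)
  have h2 : RatComputable M dom fun f => ((Algebra.leftMulMatrix bas (F f)).det)⁻¹ *
      ∑ k, (Algebra.leftMulMatrix bas (F f)).adjugate j k * bas.repr 1 k :=
    ((RatComputable.det hent).inv fun f hf => det_leftMulMatrix_ne_zero bas (h0 f hf)).mul
      (RatComputable.sum _ fun k => (RatComputable.adjugate hent j k).mul (.const _))
  obtain ⟨N, D, hN, hD, hv⟩ := h2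
  refine ⟨N, D, hN, hD, fun f hf => ⟨(hv f hf).1, ?_⟩⟩
  exact (repr_inv_eq bas (h0 f hf) j).trans (hv f hf).2

end FieldComputable

/-- The denominators in the registers are nonzero, and the expression is defined. -/
def KExpr.Dom (bas : Module.Basis (Fin d) ℚ K) (e : KExpr K) (f : ℕ → ℤ) : Prop :=
  (∀ r, ∀ j : Fin d, f (denVar r j) ≠ 0) ∧ e.Defined (regVal bas f)

/-- Reduces field arithmetic to integer arithmetic: the two integer expressions for a coordinate
depend on `e` and the basis, but not on the values in the registers. -/
theorem KExpr.fieldComputable (e : KExpr K) :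
    FieldComputable bas (20 + 20 * d) (e.Dom bas) fun f => e.eval (regVal bas f) := by
  induction e with
  | reg r =>
    intro j
    refine ⟨.var (numVar r j), .var (denVar r j), ?_, ?_, fun f hf => ⟨hf.1 r j, ?_⟩⟩
    · simp only [ZExpr.Below, numVar]; omega
    · simp only [ZExpr.Below, denVar]; omega
    · exact repr_regVal bas f r j
  | const z => exact fun j => .const (bas.repr z j)
  | add e₁ e₂ h₁ h₂ =>
    intro j
    simpa using ((h₁ j).mono fun f hf => ⟨hf.1, hf.2.1⟩).add ((h₂ j).mono fun f hf => ⟨hf.1, hf.2.2⟩)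
  | sub e₁ e₂ h₁ h₂ =>
    intro j
    simpa using ((h₁ j).mono fun f hf => ⟨hf.1, hf.2.1⟩).sub ((h₂ j).mono fun f hf => ⟨hf.1, hf.2.2⟩)
  | mul e₁ e₂ h₁ h₂ =>
    exact FieldComputable.mul (fun j => (h₁ j).mono fun f hf => ⟨hf.1, hf.2.1⟩)
      fun j => (h₂ j).mono fun f hf => ⟨hf.1, hf.2.2⟩
  | div e₁ e₂ h₁ h₂ =>
    simp only [eval, div_eq_mul_inv]
    exact FieldComputable.mul (fun j => (h₁ j).mono fun f hf => ⟨hf.1, hf.2.1⟩)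
      (FieldComputable.inv (fun j => (h₂ j).mono fun f hf => ⟨hf.1, hf.2.2.1⟩) fun f hf => hf.2.2.2)

end Field

/-! ### Programs for field expressions -/

/-- The quotient of two expressions is stored in lowest terms in the variables `t` and `t + 1`. -/
def fracProg (N D : ZExpr) (t : ℕ) : Prog :=
  .seq ((ZExpr.op .times N D).compile t) (.seq ((ZExpr.op .times D D).compile (t + 1)) (reduceProg t))

/-- A bound for the length of the numbers that occur in `fracProg`. -/
noncomputable def fracBound (N D : ZExpr) : ℕ[X] :=
  C (N.weight + D.weight + D.weight) * (X + 1)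

noncomputable def fracTime (N D : ZExpr) : ℕ[X] :=
  (ZExpr.op .times N D).time + ((ZExpr.op .times D D).time +
    (2 * fracBound N D + 8) * (13 * (2 * fracBound N D + 1) ^ 2))

/-- The fraction is formed as `N * D` over `D * D`: its value is the same, and its denominator is
positive, as the reduction to lowest terms requires, without a test of signs. -/
theorem runs_fracProg {O : List ℤ → List ℤ} {N D : ZExpr} {M t b : ℕ} {m : Memory} (hN : N.Below M)
    (hD : D.Below M) (ht : M ≤ t) (hb : ∀ i < M, bitLen (m.var i) ≤ b) (h0 : D.eval m.var ≠ 0) :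
    Runs O (fracProg N D t) m ((fracTime N D).eval b) fun m' =>
      m'.var t = ((N.eval m.var : ℚ) / D.eval m.var).num ∧
      m'.var (t + 1) = ((N.eval m.var : ℚ) / D.eval m.var).den ∧
      bitLen (m'.var t) ≤ (fracBound N D).eval b ∧ bitLen (m'.var (t + 1)) ≤ (fracBound N D).eval b ∧
      (∀ i < t, m'.var i = m.var i) ∧ m'.arr = m.arr := by
  unfold fracProg fracTime
  rw [eval_add, eval_add]
  have hND : (ZExpr.op .times N D).Below M := ⟨hN, hD⟩
  have hDD : (ZExpr.op .times D D).Below M := ⟨hD, hD⟩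
  refine Runs.seq ((ZExpr.runs_compile _ hND ht hb).mono le_rfl ?_)
  rintro m₁ ⟨hv₁, hl₁, ha₁⟩
  have hb₁ : ∀ i < M, bitLen (m₁.var i) ≤ b := fun i hi => by
    rw [hl₁ i (by omega)]; exact hb i hi
  refine Runs.seq ((ZExpr.runs_compile _ hDD (t := t + 1) (by omega) hb₁).mono le_rfl ?_)
  rintro m₂ ⟨hv₂, hl₂, ha₂⟩
  have e1 : m₂.var t = N.eval m.var * D.eval m.var := by rw [hl₂ t (by omega), hv₁]; rfl
  have e2 : m₂.var (t + 1) = D.eval m.var * D.eval m.var := by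
    rw [hv₂, (ZExpr.op .times D D).eval_congr hDD fun i hi => hl₁ i (by omega)]; rfl
  have hpos : 0 < m₂.var (t + 1) := by rw [e2]; exact mul_self_pos.2 h0
  have b1 : bitLen (m₂.var t) ≤ (fracBound N D).eval b := by
    have := ZExpr.bitLen_eval_le _ hND hb
    rw [hl₂ t (by omega), hv₁]
    refine this.trans ?_
    simp only [fracBound, eval_mul, eval_C, eval_add, eval_X, eval_one, ZExpr.weight]
    exact Nat.mul_le_mul_right _ (by omega)
  have b2 : bitLen (m₂.var (t + 1)) ≤ (fracBound N D).eval b := by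
    have := ZExpr.bitLen_eval_le _ hDD hb₁
    rw [hv₂]
    refine this.trans ?_
    simp only [fracBound, eval_mul, eval_C, eval_add, eval_X, eval_one, ZExpr.weight]
    exact Nat.mul_le_mul_right _ (by omega)
  have hq : (m₂.var t : ℚ) / m₂.var (t + 1) = (N.eval m.var : ℚ) / D.eval m.var := by
    rw [e1, e2]
    push_cast
    rw [mul_div_mul_right _ _ (by exact_mod_cast h0)]
  obtain ⟨hnum, hden⟩ := num_den_div (x := m₂.var t) hpos
  refine (runs_reduceProg b1 b2 hpos).mono (by simp) ?_
  rintro m₃ ⟨hv₃, hw₃, hl₃, ha₃⟩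
  refine ⟨by rw [hv₃, hq], by rw [hw₃, hq], ?_, ?_, fun i hi => ?_, ?_⟩
  · rw [hv₃, hnum]; exact (bitLen_ediv_le _ _).trans b1
  · rw [hw₃, hden]; exact (bitLen_ediv_le _ _).trans b2
  · rw [hl₃ i hi, hl₂ i (by omega), hl₁ i hi]
  · rw [ha₃, ha₂, ha₁]

/-- The numbers in the scratch variables from `S` on are copied to the register `r`. -/
def copyProg (r : Fin 10) (S Z j : ℕ) : Prog :=
  .seq (.const Z 0) (.seq (.arith .plus (numVar r j) (S + 2 * j) Z)
    (.arith .plus (denVar r j) (S + 2 * j + 1) Z))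

/-- Since `e` may read the register `r`, all coordinates are first computed in scratch variables
from `S` on and copied to `r` only afterwards. The pair of coordinate `j` sits at `S + 2 * j`, and
later coordinates use scratch variables above it. -/
theorem exists_kexpr_prog {K : Type*} [Field K] [Algebra ℚ K] {d : ℕ}
    (bas : Module.Basis (Fin d) ℚ K) (e : KExpr K) (r : Fin 10) :
    ∃ (p : Prog) (T : ℕ[X]), ∀ (O : List ℤ → List ℤ) (b : ℕ) (m : Memory),
      (∀ i < 20 + 20 * d, bitLen (m.var i) ≤ b) → e.Dom bas m.var →
      Runs O p m (T.eval b) fun m' => m'.arr = m.arr ∧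
        (∀ j : Fin d, m'.var (numVar r j) = (bas.repr (e.eval (regVal bas m.var)) j).num ∧
          m'.var (denVar r j) = (bas.repr (e.eval (regVal bas m.var)) j).den) ∧
        ∀ i < 20 + 20 * d, (∀ j : Fin d, i ≠ numVar r j ∧ i ≠ denVar r j) →
          m'.var i = m.var i := by
  choose N D hN hD hv using e.fieldComputable (bas := bas)
  set S := 20 + 20 * d with hS
  -- A sum in place of a maximum over the coordinates, as the bound has to be a polynomial.
  set TB := ∑ j, fracTime (N j) (D j) with hTB
  set BB := ∑ j, fracBound (N j) (D j) with hBB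
  have evalle : ∀ (g : Fin d → ℕ[X]) (j : Fin d) (b : ℕ), (g j).eval b ≤ (∑ j, g j).eval b := by
    intro g j b
    rw [eval_finsetSum]
    exact Finset.single_le_sum (f := fun j => (g j).eval b) (fun _ _ => Nat.zero_le _)
      (Finset.mem_univ j)
  refine ⟨.seq (progSeq (fun j => if h : j < d then fracProg (N ⟨j, h⟩) (D ⟨j, h⟩) (S + 2 * j)
      else .skip) d) (progSeq (copyProg r S (S + 2 * d)) d),
    (d * TB + 1) + (d * (10 + BB + BB) + 1), fun O b m hb hdom => ?_⟩
  rw [eval_add, eval_add, eval_add, eval_mul, eval_mul, eval_add, eval_add]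
  simp only [eval_natCast, eval_one, Nat.cast_id, eval_ofNat]
  set z := e.eval (regVal bas m.var) with hz
  refine Runs.seq ((runs_progSeq (fun k m' => (∀ j : Fin d, j < k →
      m'.var (S + 2 * j) = (bas.repr z j).num ∧ m'.var (S + 2 * j + 1) = (bas.repr z j).den ∧
      bitLen (m'.var (S + 2 * j)) ≤ BB.eval b ∧ bitLen (m'.var (S + 2 * j + 1)) ≤ BB.eval b) ∧
      (∀ i < S, m'.var i = m.var i) ∧ m'.arr = m.arr) ?_ ?_).mono le_rfl ?_)
  · exact ⟨fun j hj => absurd hj (Nat.not_lt_zero _), fun _ _ => rfl, rfl⟩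
  · rintro k hk m₁ ⟨hdone, hlow, harr⟩
    rw [dif_pos hk]
    have hev : ∀ E : ZExpr, E.Below S → E.eval m₁.var = E.eval m.var :=
      fun E hE => E.eval_congr hE hlow
    have h0 := hv ⟨k, hk⟩ m.var hdom
    refine (runs_fracProg (hN ⟨k, hk⟩) (hD ⟨k, hk⟩) (t := S + 2 * k) (by omega) (b := b)
      (fun i hi => by rw [hlow i hi]; exact hb i hi) (by rw [hev _ (hD _)]; exact h0.1)).mono
      (evalle (fun j => fracTime (N j) (D j)) ⟨k, hk⟩ b) ?_
    rintro m₂ ⟨h1, h2, h3, h4, h5, h6⟩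
    rw [hev _ (hN _), hev _ (hD _), ← h0.2] at h1 h2
    refine ⟨fun j hj => ?_, fun i hi => by rw [h5 i (by omega), hlow i hi], by rw [h6, harr]⟩
    by_cases hjk : (j : ℕ) = k
    · obtain rfl : j = ⟨k, hk⟩ := Fin.ext hjk
      exact ⟨h1, h2, h3.trans (evalle (fun j => fracBound (N j) (D j)) _ b),
        h4.trans (evalle (fun j => fracBound (N j) (D j)) _ b)⟩
    · rw [h5 (S + 2 * j) (by omega), h5 (S + 2 * j + 1) (by omega)]
      exact hdone j (by omega)
  · rintro m₁ ⟨hdone, hlow, harr⟩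
    refine (runs_progSeq (fun k m' => (∀ j : Fin d, j < k →
      m'.var (numVar r j) = (bas.repr z j).num ∧ m'.var (denVar r j) = (bas.repr z j).den) ∧
      (∀ i < S, (∀ j : Fin d, i ≠ numVar r j ∧ i ≠ denVar r j) → m'.var i = m₁.var i) ∧
      (∀ i, S ≤ i → i ≠ S + 2 * d → m'.var i = m₁.var i) ∧ m'.arr = m₁.arr) ?_ ?_).mono le_rfl ?_
    · exact ⟨fun j hj => absurd hj (Nat.not_lt_zero _), fun _ _ _ => rfl, fun _ _ _ => rfl, rfl⟩
    · rintro k hk m₂ ⟨g1, g2, g3, g4⟩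
      obtain ⟨d1, d2, d3, d4⟩ := hdone ⟨k, hk⟩ hk
      simp only at d1 d2 d3 d4
      have c1 : m₂.var (S + 2 * k) = m₁.var (S + 2 * k) := g3 _ (by omega) (by omega)
      have c2 : m₂.var (S + 2 * k + 1) = m₁.var (S + 2 * k + 1) := g3 _ (by omega) (by omega)
      have n1 : numVar r k < S := by simp only [numVar]; omega
      have n2 : denVar r k < S := by simp only [denVar]; omega
      have n3 : denVar r k = numVar r k + 1 := rfl
      refine Runs.mono (T := 2 + ((1 + BB.eval b) + (1 + BB.eval b))) (Runs.seq <| Runs.const ?_ <|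
        Runs.seq <| Runs.arith ?_ <| Runs.arith ?_ ⟨fun j hj => ?_, fun i hi hne => ?_,
          fun i hi hne => ?_, ?_⟩) (by omega) fun _ => id
      · simp [bitLen]
      · simp only [Memory.setVar_var]
        rw [if_neg (by omega), if_pos trivial, c1]
        simpa [bitLen] using d3
      · simp only [Memory.setVar_var]
        rw [if_neg (by omega), if_neg (by omega), if_neg (by omega), if_pos trivial, c2]
        simpa [bitLen] using d4
      · simp only [Memory.setVar_var, ArithOp.apply]
        by_cases hjk : (j : ℕ) = k
        · obtain rfl : j = ⟨k, hk⟩ := Fin.ext hjk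
          simp [c1, c2, d1, d2, show numVar r k ≠ denVar r k by omega,
            show S + 2 * k + 1 ≠ numVar r k by omega, show S + 2 * k + 1 ≠ S + 2 * d by omega,
            show S + 2 * d ≠ numVar r k by omega, show k ≠ d by omega]
        · have := g1 j (by omega)
          have q1 : numVar r j ≠ numVar r k := by simp only [numVar]; omega
          have q2 : denVar r j ≠ numVar r k := by simp only [numVar, denVar]; omega
          have q3 : numVar r j ≠ denVar r k := by simp only [numVar, denVar]; omega
          have q4 : denVar r j ≠ denVar r k := by simp only [denVar]; omega
          have q5 : numVar r j < S := by simp only [numVar]; omega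
          have q6 : denVar r j < S := by simp only [denVar]; omega
          simp [this, q1, q2, q3, q4, show numVar r j ≠ S + 2 * d by omega,
            show denVar r j ≠ S + 2 * d by omega]
      · have := hne ⟨k, hk⟩
        simp only at this
        simp [this.1, this.2, show i ≠ S + 2 * d by omega, g2 i hi hne]
      · simp [hne, show i ≠ numVar r k by omega, show i ≠ denVar r k by omega, g3 i hi hne]
      · simp [g4]
    · rintro m₂ ⟨g1, g2, g3, g4⟩
      exact ⟨by rw [g4, harr], fun j => g1 j j.2, fun i hi hne => by rw [g2 i hi hne, hlow i hi]⟩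

/-! ### Abstract states -/

/-- The abstract state of a machine: integer variables, ten registers for field elements, two
vectors of field elements, and arrays of integers. -/
structure AState (K : Type*) where
  int : ℕ → ℤ
  reg : Fin 10 → K
  vec : Fin 2 → List K
  arr : ℕ → List ℤ

namespace AState

variable {K : Type*} (s : AState K)

def setInt (v : ℕ) (x : ℤ) : AState K := { s with int := Function.update s.int v x }
def setReg (r : Fin 10) (z : K) : AState K := { s with reg := Function.update s.reg r z }
def setVec (A : Fin 2) (l : List K) : AState K := { s with vec := Function.update s.vec A l }
def setArr (a : ℕ) (l : List ℤ) : AState K := { s with arr := Function.update s.arr a l }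

@[simp] theorem setInt_int (v : ℕ) (x : ℤ) (w : ℕ) :
    (s.setInt v x).int w = if w = v then x else s.int w := by
  simp [setInt, Function.update_apply]
@[simp] theorem setInt_reg (v : ℕ) (x : ℤ) : (s.setInt v x).reg = s.reg := rfl
@[simp] theorem setInt_vec (v : ℕ) (x : ℤ) : (s.setInt v x).vec = s.vec := rfl
@[simp] theorem setInt_arr (v : ℕ) (x : ℤ) : (s.setInt v x).arr = s.arr := rfl
@[simp] theorem setReg_reg (r : Fin 10) (z : K) (q : Fin 10) :
    (s.setReg r z).reg q = if q = r then z else s.reg q := by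
  simp [setReg, Function.update_apply]
@[simp] theorem setReg_int (r : Fin 10) (z : K) : (s.setReg r z).int = s.int := rfl
@[simp] theorem setReg_vec (r : Fin 10) (z : K) : (s.setReg r z).vec = s.vec := rfl
@[simp] theorem setReg_arr (r : Fin 10) (z : K) : (s.setReg r z).arr = s.arr := rfl
@[simp] theorem setVec_vec (A : Fin 2) (l : List K) (B : Fin 2) :
    (s.setVec A l).vec B = if B = A then l else s.vec B := by
  simp [setVec, Function.update_apply]
@[simp] theorem setVec_int (A : Fin 2) (l : List K) : (s.setVec A l).int = s.int := rfl
@[simp] theorem setVec_reg (A : Fin 2) (l : List K) : (s.setVec A l).reg = s.reg := rfl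
@[simp] theorem setVec_arr (A : Fin 2) (l : List K) : (s.setVec A l).arr = s.arr := rfl
@[simp] theorem setArr_arr (a : ℕ) (l : List ℤ) (c : ℕ) :
    (s.setArr a l).arr c = if c = a then l else s.arr c := by
  simp [setArr, Function.update_apply]
@[simp] theorem setArr_int (a : ℕ) (l : List ℤ) : (s.setArr a l).int = s.int := rfl
@[simp] theorem setArr_reg (a : ℕ) (l : List ℤ) : (s.setArr a l).reg = s.reg := rfl
@[simp] theorem setArr_vec (a : ℕ) (l : List ℤ) : (s.setArr a l).vec = s.vec := rfl

end AState

/-- The array that holds the numerators of coordinate `j` of the vector `A`. -/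
def numArr (A : Fin 2) (j : ℕ) : ℕ := 10 + 4 * j + 2 * A

/-- The array that holds the denominators of coordinate `j` of the vector `A`. -/
def denArr (A : Fin 2) (j : ℕ) : ℕ := 10 + 4 * j + 2 * A + 1

section Field

variable {K : Type*} [Field K] [Algebra ℚ K] {d : ℕ} (bas : Module.Basis (Fin d) ℚ K)

/-- The numerators and denominators of the coordinates of `z` have at most `b` bits. -/
def Small (b : ℕ) (z : K) : Prop :=
  ∀ j, bitLen (bas.repr z j).num ≤ b ∧ bitLen ((bas.repr z j).den : ℤ) ≤ b

/-- The memory `m` represents the abstract state `s`, all of whose components are bounded by `b`. -/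
structure Rep (b : ℕ) (m : Memory) (s : AState K) : Prop where
  int : ∀ i < 20, m.var i = s.int i
  num : ∀ r (j : Fin d), m.var (numVar r j) = (bas.repr (s.reg r) j).num
  den : ∀ r (j : Fin d), m.var (denVar r j) = (bas.repr (s.reg r) j).den
  arr : ∀ a < 10, m.arr a = s.arr a
  vnum : ∀ A (j : Fin d), m.arr (numArr A j) = (s.vec A).map fun z => (bas.repr z j).num
  vden : ∀ A (j : Fin d), m.arr (denArr A j) = (s.vec A).map fun z => ((bas.repr z j).den : ℤ)
  -- Integer variables are counters, sizes and indices, so their values are bounded, not only their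
  -- lengths. This bounds the number of rounds of a loop.
  int_lt : ∀ i < 20, (s.int i).natAbs < b
  reg_small : ∀ r, Small bas b (s.reg r)
  arr_length : ∀ a < 10, (s.arr a).length ≤ b
  arr_small : ∀ a < 10, ∀ x ∈ s.arr a, bitLen x ≤ b
  vec_length : ∀ A, (s.vec A).length ≤ b
  vec_small : ∀ A, ∀ z ∈ s.vec A, Small bas b z

variable {bas} {b : ℕ} {m m' : Memory} {s : AState K}

namespace Rep

/-- Beyond the first `20` variables, the index decomposes into a coordinate (a block of `20`), a
register (a pair within the block) and the parity that separates numerators from denominators. -/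
theorem bitLen_var_le (h : Rep bas b m s) {i : ℕ} (hi : i < 20 + 20 * d) : bitLen (m.var i) ≤ b := by
  by_cases h1 : i < 20
  · rw [h.int i h1]
    exact bitLen_le_of_natAbs_lt (h.int_lt i h1)
  · have hj : (i - 20) / 20 < d := by omega
    have hr : (i - 20) % 20 / 2 < 10 := by omega
    have hs := h.reg_small ⟨_, hr⟩ ⟨_, hj⟩
    rcases Nat.mod_two_eq_zero_or_one i with h2 | h2
    · have : i = numVar ⟨_, hr⟩ (⟨_, hj⟩ : Fin d) := by simp only [numVar]; omega
      rw [this, h.num]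
      exact hs.1
    · have : i = denVar ⟨_, hr⟩ (⟨_, hj⟩ : Fin d) := by simp only [denVar]; omega
      rw [this, h.den]
      exact hs.2

theorem regVal_eq (h : Rep bas b m s) : regVal bas m.var = s.reg := by
  funext r
  apply bas.repr.injective
  ext j
  rw [repr_regVal, h.num, h.den]
  exact Rat.num_div_den _

theorem setReg (h : Rep bas b m s) {r : Fin 10} {z : K} (hz : Small bas b z)
    (ha : m'.arr = m.arr)
    (hn : ∀ j : Fin d, m'.var (numVar r j) = (bas.repr z j).num ∧
      m'.var (denVar r j) = (bas.repr z j).den)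
    (ho : ∀ i < 20 + 20 * d, (∀ j : Fin d, i ≠ numVar r j ∧ i ≠ denVar r j) → m'.var i = m.var i) :
    Rep bas b m' (s.setReg r z) where
  int i hi := by
    rw [ho i (by omega) fun j => by simp only [numVar, denVar]; omega]
    exact h.int i hi
  num q j := by
    by_cases hq : q = r
    · subst hq; simpa using (hn j).1
    · have : (q : ℕ) ≠ r := fun h => hq (Fin.ext h)
      rw [ho _ (by simp only [numVar]; omega) fun k => by simp only [numVar, denVar]; omega]
      simpa [hq] using h.num q j
  den q j := by
    by_cases hq : q = r
    · subst hq; simpa using (hn j).2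
    · have : (q : ℕ) ≠ r := fun h => hq (Fin.ext h)
      rw [ho _ (by simp only [denVar]; omega) fun k => by simp only [numVar, denVar]; omega]
      simpa [hq] using h.den q j
  arr a hA := by rw [ha]; exact h.arr a hA
  vnum A j := by rw [ha]; exact h.vnum A j
  vden A j := by rw [ha]; exact h.vden A j
  int_lt := h.int_lt
  reg_small q := by
    by_cases hq : q = r
    · simpa [hq] using hz
    · simpa [hq] using h.reg_small q
  arr_length := h.arr_length
  arr_small := h.arr_small
  vec_length := h.vec_length
  vec_small := h.vec_small

theorem setInt (h : Rep bas b m s) {v : ℕ} (hv : v < 20) {x : ℤ} (hx : x.natAbs < b)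
    (ha : m'.arr = m.arr) (hn : m'.var v = x)
    (ho : ∀ i < 20 + 20 * d, i ≠ v → m'.var i = m.var i) :
    Rep bas b m' (s.setInt v x) where
  int i hi := by
    by_cases hiv : i = v
    · subst hiv; simpa using hn
    · rw [ho i (by omega) hiv]
      simpa [hiv] using h.int i hi
  num q j := by
    rw [ho _ (by simp only [numVar]; omega) (by simp only [numVar]; omega)]
    exact h.num q j
  den q j := by
    rw [ho _ (by simp only [denVar]; omega) (by simp only [denVar]; omega)]
    exact h.den q j
  arr a hA := by rw [ha]; exact h.arr a hA
  vnum A j := by rw [ha]; exact h.vnum A j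
  vden A j := by rw [ha]; exact h.vden A j
  int_lt i hi := by
    by_cases hiv : i = v
    · simpa [hiv] using hx
    · simpa [hiv] using h.int_lt i hi
  reg_small := h.reg_small
  arr_length := h.arr_length
  arr_small := h.arr_small
  vec_length := h.vec_length
  vec_small := h.vec_small

theorem setArr (h : Rep bas b m s) {a : ℕ} (ha : a < 10) {l : List ℤ} (hl : l.length ≤ b)
    (hs : ∀ x ∈ l, bitLen x ≤ b) (hv : m'.var = m.var) (hn : m'.arr a = l)
    (ho : ∀ c, c ≠ a → m'.arr c = m.arr c) : Rep bas b m' (s.setArr a l) where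
  int i hi := by rw [hv]; exact h.int i hi
  num q j := by rw [hv]; exact h.num q j
  den q j := by rw [hv]; exact h.den q j
  arr c hc := by
    by_cases hca : c = a
    · subst hca; simpa using hn
    · rw [ho c hca]; simpa [hca] using h.arr c hc
  vnum A j := by rw [ho _ (by simp only [numArr]; omega)]; exact h.vnum A j
  vden A j := by rw [ho _ (by simp only [denArr]; omega)]; exact h.vden A j
  int_lt := h.int_lt
  reg_small := h.reg_small
  arr_length c hc := by
    by_cases hca : c = a
    · simpa [hca] using hl
    · simpa [hca] using h.arr_length c hc
  arr_small c hc := by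
    by_cases hca : c = a
    · simpa [hca] using hs
    · simpa [hca] using h.arr_small c hc
  vec_length := h.vec_length
  vec_small := h.vec_small

theorem setVec (h : Rep bas b m s) {A : Fin 2} {l : List K} (hl : l.length ≤ b)
    (hs : ∀ z ∈ l, Small bas b z) (hv : m'.var = m.var)
    (hn : ∀ j : Fin d, m'.arr (numArr A j) = l.map (fun z => (bas.repr z j).num) ∧
      m'.arr (denArr A j) = l.map fun z => ((bas.repr z j).den : ℤ))
    (ho : ∀ c, (∀ j : Fin d, c ≠ numArr A j ∧ c ≠ denArr A j) → m'.arr c = m.arr c) :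
    Rep bas b m' (s.setVec A l) where
  int i hi := by rw [hv]; exact h.int i hi
  num q j := by rw [hv]; exact h.num q j
  den q j := by rw [hv]; exact h.den q j
  arr c hc := by
    rw [ho c fun j => by simp only [numArr, denArr]; omega]
    exact h.arr c hc
  vnum B j := by
    by_cases hq : B = A
    · subst hq; simpa using (hn j).1
    · have : (B : ℕ) ≠ A := fun h => hq (Fin.ext h)
      rw [ho _ fun k => by simp only [numArr, denArr]; omega]
      simpa [hq] using h.vnum B j
  vden B j := by
    by_cases hq : B = A
    · subst hq; simpa using (hn j).2
    · have : (B : ℕ) ≠ A := fun h => hq (Fin.ext h)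
      rw [ho _ fun k => by simp only [numArr, denArr]; omega]
      simpa [hq] using h.vden B j
  int_lt := h.int_lt
  reg_small := h.reg_small
  arr_length := h.arr_length
  arr_small := h.arr_small
  vec_length B := by
    by_cases hq : B = A
    · simpa [hq] using hl
    · simpa [hq] using h.vec_length B
  vec_small B := by
    by_cases hq : B = A
    · simpa [hq] using hs
    · simpa [hq] using h.vec_small B

end Rep

/-! ### Programs on abstract states -/

/-- A program together with a polynomial time bound. -/
structure Code where
  prog : Prog
  time : ℕ[X]

variable (bas) in
/-- On memories that represent `s` within the bound `b`, the code runs in time and arrives at a state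
with the property `Q`, within the bound `b`. -/
def WP (O : List ℤ → List ℤ) (b : ℕ) (c : Code) (Q : AState K → Prop) (s : AState K) : Prop :=
  ∀ m, Rep bas b m s → Runs O c.prog m (c.time.eval b) fun m' => ∃ s', Rep bas b m' s' ∧ Q s'

variable {O : List ℤ → List ℤ} {Q : AState K → Prop}

theorem WP.mono {c : Code} {R : AState K → Prop} (h : WP bas O b c Q s) (hQ : ∀ s, Q s → R s) :
    WP bas O b c R s :=
  fun m hm => (h m hm).mono le_rfl fun _ ⟨s', h1, h2⟩ => ⟨s', h1, hQ _ h2⟩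

namespace Code

/-- First `c₁`, then `c₂`. -/
noncomputable def seq (c₁ c₂ : Code) : Code := ⟨.seq c₁.prog c₂.prog, c₁.time + c₂.time⟩

theorem wp_seq {c₁ c₂ : Code} (h : WP bas O b c₁ (WP bas O b c₂ Q) s) :
    WP bas O b (c₁.seq c₂) Q s := by
  intro m hm
  simp only [seq, eval_add]
  refine Runs.seq ((h m hm).mono le_rfl ?_)
  rintro m₁ ⟨s₁, h1, h2⟩
  exact h2 m₁ h1

variable (d) in
/-- The integer variable `v` gets the value of the expression `e`. -/
noncomputable def set (v : ℕ) (e : ZExpr) : Code where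
  prog := .seq (e.compile (20 + 20 * d)) (.seq (.const (20 + 20 * d + 1) 0)
    (.arith .plus v (20 + 20 * d) (20 + 20 * d + 1)))
  time := e.time + (2 + (1 + C e.weight * (X + 1)))

theorem wp_set {v : ℕ} {e : ZExpr} (hv : v < 20) (he : e.Below 20)
    (hb : (e.eval s.int).natAbs < b) (hQ : Q (s.setInt v (e.eval s.int))) :
    WP bas O b (set d v e) Q s := by
  intro m hm
  simp only [set, eval_add, eval_mul, eval_C, eval_X, eval_one, eval_ofNat]
  have hlow : ∀ i < 20, bitLen (m.var i) ≤ b := fun i hi => hm.bitLen_var_le (by omega)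
  refine Runs.seq ((ZExpr.runs_compile e he (t := 20 + 20 * d) (by omega) hlow).mono le_rfl ?_)
  rintro m₁ ⟨h1, h2, h3⟩
  have hev := e.eval_congr he hm.int
  refine Runs.seq (Runs.const (by simp [bitLen]) (Runs.arith ?_ ⟨_, hm.setInt hv hb ?_ ?_ ?_, hQ⟩))
  · simpa [bitLen, h1] using e.bitLen_eval_le he hlow
  · simp [h3]
  · simp [ArithOp.apply, h1, hev]
  · intro i hi hiv
    simp [hiv, show i ≠ 20 + 20 * d + 1 by omega, h2 i hi]

variable (bas) in
/-- The register `r` gets the value of the expression `e`. -/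
noncomputable def kset (r : Fin 10) (e : KExpr K) : Code :=
  ⟨(exists_kexpr_prog bas e r).choose, (exists_kexpr_prog bas e r).choose_spec.choose⟩

theorem wp_kset {r : Fin 10} {e : KExpr K} (he : e.Defined s.reg) (hb : Small bas b (e.eval s.reg))
    (hQ : Q (s.setReg r (e.eval s.reg))) : WP bas O b (kset bas r e) Q s := by
  intro m hm
  have h := (exists_kexpr_prog bas e r).choose_spec.choose_spec O b m
    (fun i hi => hm.bitLen_var_le hi)
    ⟨fun q j => by rw [hm.den]; exact_mod_cast Rat.den_ne_zero _, by rw [hm.regVal_eq]; exact he⟩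
  rw [hm.regVal_eq] at h
  refine h.mono le_rfl ?_
  rintro m₁ ⟨h1, h2, h3⟩
  exact ⟨_, hm.setReg hb h1 h2 h3, hQ⟩

/-- `v := a[w]`. -/
noncomputable def load (v a w : ℕ) : Code := ⟨.load v a w, 2 * X + 10⟩

theorem wp_load {v a w : ℕ} (hv : v < 20) (ha : a < 10) (hw : w < 20)
    (hb : ((s.arr a).getD (s.int w).toNat 0).natAbs < b)
    (hQ : Q (s.setInt v ((s.arr a).getD (s.int w).toNat 0))) : WP bas O b (load v a w) Q s := by
  intro m hm
  have hr : m.read a w = (s.arr a).getD (s.int w).toNat 0 := by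
    rw [Memory.read, hm.arr a ha, hm.int w hw]
  refine Runs.load ?_ ⟨_, hm.setInt hv hb rfl (by simp [hr]) fun i _ hi => by simp [hi], hQ⟩
  rw [hr]
  have h1 := hm.bitLen_var_le (i := w) (by omega)
  have h2 := bitLen_le_of_natAbs_lt hb
  simp only [load, eval_add, eval_mul, eval_X, eval_ofNat]
  omega

/-- Append `v` to `a`. -/
noncomputable def push (a v : ℕ) : Code := ⟨.push a v, X + 1⟩

theorem wp_push {a v : ℕ} (ha : a < 10) (hv : v < 20) (hb : (s.arr a).length < b)
    (hQ : Q (s.setArr a (s.arr a ++ [s.int v]))) : WP bas O b (push a v) Q s := by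
  intro m hm
  have h1 := hm.bitLen_var_le (i := v) (by omega)
  refine Runs.push (by simp [push]; omega) ⟨_, hm.setArr ha (by simpa) ?_ rfl ?_ ?_, hQ⟩
  · intro x hx
    rcases List.mem_append.1 hx with hx | hx
    · exact hm.arr_small a ha x hx
    · rw [List.mem_singleton.1 hx, ← hm.int v hv]; exact h1
  · simp [hm.arr a ha, hm.int v hv]
  · intro c hc
    simp [hc]

theorem bitSize_le {l : List ℤ} {b c : ℕ} (hl : l.length ≤ c) (hs : ∀ x ∈ l, bitLen x ≤ b) :
    bitSize l ≤ c * b := by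
  refine (List.sum_le_card_nsmul _ b ?_).trans ?_
  · simpa using hs
  · simpa using Nat.mul_le_mul_right b hl

/-- Make `a` empty. -/
noncomputable def clear (a : ℕ) : Code := ⟨.clear a, 1 + X * X⟩

theorem wp_clear {a : ℕ} (ha : a < 10) (hQ : Q (s.setArr a [])) : WP bas O b (clear a) Q s := by
  intro m hm
  refine Runs.clear ?_ ⟨_, hm.setArr ha (by simp) (by simp) rfl (by simp)
    fun c hc => by simp [hc], hQ⟩
  have := bitSize_le (hm.arr_length a ha) (hm.arr_small a ha)
  simpa [clear, hm.arr a ha] using this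

/-- Send the query in `a` to the oracle and put its answer into `c`. -/
noncomputable def query (a c : ℕ) : Code := ⟨.query a c, 1 + X * X + X * X⟩

theorem wp_query {a c : ℕ} (ha : a < 10) (hc : c < 10) (hl : (O (s.arr a)).length ≤ b)
    (hs : ∀ x ∈ O (s.arr a), bitLen x ≤ b) (hQ : Q (s.setArr c (O (s.arr a)))) :
    WP bas O b (query a c) Q s := by
  intro m hm
  refine Runs.query ?_ ⟨_, hm.setArr hc hl hs rfl (by simp [hm.arr a ha])
    fun c hc => by simp [hc], hQ⟩
  have := bitSize_le (hm.arr_length a ha) (hm.arr_small a ha)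
  have := bitSize_le hl hs
  simp only [query, hm.arr a ha, eval_add, eval_mul, eval_X, eval_one]
  omega

/-- `v` times, with `v` counting down to `0`: do `c`. -/
noncomputable def repeatDown (d v : ℕ) (c : Code) : Code where
  prog := .loop v (c.seq (set d v (.op .minus (.var v) (.const 1)))).prog
  time := (X + 1) * (1 + X + (c.seq (set d v (.op .minus (.var v) (.const 1)))).time)

/-- `Inv i` describes the state after `i` rounds, while the counter shows `n - i`. It is demanded
with the counter already decreased, because the decrement belongs to the loop and not to the body.
The counter stays below `b`, hence the factor `X + 1` in the time. -/
theorem wp_repeatDown {v : ℕ} (hv : v < 20) {c : Code} (Inv : ℕ → AState K → Prop) (n : ℕ)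
    (hn : s.int v = n) (h0 : Inv 0 s)
    (hs : ∀ i < n, ∀ s, Inv i s → s.int v = (n : ℤ) - i →
      WP bas O b c (fun s' => s'.int v = (n : ℤ) - i ∧ Inv (i + 1) (s'.setInt v (n - i - 1))) s)
    (hQ : ∀ s, Inv n s → s.int v = 0 → Q s) : WP bas O b (repeatDown d v c) Q s := by
  set c' := c.seq (set d v (.op .minus (.var v) (.const 1))) with hc'
  have hstep : ∀ i < n, ∀ s, Inv i s → s.int v = (n : ℤ) - i →
      WP bas O b c' (fun s' => s'.int v = (n : ℤ) - (i + 1 : ℕ) ∧ Inv (i + 1) s') s := by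
    intro i hi s h1 h2 m hm
    have hlt := hm.int_lt v hv
    refine wp_seq (Q := fun s' => s'.int v = (n : ℤ) - (i + 1 : ℕ) ∧ Inv (i + 1) s')
      ((hs i hi s h1 h2).mono ?_) m hm
    rintro s' ⟨h3, h4⟩
    refine wp_set hv ⟨hv, trivial⟩ ?_ ?_
    · simp only [ZExpr.eval, ArithOp.apply, h3]
      omega
    · simp only [ZExpr.eval, ArithOp.apply, h3]
      exact ⟨by simp; ring, h4⟩
  -- Induction on the number `k` of rounds that remain.
  have main : ∀ k i, i + k = n → ∀ s, Inv i s → s.int v = (n : ℤ) - i → ∀ m, Rep bas b m s →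
      Runs O (.loop v c'.prog) m ((k + 1) * (1 + b + c'.time.eval b))
        fun m' => ∃ s', Rep bas b m' s' ∧ Q s' := by
    intro k
    induction k with
    | zero =>
      intro i hi s h1 h2 m hm
      obtain rfl : i = n := by omega
      rw [sub_self] at h2
      have hz : m.var v = 0 := by rw [hm.int v hv, h2]
      have := hm.bitLen_var_le (i := v) (by omega)
      exact ⟨m, _, .loop_neg (by omega), by omega, s, hm, hQ s h1 h2⟩
    | succ k ih =>
      intro i hi s h1 h2 m hm
      obtain ⟨m₁, t₁, e1, ht₁, s₁, r1, g1, g2⟩ := hstep i (by omega) s h1 h2 m hm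
      obtain ⟨m₂, t₂, e2, ht₂, h3⟩ := ih (i + 1) (by omega) s₁ g2 g1 m₁ r1
      have hpos : 0 < m.var v := by rw [hm.int v hv, h2]; omega
      have := hm.bitLen_var_le (i := v) (by omega)
      refine ⟨m₂, _, .loop_pos hpos e1 e2, ?_, h3⟩
      rw [add_mul (k + 1) 1]
      omega
  intro m hm
  have hlt := hm.int_lt v hv
  refine (main n 0 (by simp) s h0 (by simpa using hn) m hm).mono ?_ fun _ => id
  simp only [repeatDown, eval_mul, eval_add, eval_X, eval_one]
  exact Nat.mul_le_mul_right _ (by omega)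

end Code

end Field

section Field

variable {K : Type*} [Field K] [Algebra ℚ K] {d : ℕ} {bas : Module.Basis (Fin d) ℚ K}
  {b : ℕ} {m : Memory} {s : AState K} {O : List ℤ → List ℤ} {Q : AState K → Prop}

/-! ### Registers and vectors -/

/-- Variables from `20 + 20 * d` on are unconstrained and so remain available as scratch. -/
theorem runs_progSeq_reg {f : ℕ → Prog} {T : ℕ} {r : Fin 10} (x y : Fin d → ℤ)
    (hf : ∀ (j : Fin d) (m₁ : Memory), m₁.arr = m.arr →
      (∀ i < 20, m₁.var i = m.var i) → Runs O (f j) m₁ T fun m₂ => m₂.arr = m₁.arr ∧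
        m₂.var (numVar r j) = x j ∧ m₂.var (denVar r j) = y j ∧
        ∀ i < 20 + 20 * d, i ≠ numVar r j → i ≠ denVar r j → m₂.var i = m₁.var i) :
    Runs O (progSeq f d) m (d * T + 1) fun m' => m'.arr = m.arr ∧
      (∀ j : Fin d, m'.var (numVar r j) = x j ∧ m'.var (denVar r j) = y j) ∧
      ∀ i < 20 + 20 * d, (∀ j : Fin d, i ≠ numVar r j ∧ i ≠ denVar r j) → m'.var i = m.var i := by
  refine (runs_progSeq (fun k m' => m'.arr = m.arr ∧
      (∀ j : Fin d, j < k → m'.var (numVar r j) = x j ∧ m'.var (denVar r j) = y j) ∧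
      ∀ i < 20 + 20 * d, (∀ j : Fin d, i ≠ numVar r j ∧ i ≠ denVar r j) → m'.var i = m.var i)
      ⟨rfl, fun j hj => absurd hj (Nat.not_lt_zero _), fun _ _ _ => rfl⟩ ?_).mono le_rfl
      fun m' h => ⟨h.1, fun j => h.2.1 j j.2, h.2.2⟩
  rintro k hk m₁ ⟨h1, h2, h3⟩
  refine (hf ⟨k, hk⟩ m₁ h1 fun i hi => h3 i (by omega) fun j => by
    simp only [numVar, denVar]; omega).mono le_rfl ?_
  rintro m₂ ⟨g1, g2, g3, g4⟩
  refine ⟨g1.trans h1, fun j hj => ?_, fun i hi hne => ?_⟩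
  · by_cases hjk : (j : ℕ) = k
    · obtain rfl : j = ⟨k, hk⟩ := Fin.ext hjk
      exact ⟨g2, g3⟩
    · rw [g4, g4]
      · exact h2 j (by omega)
      all_goals simp only [numVar, denVar]; omega
  · rw [g4 i hi (hne ⟨k, hk⟩).1 (hne ⟨k, hk⟩).2, h3 i hi hne]

/-- Step `j` changes only the two arrays of its own coordinate, so each coordinate is found in its
original form when its turn comes. -/
theorem runs_progSeq_vec {f : ℕ → Prog} {T : ℕ} {A : Fin 2} (x y : Fin d → List ℤ)
    (hf : ∀ (j : Fin d) (m₁ : Memory), m₁.var = m.var →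
      m₁.arr (numArr A j) = m.arr (numArr A j) → m₁.arr (denArr A j) = m.arr (denArr A j) →
      Runs O (f j) m₁ T fun m₂ => m₂ = (m₁.setArr (numArr A j) (x j)).setArr (denArr A j) (y j)) :
    Runs O (progSeq f d) m (d * T + 1) fun m' => m'.var = m.var ∧
      (∀ j : Fin d, m'.arr (numArr A j) = x j ∧ m'.arr (denArr A j) = y j) ∧
      ∀ c, (∀ j : Fin d, c ≠ numArr A j ∧ c ≠ denArr A j) → m'.arr c = m.arr c := by
  refine (runs_progSeq (fun k m' => m'.var = m.var ∧
      (∀ j : Fin d, j < k → m'.arr (numArr A j) = x j ∧ m'.arr (denArr A j) = y j) ∧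
      ∀ c, (∀ j : Fin d, j < k → c ≠ numArr A j ∧ c ≠ denArr A j) → m'.arr c = m.arr c)
      ⟨rfl, fun j hj => absurd hj (Nat.not_lt_zero _), fun _ _ => rfl⟩ ?_).mono le_rfl
      fun m' h => ⟨h.1, fun j => h.2.1 j j.2, fun c hc => h.2.2 c fun j _ => hc j⟩
  rintro k hk m₁ ⟨h1, h2, h3⟩
  have hnum : m₁.arr (numArr A k) = m.arr (numArr A k) :=
    h3 _ fun j hj => by simp only [numArr, denArr]; omega
  have hden : m₁.arr (denArr A k) = m.arr (denArr A k) :=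
    h3 _ fun j hj => by simp only [numArr, denArr]; omega
  refine (hf ⟨k, hk⟩ m₁ h1 hnum hden).mono le_rfl ?_
  rintro m₂ rfl
  refine ⟨h1, fun j hj => ?_, fun c hc => ?_⟩
  · by_cases hjk : (j : ℕ) = k
    · obtain rfl : j = ⟨k, hk⟩ := Fin.ext hjk
      simp [numArr, denArr]
    · have := h2 j (by omega)
      rw [← this.1, ← this.2]
      simp only [Memory.setArr_arr]
      constructor
      · rw [if_neg (by simp only [numArr, denArr]; omega), if_neg (by simp only [numArr]; omega)]
      · rw [if_neg (by simp only [denArr]; omega), if_neg (by simp only [numArr, denArr]; omega)]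
  · have := hc ⟨k, hk⟩ (by simp)
    simp only at this
    simp only [Memory.setArr_arr, this.1, this.2, if_false]
    exact h3 c fun j hj => hc j (by omega)

namespace Code

/-- The register `r` gets the element of the vector `A` at the index in the variable `w`. -/
noncomputable def vload (d : ℕ) (r : Fin 10) (A : Fin 2) (w : ℕ) : Code where
  prog := progSeq (fun j => .seq (.load (numVar r j) (numArr A j) w)
    (.load (denVar r j) (denArr A j) w)) d
  time := C d * (4 * X + 2) + 1

theorem wp_vload {r : Fin 10} {A : Fin 2} {w i : ℕ} (hw : w < 20) (hi : s.int w = i) {z : K}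
    (hz : (s.vec A)[i]? = some z) (hQ : Q (s.setReg r z)) :
    WP bas O b (vload d r A w) Q s := by
  intro m hm
  have hzs : Small bas b z := hm.vec_small A z (List.mem_of_getElem? hz)
  have hw1 := hm.bitLen_var_le (i := w) (by omega)
  have hwi : (m.var w).toNat = i := by rw [hm.int w hw, hi]; simp
  refine (runs_progSeq_reg (r := r) (T := 4 * b + 2) (fun j => (bas.repr z j).num)
    (fun j => ((bas.repr z j).den : ℤ)) ?_).mono (by simp [vload]) ?_
  · intro j m₁ ha hv
    have e1 : m₁.read (numArr A j) w = (bas.repr z j).num := by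
      simp [Memory.read, ha, hv w hw, hwi, hm.vnum A j, hz]
    have e2 : m₁.read (denArr A j) w = (bas.repr z j).den := by
      simp [Memory.read, ha, hv w hw, hwi, hm.vden A j, hz]
    have n1 : w ≠ numVar r j := by simp only [numVar]; omega
    have n2 : numVar r j ≠ denVar r j := by simp only [numVar, denVar]; omega
    refine Runs.mono (T := (1 + b + b) + (1 + b + b)) (Runs.seq <| Runs.load ?_ <| Runs.load ?_
      ⟨rfl, ?_, ?_, ?_⟩) (by omega) fun _ => id
    · rw [e1, hv w hw]
      have := (hzs j).1
      omega
    · have e3 : (m₁.setVar (numVar r j) (m₁.read (numArr A j) w)).read (denArr A j) w =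
          (bas.repr z j).den := by
        rw [← e2]; simp [Memory.read, n1]
      rw [e3]
      simp only [Memory.setVar_var, n1, if_false]
      rw [hv w hw]
      have := (hzs j).2
      omega
    · simp [n2, e1]
    · simp only [Memory.setVar_var, if_true]
      rw [← e2]; simp [Memory.read, n1]
    · intro i _ h1 h2
      simp [h1, h2]
  · rintro m' ⟨h1, h2, h3⟩
    exact ⟨_, hm.setReg hzs h1 h2 h3, hQ⟩

/-- Append the register `r` to the vector `A`. -/
noncomputable def vpush (d : ℕ) (A : Fin 2) (r : Fin 10) : Code where
  prog := progSeq (fun j => .seq (.push (numArr A j) (numVar r j))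
    (.push (denArr A j) (denVar r j))) d
  time := C d * (2 * X + 2) + 1

theorem numArr_ne_denArr (A : Fin 2) (j : ℕ) : numArr A j ≠ denArr A j := by
  simp only [numArr, denArr]; omega

theorem wp_vpush {A : Fin 2} {r : Fin 10} (hl : (s.vec A).length < b)
    (hQ : Q (s.setVec A (s.vec A ++ [s.reg r]))) : WP bas O b (vpush d A r) Q s := by
  intro m hm
  refine (runs_progSeq_vec (A := A) (T := 2 * b + 2)
    (fun j => (s.vec A ++ [s.reg r]).map fun z => (bas.repr z j).num)
    (fun j => (s.vec A ++ [s.reg r]).map fun z => ((bas.repr z j).den : ℤ)) ?_).mono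
    (by simp [vpush]) ?_
  · intro j m₁ hv h1 h2
    refine Runs.mono (T := (1 + b) + (1 + b)) (Runs.seq <| Runs.push ?_ <| Runs.push ?_ ?_)
      (by omega) fun _ => id
    · rw [hv, hm.num]; simpa using (hm.reg_small r j).1
    · rw [Memory.setArr_var, hv, hm.den]; simpa using (hm.reg_small r j).2
    · simp [hv, h1, h2, hm.vnum, hm.vden, hm.num, hm.den, (numArr_ne_denArr A j).symm]
  · rintro m' ⟨h1, h2, h3⟩
    refine ⟨_, hm.setVec (by simpa) ?_ h1 h2 h3, hQ⟩
    intro z hz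
    rcases List.mem_append.1 hz with hz | hz
    · exact hm.vec_small A z hz
    · rw [List.mem_singleton.1 hz]; exact hm.reg_small r

/-- The element of the vector `A` at the index in the variable `w` gets the value of the
register `r`. -/
noncomputable def vstore (d : ℕ) (A : Fin 2) (w : ℕ) (r : Fin 10) : Code where
  prog := progSeq (fun j => .seq (.store (numArr A j) w (numVar r j))
    (.store (denArr A j) w (denVar r j))) d
  time := C d * (4 * X + 2) + 1

theorem wp_vstore {A : Fin 2} {r : Fin 10} {w i : ℕ} (hw : w < 20) (hi : s.int w = i)
    (hQ : Q (s.setVec A ((s.vec A).set i (s.reg r)))) : WP bas O b (vstore d A w r) Q s := by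
  intro m hm
  have hw1 := hm.bitLen_var_le (i := w) (by omega)
  have hwi : (m.var w).toNat = i := by rw [hm.int w hw, hi]; simp
  refine (runs_progSeq_vec (A := A) (T := 4 * b + 2)
    (fun j => ((s.vec A).set i (s.reg r)).map fun z => (bas.repr z j).num)
    (fun j => ((s.vec A).set i (s.reg r)).map fun z => ((bas.repr z j).den : ℤ)) ?_).mono
    (by simp [vstore]) ?_
  · intro j m₁ hv h1 h2
    refine Runs.mono (T := (1 + b + b) + (1 + b + b)) (Runs.seq <| Runs.store ?_ <| Runs.store ?_ ?_)
      (by omega) fun _ => id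
    · rw [hv, hm.num]
      have := (hm.reg_small r j).1
      omega
    · rw [Memory.setArr_var, hv, hm.den]
      have := (hm.reg_small r j).2
      omega
    · simp [hv, h1, h2, hm.vnum, hm.vden, hm.num, hm.den, (numArr_ne_denArr A j).symm, hwi,
        List.map_set]
  · rintro m' ⟨h1, h2, h3⟩
    refine ⟨_, hm.setVec (by simpa using hm.vec_length A) ?_ h1 h2 h3, hQ⟩
    intro z hz
    rcases List.mem_or_eq_of_mem_set hz with hz | rfl
    · exact hm.vec_small A z hz
    · exact hm.reg_small r

/-- The sum of the squares of the numerators of the first coordinates of a register. -/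
def sqExpr (r : Fin 10) : ℕ → ZExpr
  | 0 => .const 0
  | k + 1 => .op .plus (sqExpr r k) (.op .times (.var (numVar r k)) (.var (numVar r k)))

theorem below_sqExpr (r : Fin 10) (k : ℕ) : (sqExpr r k).Below (20 + 20 * k) := by
  have mono : ∀ (e : ZExpr) (M N : ℕ), M ≤ N → e.Below M → e.Below N := by
    intro e M N hMN
    induction e with
    | var i => exact fun h : i < M => h.trans_le hMN
    | const c => exact fun _ => trivial
    | op o e₁ e₂ h₁ h₂ => exact fun h => ⟨h₁ h.1, h₂ h.2⟩
  induction k with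
  | zero => trivial
  | succ k ih =>
    have h : numVar r k < 20 + 20 * (k + 1) := by simp only [numVar]; omega
    exact ⟨mono _ _ _ (by omega) ih, h, h⟩

theorem sqExpr_eval (r : Fin 10) (k : ℕ) (f : ℕ → ℤ) :
    (sqExpr r k).eval f = ∑ j : Fin k, f (numVar r j) * f (numVar r j) := by
  induction k with
  | zero => rfl
  | succ k ih => rw [Fin.sum_univ_castSucc, sqExpr, ZExpr.eval, ih]; rfl

/-- If the register `r` is not zero, then `v := w`. -/
noncomputable def setIfNe (d v w : ℕ) (r : Fin 10) : Code where
  prog := .seq ((sqExpr r d).compile (20 + 20 * d)) (.branch (20 + 20 * d)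
    (.seq (.const (20 + 20 * d + 1) 0) (.arith .plus v w (20 + 20 * d + 1))) .skip)
  time := (sqExpr r d).time + (C (sqExpr r d).weight * (X + 1) + X + 10)

-- The machine can only test whether an integer is positive. A sum of squares of numerators is
-- positive exactly if some coordinate is nonzero.
open Classical in
theorem wp_setIfNe {v w : ℕ} (hv : v < 20) (hw : w < 20) {r : Fin 10}
    (hQ : Q (s.setInt v (if s.reg r = 0 then s.int v else s.int w))) :
    WP bas O b (setIfNe d v w r) Q s := by
  intro m hm
  simp only [setIfNe, eval_add, eval_mul, eval_C, eval_X, eval_one, eval_ofNat]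
  have hb : ∀ i < 20 + 20 * d, bitLen (m.var i) ≤ b := fun i => hm.bitLen_var_le
  refine Runs.seq ((ZExpr.runs_compile _ (below_sqExpr r d) le_rfl hb).mono le_rfl ?_)
  rintro m₁ ⟨h1, h2, h3⟩
  have hS : bitLen (m₁.var (20 + 20 * d)) ≤ (sqExpr r d).weight * (b + 1) := by
    rw [h1]; exact ZExpr.bitLen_eval_le _ (below_sqExpr r d) hb
  have hpos : 0 < m₁.var (20 + 20 * d) ↔ s.reg r ≠ 0 := by
    rw [h1, sqExpr_eval, Finset.sum_pos_iff_of_nonneg fun j _ => mul_self_nonneg _]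
    simp only [Finset.mem_univ, true_and, mul_self_pos, hm.num]
    rw [← _root_.not_forall_not, not_iff_not]
    refine ⟨fun h => bas.repr.injective ?_, fun h j => by simp [h]⟩
    ext j
    simpa using h j
  have hlt : (if s.reg r = 0 then s.int v else s.int w).natAbs < b := by
    split_ifs
    exacts [hm.int_lt v hv, hm.int_lt w hw]
  by_cases hz : s.reg r = 0
  · have hneg : ¬ 0 < m₁.var (20 + 20 * d) := by rw [hpos]; simpa using hz
    refine ⟨m₁, _, .branch_neg hneg (.skip m₁), by omega, _, hm.setInt hv hlt h3 ?_ ?_, hQ⟩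
    · rw [if_pos hz, h2 v (by omega), hm.int v hv]
    · exact fun i hi _ => h2 i hi
  · have hwb := hm.bitLen_var_le (i := w) (by omega)
    refine ⟨_, _, .branch_pos (hpos.2 hz) ((Exec.const m₁ _ 0).seq (.arith _ .plus v w _)), ?_, _,
      hm.setInt hv hlt h3 ?_ ?_, hQ⟩
    · simp only [Memory.setVar_var, if_true, if_neg (show w ≠ 20 + 20 * d + 1 by omega),
        h2 w (by omega)]
      have : bitLen 0 = 1 := by simp [bitLen]
      rw [this]
      omega
    · simp [hz, ArithOp.apply, show w ≠ 20 + 20 * d + 1 by omega, h2 w (by omega), hm.int w hw]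
    · intro i hi hne
      simp [hne, show i ≠ 20 + 20 * d + 1 by omega, h2 i hi]

end Code

/-! ### The initial state -/

/-- All denominators in the registers are set to `1`. -/
def initProg (d : ℕ) : Prog := progSeq (fun q => .const (20 + 2 * q + 1) 1) (10 * d)

/-- Zeroed memory does not represent zero registers, since `0` in lowest terms has denominator `1`.
-/
theorem runs_initProg {l : List ℤ} (hl : l.length ≤ b) (hs : ∀ x ∈ l, bitLen x ≤ b) (hb : 2 ≤ b) :
    Runs O (initProg d) (Memory.start l) (10 * d * 3 + 1) fun m' =>
      Rep bas b m' ⟨fun _ => 0, fun _ => 0, fun _ => [], fun a => if a = 0 then l else []⟩ := by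
  have h1 : bitLen 1 = 2 := by simp [bitLen]
  have h0 : bitLen 0 = 1 := by simp [bitLen]
  refine (runs_progSeq (T := 3) (fun k m' => m'.arr = (Memory.start l).arr ∧
    (∀ q < k, m'.var (20 + 2 * q + 1) = 1) ∧
    ∀ i, (∀ q, i ≠ 20 + 2 * q + 1) → m'.var i = 0) ?_ ?_).mono le_rfl ?_
  · exact ⟨rfl, fun q hq => absurd hq (Nat.not_lt_zero _), fun _ _ => rfl⟩
  · rintro k hk m₁ ⟨g1, g2, g3⟩
    refine Runs.const (by rw [h1]) ⟨g1, fun q hq => ?_, fun i hi => ?_⟩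
    · by_cases hqk : q = k
      · simp [hqk]
      · simpa [hqk] using g2 q (by omega)
    · simpa [hi k] using g3 i hi
  · rintro m₁ ⟨g1, g2, g3⟩
    have small0 : Small bas b (0 : K) := fun j => by simp [h0, h1]; omega
    refine ⟨fun i hi => g3 i fun q => by omega, fun r j => ?_, fun r j => ?_, fun a ha => ?_,
      fun A j => ?_, fun A j => ?_, fun i hi => by simp; omega, fun r => small0, fun a ha => ?_,
      fun a ha => ?_, fun A => by simp, fun A => by simp⟩
    · rw [g3 _ fun q => by simp only [numVar]; omega]; simp
    -- The number `10 * j + r` enumerates the pairs of a coordinate and a register.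
    · have := g2 (10 * j + r) (by omega)
      rw [show denVar r j = 20 + 2 * (10 * j + r) + 1 by simp only [denVar]; omega, this]; simp
    · rw [g1]; rfl
    · rw [g1]; simp [Memory.start, numArr]
    · rw [g1]; simp [Memory.start, denArr]
    · by_cases h : a = 0 <;> simp [h, hl]
    · by_cases h : a = 0
      · simpa [h] using hs
      · simp [h]

end Field

/-! ### Encodings of field elements in arrays of integers -/

theorem getElem?_flatten_ofFn {α : Type*} {n L : ℕ} {g : Fin n → List α}
    (hg : ∀ i, (g i).length = L) (i : Fin n) {j : ℕ} (hj : j < L) :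
    (List.ofFn g).flatten[(i : ℕ) * L + j]? = (g i)[j]? := by
  induction n with
  | zero => exact i.elim0
  | succ n ih =>
    rw [List.ofFn_succ, List.flatten_cons]
    refine Fin.cases ?_ (fun i => ?_) i
    · rw [Fin.val_zero, zero_mul, zero_add, List.getElem?_append_left (by rw [hg]; exact hj)]
    · rw [List.getElem?_append_right (by rw [hg, Fin.val_succ, add_mul]; omega), hg,
        ← ih (fun i => hg i.succ) i, Fin.val_succ]
      congr 1
      rw [add_mul]; omega

section Enc

variable {K : IntermediateField ℚ ℝ} {d : ℕ} {bas : Module.Basis (Fin d) ℚ K}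
  {b : ℕ} {m : Memory} {s : AState K} {O : List ℤ → List ℤ} {Q : AState K → Prop}

theorem bitLen_le_of_mem_encElem {z : K} (hz : Small bas b z) : ∀ x ∈ encElem bas z, bitLen x ≤ b := by
  intro x hx
  simp only [encElem, List.mem_flatten, List.mem_ofFn] at hx
  obtain ⟨l, ⟨j, rfl⟩, hx⟩ := hx
  rcases List.mem_pair.1 hx with rfl | rfl
  · exact (hz j).1
  · exact (hz j).2

namespace Code

/-- The register `r` gets the field element whose encoding is in the array `a`. -/
noncomputable def decode (d : ℕ) (r : Fin 10) (a : ℕ) : Code where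
  prog := progSeq (fun j => .seq (.const (20 + 20 * d) ((j * 2 : ℕ) : ℤ))
    (.seq (.load (numVar r j) a (20 + 20 * d)) (.seq (.const (20 + 20 * d) ((j * 2 + 1 : ℕ) : ℤ))
      (.load (denVar r j) a (20 + 20 * d))))) d
  time := C d * (2 * X + C (8 * d + 20)) + 1

/-- No bound on `z` has to be assumed: its numerators and denominators are entries of the array `a`,
which `Rep` bounds. -/
theorem wp_decode {r : Fin 10} {a : ℕ} (ha : a < 10) {z : K} (hz : s.arr a = encElem bas z)
    (hQ : Q (s.setReg r z)) : WP bas O b (decode d r a) Q s := by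
  intro m hm
  have hmem : ∀ j : Fin d, ((bas.repr z j).num : ℤ) ∈ encElem bas z ∧
      ((bas.repr z j).den : ℤ) ∈ encElem bas z := fun j => by
    simp only [encElem, List.mem_flatten, List.mem_ofFn]
    exact ⟨⟨_, ⟨j, rfl⟩, by simp⟩, ⟨_, ⟨j, rfl⟩, by simp⟩⟩
  have hzs : Small bas b z := fun j => by
    have h := hm.arr_small a ha
    rw [hz] at h
    exact ⟨h _ (hmem j).1, h _ (hmem j).2⟩
  have hget : ∀ j : Fin d, (encElem bas z)[(j : ℕ) * 2]? = some (bas.repr z j).num ∧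
      (encElem bas z)[(j : ℕ) * 2 + 1]? = some ((bas.repr z j).den : ℤ) := fun j => by
    have h0 := getElem?_flatten_ofFn (L := 2)
      (g := fun i : Fin d => [(bas.repr z i).num, ((bas.repr z i).den : ℤ)]) (by simp) j
      (j := 0) (by norm_num)
    have h1 := getElem?_flatten_ofFn (L := 2)
      (g := fun i : Fin d => [(bas.repr z i).num, ((bas.repr z i).den : ℤ)]) (by simp) j
      (j := 1) (by norm_num)
    exact ⟨h0, h1⟩
  refine (runs_progSeq_reg (r := r) (T := 2 * b + (8 * d + 20)) (fun j => (bas.repr z j).num)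
    (fun j => ((bas.repr z j).den : ℤ)) ?_).mono (by simp [decode]) ?_
  · intro j m₁ harr hv
    have n1 : 20 + 20 * d ≠ numVar r j := by simp only [numVar]; omega
    have n2 : numVar r j ≠ denVar r j := by simp only [numVar, denVar]; omega
    have hj := j.2
    have b1 : bitLen (((j : ℕ) * 2 : ℕ) : ℤ) ≤ 2 * d + 2 := bitLen_le_of_natAbs_lt (by omega)
    have b2 : bitLen (((j : ℕ) * 2 + 1 : ℕ) : ℤ) ≤ 2 * d + 2 := bitLen_le_of_natAbs_lt (by omega)
    have hrd : ∀ m₂ : Memory, m₂.arr = m₁.arr → ∀ k : ℕ, m₂.var (20 + 20 * d) = k →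
        m₂.read a (20 + 20 * d) = (encElem bas z)[k]?.getD 0 := by
      intro m₂ h1 k h2
      simp [Memory.read, h1, h2, harr, hm.arr a ha, hz]
    have e1 : (m₁.setVar (20 + 20 * d) (((j : ℕ) * 2 : ℕ) : ℤ)).read a (20 + 20 * d) =
        (bas.repr z j).num := by
      refine (hrd (m₁.setVar _ _) rfl (j * 2) (by simp)).trans ?_
      rw [(hget j).1]; rfl
    set m₂ := m₁.setVar (20 + 20 * d) (((j : ℕ) * 2 : ℕ) : ℤ) with hm₂
    set m₃ := m₂.setVar (numVar r j) (m₂.read a (20 + 20 * d)) with hm₃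
    have e2 : (m₃.setVar (20 + 20 * d) (((j : ℕ) * 2 + 1 : ℕ) : ℤ)).read a (20 + 20 * d) =
        (bas.repr z j).den := by
      refine (hrd (m₃.setVar _ _) rfl (j * 2 + 1) (by simp)).trans ?_
      rw [(hget j).2]; rfl
    refine Runs.mono (T := (1 + (2 * d + 2)) + ((1 + (2 * d + 2) + b) + ((1 + (2 * d + 2)) +
      (1 + (2 * d + 2) + b)))) (Runs.seq <| Runs.const ?_ <| Runs.seq <| Runs.load ?_ <| Runs.seq <|
      Runs.const ?_ <| Runs.load ?_ ⟨rfl, ?_, ?_, ?_⟩) (by omega) fun _ => id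
    · omega
    · rw [← hm₂, e1]
      have := (hzs j).1
      rw [hm₂]
      simp only [Memory.setVar_var, if_true]
      omega
    · omega
    · rw [← hm₂, ← hm₃, e2]
      have := (hzs j).2
      simp only [Memory.setVar_var, if_true]
      omega
    · rw [← hm₂, ← hm₃, e2]
      simp [n2, n1.symm, hm₃, e1]
    · rw [← hm₂, ← hm₃, e2]
      simp
    · intro i hi h1 h2
      simp [h1, h2, show i ≠ 20 + 20 * d by omega]
  · rintro m' ⟨h1, h2, h3⟩
    exact ⟨_, hm.setReg hzs h1 h2 h3, hQ⟩

/-- Append the encoding of the register `r` to the array `a`. -/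
noncomputable def encode (d a : ℕ) (r : Fin 10) : Code where
  prog := progSeq (fun j => .seq (.push a (numVar r j)) (.push a (denVar r j))) d
  time := C d * (2 * X + 2) + 1

theorem wp_encode {a : ℕ} {r : Fin 10} (ha : a < 10) (hl : (s.arr a).length + d * 2 ≤ b)
    (hQ : Q (s.setArr a (s.arr a ++ encElem bas (s.reg r)))) : WP bas O b (encode d a r) Q s := by
  intro m hm
  set g : Fin d → List ℤ := fun i => [(bas.repr (s.reg r) i).num, ((bas.repr (s.reg r) i).den : ℤ)]
  -- Invariant: the array followed by the blocks still to be written is the final result.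
  refine (runs_progSeq (T := 2 * b + 2) (fun k m' => m'.var = m.var ∧
    (∀ c, c ≠ a → m'.arr c = m.arr c) ∧
    m'.arr a ++ ((List.ofFn g).drop k).flatten = s.arr a ++ encElem bas (s.reg r)) ?_ ?_).mono
    (by simp [encode]) ?_
  · exact ⟨rfl, fun _ _ => rfl, by rw [hm.arr a ha]; rfl⟩
  · rintro k hk m₁ ⟨hv, ho, he⟩
    have h1 := hm.num r ⟨k, hk⟩
    have h2 := hm.den r ⟨k, hk⟩
    refine Runs.mono (T := (1 + b) + (1 + b)) (Runs.seq <| Runs.push ?_ <| Runs.push ?_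
      ⟨hv, ?_, ?_⟩) (by omega) fun _ => id
    · rw [hv, h1]; simpa using (hm.reg_small r _).1
    · rw [Memory.setArr_var, hv, h2]; simpa using (hm.reg_small r _).2
    · intro c hc
      simp [hc, ho c hc]
    · rw [← he, List.drop_eq_getElem_cons (i := k) (by simpa using hk)]
      simp only [Memory.setArr_arr, if_true, Memory.setArr_var, hv, h1, h2]
      simp [g]
  · rintro m' ⟨hv, ho, he⟩
    rw [List.drop_of_length_le (by simp), List.flatten_nil, List.append_nil] at he
    refine ⟨_, hm.setArr ha ?_ ?_ hv he ho, hQ⟩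
    · rw [List.length_append, encElem_length]; exact hl
    · intro x hx
      rcases List.mem_append.1 hx with hx | hx
      · exact hm.arr_small a ha x hx
      · exact bitLen_le_of_mem_encElem (hm.reg_small r) x hx

end Code

end Enc

/-! ### Cloning of vertices -/

namespace LoopGraph

variable {V W : Type*}

/-- The graph on `W` in which every vertex `a` of `W` is a copy of the vertex `π a`. -/
def comap (G : LoopGraph V) (π : W → V) : LoopGraph W where
  Adj a c := G.Adj (π a) (π c)
  symm _ _ h := G.symm _ _ h

/-- Selecting rows and columns, with repetitions allowed, is multiplication by `0`-`1` matrices on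
both sides. -/
theorem rank_submatrix_le_rank {m n m' n' : Type*} [Fintype m] [Fintype n] [Fintype m']
    [Fintype n'] {F : Type*} [Field F] (A : Matrix m n F) (f : m' → m) (g : n' → n) :
    (A.submatrix f g).rank ≤ A.rank := by
  classical
  have h : A.submatrix f g =
      (1 : Matrix m m F).submatrix f id * (A * (1 : Matrix n n F).submatrix id g) := by
    ext i j
    simp [Matrix.mul_apply, Matrix.one_apply]
  rw [h]
  exact (Matrix.rank_mul_le_right _ _).trans (Matrix.rank_mul_le_left _ _)

/-- With a section of `π`, each of the two adjacency matrices is a submatrix of the other. -/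
theorem rk_comap [Fintype V] [Fintype W] (G : LoopGraph V) {π : W → V}
    (hπ : Function.Surjective π) : (G.comap π).rk = G.rk := by
  obtain ⟨σ, hσ⟩ := hπ.hasRightInverse
  have h1 : (G.comap π).adjMatrix = G.adjMatrix.submatrix π π := rfl
  have h2 : G.adjMatrix = (G.comap π).adjMatrix.submatrix σ σ := by
    rw [h1, Matrix.submatrix_submatrix, hσ.comp_eq_id, Matrix.submatrix_id_id]
  refine le_antisymm ?_ ?_
  · rw [rk, h1]; exact rank_submatrix_le_rank _ _ _
  · rw [rk, h2]; exact rank_submatrix_le_rank _ _ _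

theorem rk_le_card [Fintype V] (G : LoopGraph V) : G.rk ≤ Fintype.card V :=
  Matrix.rank_le_card_width _

/-- The graph induced on `A` is itself a cloning of the graph induced on the image of `A`, along the
surjection that `π` restricts to. -/
theorem rk_induce_comap [DecidableEq V] (G : LoopGraph V) (π : W → V) (A : Finset W) :
    ((G.comap π).induce A).rk = (G.induce (A.image π)).rk := by
  have hs : Function.Surjective
      fun a : A => (⟨π a, Finset.mem_image_of_mem π a.2⟩ : A.image π) := by
    rintro ⟨v, hv⟩
    obtain ⟨a, ha, rfl⟩ := Finset.mem_image.1 hv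
    exact ⟨⟨a, ha⟩, rfl⟩
  have h : (G.comap π).induce A = (G.induce (A.image π)).comap
      fun a : A => (⟨π a, Finset.mem_image_of_mem π a.2⟩ : A.image π) := rfl
  rw [h]
  exact rk_comap _ hs

/-- Summed over all subsets of `B`, both sides give `(1 + x) ^ (k * |B|)`: the left one because a
set has its image inside `B` exactly if it lies in the preimage of `B`, which has `k * |B|`
elements, the right one by the binomial theorem. Strong induction on `B` cancels the proper subsets.
-/
theorem sum_image_eq [Fintype W] [DecidableEq V] {R : Type*} [CommRing R]
    {π : W → V} {k : ℕ} (hk : ∀ v, (Finset.univ.filter fun a => π a = v).card = k) (x : R)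
    (B : Finset V) :
    ∑ A : Finset W with A.image π = B, x ^ A.card = ((1 + x) ^ k - 1) ^ B.card := by
  classical
  induction B using Finset.strongInduction with
  | H B ih =>
    set S : Finset V → R := fun B => ∑ A : Finset W with A.image π = B, x ^ A.card with hS
    have h1 : ∑ B' ∈ B.powerset, S B' = (1 + x) ^ (k * B.card) := by
      have hpre : (Finset.univ.filter fun a => π a ∈ B).card = k * B.card := by
        rw [Finset.card_eq_sum_card_fiberwise (f := π) (t := B) (by intro a; simp)]
        rw [Finset.sum_congr rfl (g := fun _ => k), Finset.sum_const, smul_eq_mul, mul_comm]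
        intro v hv
        rw [← hk v, Finset.filter_filter]
        congr 1
        ext a
        simp only [Finset.mem_filter, Finset.mem_univ, true_and]
        exact ⟨fun h => h.2, fun h => ⟨h ▸ hv, h⟩⟩
      have h2 := Finset.sum_pow_mul_eq_add_pow x 1 (Finset.univ.filter fun a => π a ∈ B)
      simp only [one_pow, mul_one] at h2
      rw [hpre, add_comm] at h2
      rw [← h2, hS]
      symm
      rw [← Finset.sum_fiberwise_of_maps_to (g := fun A : Finset W => A.image π) (t := B.powerset)]
      · refine Finset.sum_congr rfl fun B' hB' => Finset.sum_congr ?_ fun _ _ => rfl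
        ext A
        simp only [Finset.mem_filter, Finset.mem_univ, true_and, Finset.mem_powerset]
        refine ⟨fun h => h.2, fun h => ⟨fun a ha => ?_, h⟩⟩
        simp only [Finset.mem_filter, Finset.mem_univ, true_and]
        exact Finset.mem_powerset.1 hB' (h ▸ Finset.mem_image_of_mem π ha)
      · intro A hA
        rw [Finset.mem_powerset] at hA ⊢
        intro v hv
        obtain ⟨a, ha, rfl⟩ := Finset.mem_image.1 hv
        simpa using hA ha
    have h2 : ∑ B' ∈ B.powerset, ((1 + x) ^ k - 1) ^ B'.card = (1 + x) ^ (k * B.card) := by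
      have := Finset.sum_pow_mul_eq_add_pow ((1 + x) ^ k - 1) 1 B
      simpa [pow_mul] using this
    have hmem := Finset.mem_powerset_self B
    rw [← Finset.add_sum_erase _ _ hmem] at h1 h2
    have h3 : ∑ B' ∈ B.powerset.erase B, S B' =
        ∑ B' ∈ B.powerset.erase B, ((1 + x) ^ k - 1) ^ B'.card := by
      refine Finset.sum_congr rfl fun B' hB' => ih B' ?_
      rw [Finset.mem_erase, Finset.mem_powerset] at hB'
      exact hB'.2.ssubset_of_ne hB'.1
    rw [h3, ← h2] at h1
    exact add_right_cancel h1

/-- Cloning every vertex `k - 1` times amounts to a substitution in the interlace polynomial. -/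
theorem P_comap [Fintype V] [Fintype W] [DecidableEq V] {R : Type*} [CommRing R] (G : LoopGraph V)
    {π : W → V} {k : ℕ} (hk : ∀ v, (Finset.univ.filter fun a => π a = v).card = k) (u x : R) :
    (G.comap π).P u x = G.P u ((1 + x) ^ k - 1) := by
  simp only [P, rk_induce_comap]
  rw [← Finset.sum_fiberwise (g := fun A : Finset W => A.image π)]
  refine Finset.sum_congr rfl fun B _ => ?_
  rw [← sum_image_eq hk, Finset.sum_mul]
  refine Finset.sum_congr rfl fun A hA => ?_
  rw [(Finset.mem_filter.1 hA).2]

/-- Every vertex is replaced by `k` copies. -/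
def clone {n : ℕ} (G : LoopGraph (Fin n)) (k : ℕ) : LoopGraph (Fin (n * k)) := G.comap Fin.divNat

/-- The copies of a vertex are told apart by `Fin.modNat`, so each fibre of `Fin.divNat` has `k`
elements. -/
theorem P_clone {n : ℕ} {R : Type*} [CommRing R] (G : LoopGraph (Fin n)) (k : ℕ) (u x : R) :
    (G.clone k).P u x = G.P u ((1 + x) ^ k - 1) := by
  refine G.P_comap (fun v => ?_) u x
  refine Eq.trans (b := (Finset.univ : Finset (Fin k)).card) ?_ (by simp)
  refine Finset.card_bij' (fun a _ => a.modNat) (fun j _ => finProdFinEquiv (v, j)) (by simp) ?_ ?_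
    ?_
  · intro j _
    have := congrArg Prod.fst (finProdFinEquiv.symm_apply_apply (v, j))
    exact Finset.mem_filter.2 ⟨Finset.mem_univ _, this⟩
  · intro a ha
    have h1 : a.divNat = v := (Finset.mem_filter.1 ha).2
    rw [← h1]
    exact finProdFinEquiv.apply_symm_apply a
  · intro j _
    exact congrArg Prod.snd (finProdFinEquiv.symm_apply_apply (v, j))

/-! ### Values, coefficients and degree of the interlace polynomial -/

theorem eval_P [Fintype V] {R : Type*} [CommRing R] (G : LoopGraph V) (u x : R) :
    (G.P (C u) X).eval x = G.P u x := by
  simp [P, eval_finsetSum]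

theorem coeff_P [Fintype V] {R : Type*} [CommRing R] (G : LoopGraph V) (u : R) (j : ℕ) :
    (G.P (C u) X).coeff j = ∑ A : Finset V with A.card = j, u ^ (G.induce A).rk := by
  simp only [P, finsetSum_coeff, ← C_pow, coeff_X_pow_mul', coeff_C]
  rw [Finset.sum_filter]
  refine Finset.sum_congr rfl fun A _ => ?_
  by_cases h : A.card = j
  · simp [h]
  · rw [if_neg h]
    split_ifs <;> first | rfl | omega

theorem natDegree_P_le [Fintype V] {R : Type*} [CommRing R] (G : LoopGraph V) (u : R) :
    (G.P (C u) X).natDegree ≤ Fintype.card V := by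
  rw [natDegree_le_iff_coeff_eq_zero]
  intro j hj
  rw [coeff_P, Finset.filter_false_of_mem, Finset.sum_empty]
  intro A _ hA
  have := A.card_le_univ
  omega

end LoopGraph

/-! ### Heights -/

section Heights

variable {K : Type*} [Field K] [Algebra ℚ K] {d : ℕ} (bas : Module.Basis (Fin d) ℚ K)

/-- Constants for which `Ht` is a submultiplicative height. -/
structure HtData (D c s : ℕ) : Prop where
  two_le : 2 ≤ s
  c_pos : 0 < c
  D_pos : 0 < D
  mul_coeff : ∃ γ : Fin d → Fin d → Fin d → ℤ,
    (∀ k l i, (D : ℚ) * bas.repr (bas k * bas l) i = γ k l i) ∧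
    ∀ i, ∑ k, ∑ l, (γ k l i).natAbs ≤ c

/-- `s ^ a * z` has integral coordinates with respect to the basis multiplied by `D`, of size at
most `s ^ (2 * a) / c`. -/
def Ht (D c s a : ℕ) (z : K) : Prop :=
  ∃ v : Fin d → ℤ, ∀ i, c * (v i).natAbs ≤ s ^ (2 * a) ∧ (s : ℚ) ^ a * bas.repr z i = D * v i

theorem exists_common_den {ι : Type*} [Fintype ι] (f : ι → ℚ) :
    ∃ t : ℕ, 0 < t ∧ ∀ i, ∃ m : ℤ, (t : ℚ) * f i = m := by
  classical
  refine ⟨∏ i, (f i).den, Finset.prod_pos fun i _ => (f i).pos, fun i => ?_⟩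
  refine ⟨(∏ j ∈ Finset.univ.erase i, (f j).den : ℕ) * (f i).num, ?_⟩
  rw [← Finset.mul_prod_erase _ _ (Finset.mem_univ i)]
  push_cast
  have := Rat.den_mul_eq_num (f i)
  rw [mul_right_comm, this, mul_comm]

theorem exists_htData {ι : Type*} [Fintype ι] (z : ι → K) :
    ∃ D c s, HtData bas D c s ∧ ∀ j, Ht bas D c s 1 (z j) := by
  obtain ⟨D, hD, hγ⟩ := exists_common_den
    fun q : Fin d × Fin d × Fin d => bas.repr (bas q.1 * bas q.2.1) q.2.2
  choose γ hγ using hγ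
  obtain ⟨t, ht, hm⟩ := exists_common_den fun q : ι × Fin d => bas.repr (z q.1) q.2
  choose m hm using hm
  set c := 1 + ∑ i, ∑ k, ∑ l, (γ (k, l, i)).natAbs with hc
  set M := 2 + ∑ q, c * (m q).natAbs with hM
  -- In `s = D * t * M` the factor `t` clears the denominators of the given elements, `D` supplies
  -- the factor `D` that `Ht` requires of integral coordinates, and `M` dominates `c` times every
  -- numerator and ensures `2 ≤ s`.
  refine ⟨D, c, D * t * M, ⟨?_, by omega, hD, fun k l i => γ (k, l, i), fun k l i => hγ (k, l, i),
    fun i => ?_⟩, fun j => ⟨fun i => m (j, i) * M, fun i => ⟨?_, ?_⟩⟩⟩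
  · calc 2 ≤ 1 * 1 * M := by omega
      _ ≤ D * t * M := by gcongr <;> omega
  · have := Finset.single_le_sum (f := fun i => ∑ k, ∑ l, (γ (k, l, i)).natAbs)
      (fun _ _ => Nat.zero_le _) (Finset.mem_univ i)
    exact this.trans (by omega)
  · have h1 : c * (m (j, i)).natAbs ≤ M := by
      have := Finset.single_le_sum (f := fun q => c * (m q).natAbs)
        (fun _ _ => Nat.zero_le _) (Finset.mem_univ (j, i))
      omega
    have h2 : M ≤ D * t * M := Nat.le_mul_of_pos_left _ (Nat.mul_pos hD ht)
    rw [Int.natAbs_mul, Int.natAbs_natCast, ← mul_assoc, mul_one, pow_two]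
    exact Nat.mul_le_mul (h1.trans h2) h2
  · have := hm (j, i)
    simp only at this
    push_cast
    rw [← this]
    ring

variable {bas} {D c s : ℕ}

namespace Ht

variable {a a' : ℕ} {z w : K}

theorem mono (hd : HtData bas D c s) (hz : Ht bas D c s a z) (h : a ≤ a') : Ht bas D c s a' z := by
  obtain ⟨k, rfl⟩ := Nat.exists_eq_add_of_le h
  obtain ⟨v, hv⟩ := hz
  refine ⟨fun i => s ^ k * v i, fun i => ⟨?_, ?_⟩⟩
  · rw [Int.natAbs_mul, Int.natAbs_pow, Int.natAbs_natCast, mul_left_comm]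
    calc s ^ k * (c * (v i).natAbs) ≤ s ^ k * s ^ (2 * a) := Nat.mul_le_mul_left _ (hv i).1
      _ ≤ s ^ (2 * (a + k)) := by
        rw [← pow_add]; exact Nat.pow_le_pow_right (by have := hd.two_le; omega) (by omega)
  · rw [pow_add, mul_right_comm, (hv i).2]
    push_cast
    ring

theorem zero (a : ℕ) : Ht bas D c s a (0 : K) := ⟨0, fun i => by simp⟩

theorem neg (hz : Ht bas D c s a z) : Ht bas D c s a (-z) := by
  obtain ⟨v, hv⟩ := hz
  exact ⟨fun i => -v i, fun i => ⟨by simpa using (hv i).1, by simp [(hv i).2]⟩⟩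

/-- The exponent grows only with the logarithm of the number of terms, so sums over all subsets of
the vertices are affordable. -/
theorem sum {ι : Type*} (t : Finset ι) {f : ι → K} (hf : ∀ i ∈ t, Ht bas D c s a (f i))
    (ht : t.card ≤ s ^ a') : Ht bas D c s (a + a') (∑ i ∈ t, f i) := by
  choose! v hv using hf
  refine ⟨fun i => s ^ a' * ∑ j ∈ t, v j i, fun i => ⟨?_, ?_⟩⟩
  · rw [Int.natAbs_mul, Int.natAbs_pow, Int.natAbs_natCast, mul_left_comm]
    have h1 : c * (∑ j ∈ t, v j i).natAbs ≤ s ^ a' * s ^ (2 * a) := by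
      calc c * (∑ j ∈ t, v j i).natAbs ≤ c * ∑ j ∈ t, (v j i).natAbs :=
            Nat.mul_le_mul_left _ (Int.natAbs_sum_le _ _)
        _ = ∑ j ∈ t, c * (v j i).natAbs := Finset.mul_sum _ _ _
        _ ≤ ∑ j ∈ t, s ^ (2 * a) := Finset.sum_le_sum fun j hj => (hv j hj i).1
        _ = t.card * s ^ (2 * a) := by rw [Finset.sum_const, smul_eq_mul]
        _ ≤ _ := Nat.mul_le_mul_right _ ht
    refine (Nat.mul_le_mul_left _ h1).trans (le_of_eq ?_)
    ring
  · rw [map_sum, Finsupp.finsetSum_apply]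
    have h2 : ∀ j ∈ t, (s : ℚ) ^ a * bas.repr (f j) i = D * v j i := fun j hj => (hv j hj i).2
    push_cast
    rw [pow_add, mul_right_comm, Finset.mul_sum, Finset.sum_congr rfl h2, ← Finset.mul_sum]
    ring

theorem add (hd : HtData bas D c s) (hz : Ht bas D c s a z) (hw : Ht bas D c s a w) : Ht bas D c s (a + 1) (z + w) := by
  have h := sum (bas := bas) (D := D) (c := c) (s := s) (Finset.univ : Finset (Fin 2))
    (f := ![z, w]) (a := a) (a' := 1) ?_ (by simpa using hd.two_le)
  · simpa using h
  · intro i _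
    fin_cases i
    exacts [hz, hw]

theorem sub (hd : HtData bas D c s) (hz : Ht bas D c s a z) (hw : Ht bas D c s a w) : Ht bas D c s (a + 1) (z - w) := by
  rw [sub_eq_add_neg]; exact add hd hz (neg hw)

/-- Exponents add up without loss. Of the two factors `D`, one clears the denominators of the
structure constants; of the two factors `c`, one absorbs the sum of the absolute values of the
resulting integers. -/
theorem mul (hd : HtData bas D c s) (hz : Ht bas D c s a z) (hw : Ht bas D c s a' w) : Ht bas D c s (a + a') (z * w) := by
  obtain ⟨γ, hγ, hγc⟩ := hd.mul_coeff
  obtain ⟨v, hv⟩ := hz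
  obtain ⟨v', hv'⟩ := hw
  refine ⟨fun i => ∑ k, ∑ l, v k * v' l * γ k l i, fun i => ⟨?_, ?_⟩⟩
  · refine Nat.le_of_mul_le_mul_left ?_ hd.c_pos
    have h1 : ∀ k l, c * (c * (v k * v' l * γ k l i).natAbs) ≤
        s ^ (2 * (a + a')) * (γ k l i).natAbs := by
      intro k l
      rw [Int.natAbs_mul, Int.natAbs_mul]
      calc c * (c * ((v k).natAbs * (v' l).natAbs * (γ k l i).natAbs))
          = (c * (v k).natAbs) * (c * (v' l).natAbs) * (γ k l i).natAbs := by ring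
        _ ≤ s ^ (2 * a) * s ^ (2 * a') * (γ k l i).natAbs :=
          Nat.mul_le_mul_right _ (Nat.mul_le_mul (hv k).1 (hv' l).1)
        _ = _ := by ring
    calc c * (c * (∑ k, ∑ l, v k * v' l * γ k l i).natAbs)
        ≤ c * (c * ∑ k, ∑ l, (v k * v' l * γ k l i).natAbs) := by
          refine Nat.mul_le_mul_left _ (Nat.mul_le_mul_left _ ((Int.natAbs_sum_le _ _).trans ?_))
          exact Finset.sum_le_sum fun k _ => Int.natAbs_sum_le _ _
      _ = ∑ k, ∑ l, c * (c * (v k * v' l * γ k l i).natAbs) := by simp only [Finset.mul_sum]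
      _ ≤ ∑ k, ∑ l, s ^ (2 * (a + a')) * (γ k l i).natAbs :=
          Finset.sum_le_sum fun k _ => Finset.sum_le_sum fun l _ => h1 k l
      _ = s ^ (2 * (a + a')) * ∑ k, ∑ l, (γ k l i).natAbs := by simp only [Finset.mul_sum]
      _ ≤ s ^ (2 * (a + a')) * c := Nat.mul_le_mul_left _ (hγc i)
      _ = _ := mul_comm _ _
  · rw [repr_mul_eq bas z w]
    push_cast
    simp only [Finset.mul_sum]
    refine Finset.sum_congr rfl fun k _ => Finset.sum_congr rfl fun l _ => ?_
    rw [← hγ k l i]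
    calc (s : ℚ) ^ (a + a') * (bas.repr z k * bas.repr w l * bas.repr (bas k * bas l) i)
        = (s ^ a * bas.repr z k) * (s ^ a' * bas.repr w l) * bas.repr (bas k * bas l) i := by ring
      _ = _ := by rw [(hv k).2, (hv' l).2]; ring

theorem pow (hd : HtData bas D c s) (h1 : Ht bas D c s 1 (1 : K)) (hz : Ht bas D c s 1 z) (k : ℕ) :
    Ht bas D c s (k + 1) (z ^ k) := by
  induction k with
  | zero => simpa using h1
  | succ k ih => rw [pow_succ]; exact mul hd ih hz

/-- Each coordinate is a fraction `D * v / s ^ a` with `v` at most `s ^ (2 * a)`. Since `s ≤ 2 ^ s`,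
both parts have length linear in `a`, and lowest terms are no longer. -/
theorem small (hd : HtData bas D c s) (hz : Ht bas D c s a z) : Small bas ((D + 2 * s + 2) * (a + 1)) z := by
  obtain ⟨v, hv⟩ := hz
  intro i
  have hs0 : 0 < s := by have := hd.two_le; omega
  have hpos : (0 : ℤ) < (s : ℤ) ^ a := by positivity
  have hq : bas.repr z i = ((D * v i : ℤ) : ℚ) / ((s : ℤ) ^ a : ℤ) := by
    have h := (hv i).2
    rw [eq_div_iff (by positivity)]
    push_cast
    rw [← h]; ring
  obtain ⟨hnum, hden⟩ := num_den_div (x := D * v i) hpos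
  rw [← hq] at hnum hden
  have hpow : ∀ e, s ^ e ≤ 2 ^ (s * e) := fun e => by
    rw [pow_mul]; exact Nat.pow_le_pow_left s.lt_two_pow_self.le e
  have hc := hd.c_pos
  constructor
  · rw [hnum]
    refine (bitLen_ediv_le _ _).trans (le_trans (b := (D + s * (2 * a)) + 1) ?_ ?_)
    · rw [bitLen_le_succ_iff, Int.natAbs_mul, Int.natAbs_natCast, pow_add]
      have h1 : (v i).natAbs ≤ 2 ^ (s * (2 * a)) := by
        refine le_trans ?_ ((hv i).1.trans (hpow _))
        exact Nat.le_mul_of_pos_left _ hc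
      exact Nat.mul_lt_mul_of_lt_of_le D.lt_two_pow_self h1 (by positivity)
    · nlinarith
  · rw [hden]
    refine (bitLen_ediv_le _ _).trans (le_trans (b := (s * a + 1) + 1) ?_ ?_)
    · rw [bitLen_le_succ_iff, Int.natAbs_pow, Int.natAbs_natCast]
      have := hpow a
      have h2 : 0 < 2 ^ (s * a) := by positivity
      rw [pow_succ]
      omega
    · nlinarith

end Ht

end Heights

/-! ### Newton interpolation -/

section Newton

variable {K : Type*} [Field K]

/-- The product of the first `k` linear factors `X - x j`. -/
noncomputable def nodalPoly (x : ℕ → K) : ℕ → K[X]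
  | 0 => 1
  | k + 1 => nodalPoly x k * (X - C (x k))

/-- The quotient of `p` by the product of the first `k` linear factors. -/
noncomputable def newtonQuot (x : ℕ → K) (p : K[X]) : ℕ → K[X]
  | 0 => p
  | k + 1 => newtonQuot x p k /ₘ (X - C (x k))

/-- The polynomial that interpolates `p` at the first `k` points. -/
noncomputable def newtonPoly (x : ℕ → K) (p : K[X]) : ℕ → K[X]
  | 0 => 0
  | k + 1 => newtonPoly x p k + C ((newtonQuot x p k).eval (x k)) * nodalPoly x k

/-- The partial results of the evaluation at `x`, by Horner's rule, of the polynomial with `N`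
coefficients `f`. -/
def horner (f : ℕ → K) (x : K) (N : ℕ) : ℕ → K
  | 0 => 0
  | i + 1 => horner f x N i * x + f (N - 1 - i)

variable {x : ℕ → K} {p : K[X]}

/-- In each step the quotient is divided once more by a linear factor, and the remainder is the
constant by which the nodal polynomial is multiplied. -/
theorem newton_identity (k : ℕ) : p = newtonPoly x p k + nodalPoly x k * newtonQuot x p k := by
  induction k with
  | zero => simp [newtonPoly, nodalPoly, newtonQuot]
  | succ k ih =>
    have h := modByMonic_add_div (newtonQuot x p k) (X - C (x k))
    rw [modByMonic_X_sub_C_eq_C_eval] at h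
    conv_lhs => rw [ih, ← h]
    simp only [newtonPoly, nodalPoly, newtonQuot]
    ring

theorem nodalPoly_eval_ne_zero {k : ℕ} {y : K} (h : ∀ j < k, x j ≠ y) :
    (nodalPoly x k).eval y ≠ 0 := by
  induction k with
  | zero => simp [nodalPoly]
  | succ k ih =>
    simp only [nodalPoly, eval_mul, eval_sub, eval_X, eval_C]
    exact mul_ne_zero (ih fun j hj => h j (by omega)) (sub_ne_zero.2 (h k (by omega)).symm)

/-- The left side is what the program computes from an oracle answer. The right side involves only
division by monic polynomials, which gives access to its height. -/
theorem newton_coeff {k : ℕ} (h : ∀ j < k, x j ≠ x k) :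
    (p.eval (x k) - (newtonPoly x p k).eval (x k)) / (nodalPoly x k).eval (x k) =
      (newtonQuot x p k).eval (x k) := by
  rw [div_eq_iff (nodalPoly_eval_ne_zero h)]
  have h := congrArg (eval (x k)) (newton_identity (x := x) (p := p) k)
  rw [eval_add, eval_mul] at h
  linear_combination h

theorem natDegree_newtonQuot (k : ℕ) : (newtonQuot x p k).natDegree = p.natDegree - k := by
  induction k with
  | zero => rfl
  | succ k ih =>
    rw [newtonQuot, natDegree_divByMonic _ (monic_X_sub_C _), ih, natDegree_X_sub_C]
    omega

theorem newtonQuot_eq_zero {k : ℕ} (h : p.natDegree < k) : newtonQuot x p k = 0 := by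
  obtain ⟨k, rfl⟩ : ∃ j, k = j + 1 := ⟨k - 1, by omega⟩
  rw [newtonQuot, divByMonic_eq_zero_iff (monic_X_sub_C _), degree_X_sub_C]
  have h1 : (newtonQuot x p k).natDegree = 0 := by rw [natDegree_newtonQuot]; omega
  rw [eq_C_of_natDegree_eq_zero h1]
  exact lt_of_le_of_lt degree_C_le (by norm_num)

theorem newtonPoly_eq {k : ℕ} (h : p.natDegree < k) : newtonPoly x p k = p := by
  have := newton_identity (x := x) (p := p) k
  rw [newtonQuot_eq_zero h, mul_zero, add_zero] at this
  exact this.symm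

theorem natDegree_nodalPoly (k : ℕ) : (nodalPoly x k).natDegree = k := by
  have hm : ∀ k, (nodalPoly x k).Monic := fun k => by
    induction k with
    | zero => exact monic_one
    | succ k ih => exact ih.mul (monic_X_sub_C _)
  induction k with
  | zero => simp [nodalPoly]
  | succ k ih => rw [nodalPoly, (hm k).natDegree_mul (monic_X_sub_C _), ih, natDegree_X_sub_C]

theorem natDegree_newtonPoly_lt {k N : ℕ} (h : k ≤ N) (hN : 0 < N) :
    (newtonPoly x p k).natDegree < N := by
  induction k with
  | zero => simpa [newtonPoly] using hN
  | succ k ih =>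
    refine lt_of_le_of_lt (natDegree_add_le _ _) (max_lt (ih (by omega)) ?_)
    refine lt_of_le_of_lt (natDegree_C_mul_le _ _) ?_
    rw [natDegree_nodalPoly]
    omega

theorem horner_eq_sum (f : ℕ → K) (y : K) {N i : ℕ} (hi : i ≤ N) :
    horner f y N i = ∑ t ∈ Finset.range i, f (N - i + t) * y ^ t := by
  induction i with
  | zero => simp [horner]
  | succ i ih =>
    rw [horner, ih (by omega), Finset.sum_range_succ', Finset.sum_mul, pow_zero, mul_one, add_zero]
    congr 1
    · refine Finset.sum_congr rfl fun t _ => ?_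
      rw [show N - (i + 1) + (t + 1) = N - i + t by omega]
      ring
    · congr 1
      omega

theorem horner_eval {q : K[X]} {N : ℕ} (h : q.natDegree < N) (y : K) :
    horner q.coeff y N N = q.eval y := by
  rw [horner_eq_sum _ _ le_rfl, eval_eq_sum_range' h]
  simp

/-- This is the update rule of `updateCode`, where register `6` holds the preceding old coefficient,
or `0` at the start. -/
theorem coeff_nodalPoly_succ (k i : ℕ) : (nodalPoly x (k + 1)).coeff i =
    (if i = 0 then 0 else (nodalPoly x k).coeff (i - 1)) - x k * (nodalPoly x k).coeff i := by
  rw [nodalPoly]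
  cases i with
  | zero => simp [mul_sub, mul_comm]
  | succ i => rw [coeff_mul_X_sub_C]; simp [mul_comm]

variable [Algebra ℚ K] {d : ℕ} {bas : Module.Basis (Fin d) ℚ K} {D c s : ℕ}

/-- Each round costs a multiplication by `y`, which adds `e` to the exponent, and an addition, which
adds `1`. -/
theorem ht_horner (hd : HtData bas D c s) {f : ℕ → K} {y : K} {a e : ℕ}
    (hf : ∀ i, Ht bas D c s a (f i)) (hy : Ht bas D c s e y) (N i : ℕ) :
    Ht bas D c s (a + i * (e + 1)) (horner f y N i) := by
  induction i with
  | zero => exact Ht.zero _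
  | succ i ih =>
    refine (Ht.add hd (ih.mul hd hy) ((hf _).mono hd ?_)).mono hd (le_of_eq ?_)
    · rw [add_assoc]; exact Nat.le_add_right _ _
    · ring

theorem ht_coeff_nodalPoly (hd : HtData bas D c s) {e k : ℕ} (h1 : Ht bas D c s 1 (1 : K))
    (hx : ∀ j < k, Ht bas D c s e (x j)) (i : ℕ) :
    Ht bas D c s (1 + k * (e + 1)) ((nodalPoly x k).coeff i) := by
  induction k generalizing i with
  | zero =>
    rw [nodalPoly, coeff_one]
    split_ifs
    · exact h1.mono hd (by omega)
    · exact Ht.zero _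
  | succ k ih =>
    have ih' := ih fun j hj => hx j (by omega)
    have h2 : Ht bas D c s (1 + k * (e + 1) + e)
        (if i = 0 then 0 else (nodalPoly x k).coeff (i - 1)) := by
      split_ifs
      · exact Ht.zero _
      · exact (ih' _).mono hd (by omega)
    rw [coeff_nodalPoly_succ]
    refine (Ht.sub hd h2 (((hx k (by omega)).mul hd (ih' i)).mono hd (by omega))).mono hd ?_
    exact le_of_eq (by ring)

/-- Synthetic division runs from the top coefficient downwards, with one product and one sum for
each coefficient and no inversion. -/
theorem ht_coeff_divByMonic (hd : HtData bas D c s) {q : K[X]} {y : K} {a e N : ℕ}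
    (hq : ∀ i, Ht bas D c s a (q.coeff i)) (hN : q.natDegree < N) (hy : Ht bas D c s e y) (i : ℕ) :
    Ht bas D c s (a + N * (e + 1)) ((q /ₘ (X - C y)).coeff i) := by
  have hdeg : (q /ₘ (X - C y)).natDegree < N :=
    lt_of_le_of_lt (by rw [natDegree_divByMonic _ (monic_X_sub_C _)]; omega) hN
  -- Here `k` bounds the distance of the index from `N`, where all coefficients vanish.
  have main : ∀ k i, N ≤ i + k → Ht bas D c s (a + k * (e + 1)) ((q /ₘ (X - C y)).coeff i) := by
    intro k
    induction k with
    | zero =>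
      intro i hi
      rw [coeff_eq_zero_of_natDegree_lt (by omega)]
      exact Ht.zero _
    | succ k ih =>
      intro i hi
      rw [coeff_divByMonic_X_sub_C_rec]
      refine (Ht.add hd ((hq _).mono hd ?_) (hy.mul hd (ih (i + 1) (by omega)))).mono hd
        (le_of_eq ?_)
      · omega
      · ring
  exact main N i (by omega)

theorem ht_coeff_newtonQuot (hd : HtData bas D c s) {a e N k : ℕ}
    (hp : ∀ i, Ht bas D c s a (p.coeff i)) (hN : p.natDegree < N)
    (hx : ∀ j < k, Ht bas D c s e (x j)) (i : ℕ) :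
    Ht bas D c s (a + k * (N * (e + 1))) ((newtonQuot x p k).coeff i) := by
  induction k generalizing i with
  | zero => exact (hp i).mono hd (by omega)
  | succ k ih =>
    refine (ht_coeff_divByMonic hd (ih fun j hj => hx j (by omega)) (N := N) ?_
      (hx k (by omega)) i).mono hd (le_of_eq (by ring))
    rw [natDegree_newtonQuot]
    omega

theorem ht_eval (hd : HtData bas D c s) {q : K[X]} {a e N : ℕ} {y : K}
    (hq : ∀ i, Ht bas D c s a (q.coeff i)) (hN : q.natDegree < N) (hy : Ht bas D c s e y) :
    Ht bas D c s (a + N * (e + 1)) (q.eval y) := by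
  rw [← horner_eval hN]
  exact ht_horner hd hq hy N N

/-- The exponent collects the iterated divisions and one evaluation for the Newton coefficient, the
nodal coefficient by which it is multiplied, and one unit for each of the `k` additions. -/
theorem ht_coeff_newtonPoly (hd : HtData bas D c s) {a e N k : ℕ} (h1 : Ht bas D c s 1 (1 : K))
    (hp : ∀ i, Ht bas D c s a (p.coeff i)) (hN : p.natDegree < N) (hk : k ≤ N)
    (hx : ∀ j < k, Ht bas D c s e (x j)) (i : ℕ) :
    Ht bas D c s (a + N * (N * (e + 1)) + N * (e + 1) + 1 + N * (e + 1) + k)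
      ((newtonPoly x p k).coeff i) := by
  induction k generalizing i with
  | zero => rw [newtonPoly, coeff_zero]; exact Ht.zero _
  | succ k ih =>
    rw [newtonPoly, coeff_add, coeff_C_mul]
    have h2 : k * (e + 1) ≤ N * (e + 1) := Nat.mul_le_mul_right _ (by omega)
    have h3 : k * (N * (e + 1)) ≤ N * (N * (e + 1)) := Nat.mul_le_mul_right _ (by omega)
    have hx' : ∀ j < k, Ht bas D c s e (x j) := fun j hj => hx j (by omega)
    have hq := ht_eval hd (ht_coeff_newtonQuot hd hp hN hx') (N := N)
      (by rw [natDegree_newtonQuot]; omega) (hx k (by omega))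
    rw [← add_assoc]
    exact Ht.add hd (ih (by omega) hx' i)
      ((hq.mul hd (ht_coeff_nodalPoly hd h1 hx' i)).mono hd (by omega))

end Newton

/-- A coefficient is a sum of at most `2 ^ n ≤ s ^ n` powers of `u`, with exponents at most `n`
because the rank is at most the number of vertices. -/
theorem LoopGraph.ht_coeff_P {K : Type*} [Field K] [Algebra ℚ K] {d : ℕ}
    {bas : Module.Basis (Fin d) ℚ K} {D c s : ℕ} (hd : HtData bas D c s) {u : K}
    (h1 : Ht bas D c s 1 (1 : K)) (hu : Ht bas D c s 1 u) {n : ℕ} (G : LoopGraph (Fin n)) (j : ℕ) :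
    Ht bas D c s (2 * n + 1) ((G.P (C u) X).coeff j) := by
  rw [LoopGraph.coeff_P]
  refine (Ht.sum _ (a := n + 1) (a' := n) ?_ ?_).mono hd (by omega)
  · intro A _
    refine (Ht.pow hd h1 hu _).mono hd ?_
    have := (G.induce A).rk_le_card
    have h2 := A.card_le_univ
    simp only [Fintype.card_coe, Fintype.card_fin] at this h2
    omega
  · refine (Finset.card_le_univ _).trans ?_
    rw [Fintype.card_finset, Fintype.card_fin]
    exact Nat.pow_le_pow_left hd.two_le n

/-! ### Encodings of graphs -/

theorem flatten_ofFn_eq_map_range {α : Type*} {m : ℕ} {f : Fin m → Fin m → α} {g : ℕ → α}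
    (h : ∀ i j : Fin m, g (i * m + j) = f i j) :
    (List.ofFn fun i => List.ofFn fun j => f i j).flatten = (List.range (m * m)).map g := by
  apply List.ext_getElem?
  intro t
  by_cases ht : t < m * m
  · have hm : 0 < m := Nat.pos_of_ne_zero fun h => by simp [h] at ht
    have h1 : t / m < m := Nat.div_lt_of_lt_mul ht
    have h2 : t % m < m := Nat.mod_lt _ hm
    have h3 := getElem?_flatten_ofFn (L := m) (g := fun i => List.ofFn fun j => f i j) (by simp)
      ⟨t / m, h1⟩ h2
    have h4 : t / m * m + t % m = t := Nat.div_add_mod' t m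
    simp only [h4] at h3
    rw [h3, List.getElem?_map, List.getElem?_range ht, List.getElem?_ofFn, dif_pos h2]
    have h5 := h ⟨t / m, h1⟩ ⟨t % m, h2⟩
    simp only [h4] at h5
    simp [h5]
  · rw [List.getElem?_eq_none, List.getElem?_eq_none]
    · simpa using ht
    · simpa [List.length_flatten, List.map_ofFn, List.sum_ofFn] using ht

open Classical in
theorem encGraph_getD {n : ℕ} (G : LoopGraph (Fin n)) (i j : Fin n) :
    (encGraph ⟨n, G⟩).getD (1 + i * n + j) 0 = if G.Adj i j then 1 else 0 := by
  have h := getElem?_flatten_ofFn (L := n)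
    (g := fun i => List.ofFn fun j => if G.Adj i j then (1 : ℤ) else 0) (by simp) i j.2
  rw [encGraph, add_assoc, add_comm 1, List.getD_cons_succ, List.getD_eq_getElem?_getD, h]
  simp

/-- Entry `t` of the matrix belongs to row `t / (n * k)` and column `t % (n * k)`. Dividing these by
`k` gives the cloned vertices, and the leading `1` skips the vertex count. -/
theorem encGraph_clone {n k : ℕ} (G : LoopGraph (Fin n)) :
    encGraph ⟨n * k, G.clone k⟩ = ((n * k : ℕ) : ℤ) :: (List.range (n * k * (n * k))).map fun t =>
      (encGraph ⟨n, G⟩).getD (1 + t / (n * k) / k * n + t % (n * k) / k) 0 := by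
  classical
  rw [encGraph, flatten_ofFn_eq_map_range]
  intro i j
  have hm : 0 < n * k := i.pos
  have h1 : ((i : ℕ) * (n * k) + j) / (n * k) = i := by
    rw [add_comm, Nat.add_mul_div_right _ _ hm, Nat.div_eq_of_lt j.2, zero_add]
  have h2 : ((i : ℕ) * (n * k) + j) % (n * k) = j := by
    rw [add_comm, Nat.add_mul_mod_self_right, Nat.mod_eq_of_lt j.2]
  rw [h1, h2]
  exact encGraph_getD G i.divNat j.divNat

theorem length_encGraph {n : ℕ} (G : LoopGraph (Fin n)) :
    (encGraph ⟨n, G⟩).length = n * n + 1 := by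
  simp [encGraph, List.length_flatten, List.map_ofFn, List.sum_ofFn]

/-! ### The query for a cloned graph -/

/-- The index, in the encoding of a graph with `x₀` vertices, of the entry that is needed next. -/
def cloneIndex : ZExpr :=
  let M : ZExpr := .op .times (.var 0) (.var 1)
  let t : ZExpr := .op .minus (.op .times M M) (.var 3)
  let q : ZExpr := .op .quot t M
  .op .plus (.op .plus (.const 1) (.op .times (.op .quot q (.var 1)) (.var 0)))
    (.op .quot (.op .minus t (.op .times q M)) (.var 1))

/-- Variable `3` counts down from the number of entries, so the number `i` of entries already
written is recovered by subtraction. -/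
theorem cloneIndex_eval {f : ℕ → ℤ} {n k i : ℕ} (h0 : f 0 = n) (h1 : f 1 = k)
    (h3 : f 3 = ((n * k * (n * k) : ℕ) : ℤ) - i) :
    cloneIndex.eval f = ((1 + i / (n * k) / k * n + i % (n * k) / k : ℕ) : ℤ) := by
  have ht : (n : ℤ) * k * (n * k) - (((n * k * (n * k) : ℕ) : ℤ) - i) = i := by push_cast; ring
  simp only [cloneIndex, ZExpr.eval, ArithOp.apply, h0, h1, h3, ht]
  have hm : (i : ℤ) - i / (n * k) * (n * k) = i % (n * k) := by rw [Int.emod_def]; ring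
  rw [hm]
  push_cast
  ring

/-- With a graph in the array `0`, its number of vertices in the variable `0` and `k` in the variable
`1`, the answer of the oracle for the graph with `k` copies of every vertex gets to register `2`. -/
noncomputable def cloneQuery (d : ℕ) : Code :=
  (Code.clear 2).seq <| (Code.set d 4 (.op .times (.var 0) (.var 1))).seq <| (Code.push 2 4).seq <|
  (Code.set d 3 (.op .times (.op .times (.var 0) (.var 1)) (.op .times (.var 0) (.var 1)))).seq <|
  (Code.repeatDown d 3 ((Code.set d 4 cloneIndex).seq ((Code.load 5 0 4).seq (Code.push 2 5)))).seq <|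
  (Code.query 2 3).seq (Code.decode d 2 3)

section Program

variable {K : IntermediateField ℚ ℝ} {d : ℕ} {bas : Module.Basis (Fin d) ℚ K}
  {b : ℕ} {s : AState K} {O : List ℤ → List ℤ} {Q : AState K → Prop}

open Code

theorem wp_cloneQuery {n k : ℕ} {G : LoopGraph (Fin n)} {y : K}
    (hb : (n * k) * (n * k) + n * n + 2 < b) (hdb : d * 2 ≤ b) (hy : Small bas b y)
    (hO : O (encGraph ⟨n * k, G.clone k⟩) = encElem bas y)
    (h0 : s.int 0 = n) (h1 : s.int 1 = k) (ha : s.arr 0 = encGraph ⟨n, G⟩)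
    (hQ : ∀ s', s'.vec = s.vec → (∀ a < 2, s'.arr a = s.arr a) → (∀ v < 3, s'.int v = s.int v) →
      (∀ r, r ≠ 2 → s'.reg r = s.reg r) → s'.reg 2 = y → Q s') :
    WP bas O b (cloneQuery d) Q s := by
  have hM : n * k ≤ n * k * (n * k) := Nat.le_mul_self _
  refine wp_seq (wp_clear (by norm_num) (wp_seq (wp_set (by norm_num) (by simp) ?_ (wp_seq
    (wp_push (by norm_num) (by norm_num) ?_ (wp_seq (wp_set (by norm_num) (by simp) ?_ (wp_seq
    (wp_repeatDown (by norm_num) (fun i s' => s'.vec = s.vec ∧ (∀ a < 2, s'.arr a = s.arr a) ∧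
      (∀ v < 3, s'.int v = s.int v) ∧ s'.reg = s.reg ∧
      s'.arr 2 = ((n * k : ℕ) : ℤ) :: (List.range i).map fun t =>
        (encGraph ⟨n, G⟩).getD (1 + t / (n * k) / k * n + t % (n * k) / k) 0)
      (n * k * (n * k)) ?_ ?_ ?_ ?_)))))))))
  · simp only [ZExpr.eval, ArithOp.apply, AState.setArr_int, h0, h1]
    rw [← Nat.cast_mul, Int.natAbs_natCast]
    omega
  · simp; omega
  · simp only [ZExpr.eval, ArithOp.apply, AState.setArr_int, AState.setInt_int, h0, h1,
      show (0 : ℕ) ≠ 4 by norm_num, show (1 : ℕ) ≠ 4 by norm_num, if_false]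
    rw [← Nat.cast_mul, ← Nat.cast_mul, Int.natAbs_natCast]
    omega
  · simp [ArithOp.apply, h0, h1]
  · refine ⟨rfl, fun a ha => ?_, fun v hv => ?_, rfl, ?_⟩
    · simp [show a ≠ 2 by omega]
    · simp [show v ≠ 3 by omega, show v ≠ 4 by omega]
    · simp [ArithOp.apply, h0, h1]
  · rintro i hi s' ⟨g1, g2, g3, g4, g5⟩ h3
    have hm : 0 < n * k := Nat.pos_of_ne_zero fun h => by simp [h] at hi
    have e1 : i / (n * k) / k < n := by
      rw [Nat.div_div_eq_div_mul]
      refine Nat.div_lt_of_lt_mul (lt_of_lt_of_eq hi (by ring))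
    have e2 : i % (n * k) / k < n :=
      Nat.div_lt_of_lt_mul (lt_of_lt_of_eq (Nat.mod_lt _ hm) (mul_comm _ _))
    have hev := cloneIndex_eval (f := s'.int) (by rw [g3 0 (by norm_num), h0])
      (by rw [g3 1 (by norm_num), h1]) h3
    set idx := 1 + i / (n * k) / k * n + i % (n * k) / k with hidx
    have hlt : idx < n * n + 1 := by
      have : (i / (n * k) / k + 1) * n ≤ n * n := Nat.mul_le_mul_right _ e1
      rw [add_mul] at this
      omega
    -- An entry of the adjacency matrix is `0` or `1`, hence below the bound for integer variables.
    have hval : ((encGraph ⟨n, G⟩).getD idx 0).natAbs < b := by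
      classical
      rw [hidx, encGraph_getD G ⟨_, e1⟩ ⟨_, e2⟩]
      split_ifs <;> simp <;> omega
    refine wp_seq (wp_set (by norm_num) (by simp [cloneIndex]) ?_ (wp_seq
      (wp_load (by norm_num) (by norm_num) (by norm_num) ?_
      (wp_push (by norm_num) (by norm_num) ?_ ⟨?_, ?_, ?_, ?_, ?_, ?_⟩))))
    · rw [hev]; simp only [Int.natAbs_natCast]; omega
    · simp only [AState.setInt_arr, AState.setInt_int, if_true, hev, Int.toNat_natCast]
      rw [g2 0 (by norm_num), ha]
      exact hval
    · simp [g5]; omega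
    · simp [h3]
    · simp [g1]
    · intro a ha
      simp [show a ≠ 2 by omega, g2 a ha]
    · intro v hv
      simp [show v ≠ 3 by omega, show v ≠ 4 by omega, show v ≠ 5 by omega, g3 v hv]
    · simp [g4]
    · simp only [AState.setInt_arr, AState.setArr_arr, if_true, AState.setInt_int, hev,
        Int.toNat_natCast, g5, g2 0 (by norm_num), ha, List.range_succ, List.map_append,
        List.map_cons, List.map_nil, List.cons_append, ← hidx]
  · rintro s' ⟨g1, g2, g3, g4, g5⟩ h3
    have hq : O (s'.arr 2) = encElem bas y := by rw [g5, ← encGraph_clone, hO]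
    refine wp_seq (wp_query (by norm_num) (by norm_num) ?_ ?_ (wp_decode (z := y) (by norm_num) ?_
      (hQ _ ?_ ?_ ?_ ?_ ?_)))
    · rw [hq, encElem_length]; exact hdb
    · rw [hq]; exact bitLen_le_of_mem_encElem hy
    · simp [hq]
    · simp [g1]
    · intro a ha
      simp [show a ≠ 3 by omega, g2 a ha]
    · simpa using g3
    · intro r hr
      simp [hr, g4]
    · simp

/-! ### Evaluation of the interpolation polynomial -/

/-- The vectors `0` and `1` are evaluated at the register `1` by Horner's rule, and the next Newton
coefficient gets to register `5`. -/
noncomputable def hornerCode (bas : Module.Basis (Fin d) ℚ K) : Code :=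
  (kset bas 3 (.const 0)).seq <| (kset bas 4 (.const 0)).seq <|
  (Code.set d 3 (.op .plus (.var 0) (.const 2))).seq <|
  (repeatDown d 3 <| (Code.set d 4 (.op .minus (.var 3) (.const 1))).seq <|
    (vload d 7 0 4).seq <| (kset bas 3 (.add (.mul (.reg 3) (.reg 1)) (.reg 7))).seq <|
    (vload d 7 1 4).seq (kset bas 4 (.add (.mul (.reg 4) (.reg 1)) (.reg 7)))).seq <|
  kset bas 5 (.div (.sub (.reg 2) (.reg 3)) (.reg 4))

theorem wp_hornerCode {n : ℕ} {f g : ℕ → K} {x : K} (hb : n + 2 < b)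
    (h0 : s.int 0 = n) (hv0 : s.vec 0 = (List.range (n + 2)).map f)
    (hv1 : s.vec 1 = (List.range (n + 2)).map g) (hx : s.reg 1 = x)
    (hf : ∀ i ≤ n + 2, Small bas b (horner f x (n + 2) i))
    (hg : ∀ i ≤ n + 2, Small bas b (horner g x (n + 2) i))
    (hne : horner g x (n + 2) (n + 2) ≠ 0)
    (hc : Small bas b ((s.reg 2 - horner f x (n + 2) (n + 2)) / horner g x (n + 2) (n + 2)))
    (hQ : ∀ s', s'.vec = s.vec → s'.arr = s.arr → (∀ v < 3, s'.int v = s.int v) →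
      (∀ r < 3, s'.reg r = s.reg r) →
      s'.reg 5 = (s.reg 2 - horner f x (n + 2) (n + 2)) / horner g x (n + 2) (n + 2) → Q s') :
    WP bas O b (hornerCode bas) Q s := by
  have hz : Small bas b (0 : K) := hf 0 (by omega)
  refine wp_seq (wp_kset trivial hz (wp_seq (wp_kset trivial hz (wp_seq
    (wp_set (by norm_num) (by simp) ?_ (wp_seq
    (wp_repeatDown (by norm_num) (fun i s' => s'.vec = s.vec ∧ s'.arr = s.arr ∧
      (∀ v < 3, s'.int v = s.int v) ∧ (∀ r < 3, s'.reg r = s.reg r) ∧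
      s'.reg 3 = horner f x (n + 2) i ∧ s'.reg 4 = horner g x (n + 2) i)
      (n + 2) ?_ ?_ ?_ ?_)))))))
  · simp [ArithOp.apply, h0]; omega
  · simp [ArithOp.apply, h0]
  · refine ⟨rfl, rfl, fun v hv => ?_, fun r hr => ?_, ?_, ?_⟩
    · simp [show v ≠ 3 by omega]
    · simp [hr.ne, (hr.trans (show (3 : Fin 10) < 4 by decide)).ne]
    · simp [horner]
    · simp [horner]
  · rintro i hi s' ⟨g1, g2, g3, g4, g5, g6⟩ h3
    have hx' : s'.reg 1 = x := by rw [g4 1 (by decide), hx]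
    -- One less than the counter is the index of the next coefficient: from `n + 1` down to `0`, as
    -- Horner's rule requires.
    have hidx : (((n + 2 : ℕ) : ℤ) - i) - 1 = ((n + 2 - 1 - i : ℕ) : ℤ) := by omega
    refine wp_seq (wp_set (by norm_num) (by simp) ?_ (wp_seq
      (wp_vload (i := n + 2 - 1 - i) (z := f (n + 2 - 1 - i)) (by norm_num) ?_ ?_ (wp_seq
      (wp_kset (by simp) ?_ (wp_seq
      (wp_vload (i := n + 2 - 1 - i) (z := g (n + 2 - 1 - i)) (by norm_num) ?_ ?_
      (wp_kset (by simp) ?_ ⟨?_, ?_, ?_, ?_, ?_, ?_, ?_⟩))))))))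
    · simp only [ZExpr.eval, ArithOp.apply, h3, hidx, Int.natAbs_natCast]; omega
    · simp only [AState.setInt_int, if_true, ZExpr.eval, ArithOp.apply, h3, hidx]
    · simp only [AState.setInt_vec, g1, hv0]
      rw [List.getElem?_map, List.getElem?_range (by omega)]; rfl
    · have := hf (i + 1) (by omega)
      simpa [g5, hx', horner] using this
    · simp only [AState.setReg_int, AState.setInt_int, if_true, ZExpr.eval, ArithOp.apply, h3, hidx]
    · simp only [AState.setReg_vec, AState.setInt_vec, g1, hv1]
      rw [List.getElem?_map, List.getElem?_range (by omega)]; rfl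
    · have := hg (i + 1) (by omega)
      simpa [g6, hx', horner] using this
    · simp [h3]
    · simp [g1]
    · simp [g2]
    · intro v hv
      simp [show v ≠ 3 by omega, show v ≠ 4 by omega, g3 v hv]
    · intro r hr
      simp [hr.ne, (hr.trans (show (3 : Fin 10) < 4 by decide)).ne,
        (hr.trans (show (3 : Fin 10) < 7 by decide)).ne, g4 r hr]
    · simp [g5, hx', horner]
    · simp [g6, hx', horner]
  · rintro s' ⟨g1, g2, g3, g4, g5, g6⟩ h3
    have h2 : s'.reg 2 = s.reg 2 := g4 2 (by decide)
    refine wp_kset (by simpa [g6] using hne) (by simpa [g5, g6, h2] using hc) (hQ _ ?_ ?_ ?_ ?_ ?_)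
    · simp [g1]
    · simp [g2]
    · simpa using g3
    · intro r hr
      simp [(hr.trans (show (3 : Fin 10) < 5 by decide)).ne, g4 r hr]
    · simp [g5, g6, h2]

/-! ### Update of the interpolation polynomial -/

/-- The multiple of the vector `1` by the register `5` is added to the vector `0`, and the vector `1`
is multiplied by the linear factor with the root in register `1`. -/
noncomputable def updateCode (bas : Module.Basis (Fin d) ℚ K) : Code :=
  (kset bas 6 (.const 0)).seq <| (Code.set d 3 (.op .plus (.var 0) (.const 2))).seq <|
  repeatDown d 3 <| (Code.set d 4 (.op .minus (.op .plus (.var 0) (.const 2)) (.var 3))).seq <|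
    (vload d 7 1 4).seq <| (vload d 8 0 4).seq <|
    (kset bas 8 (.add (.reg 8) (.mul (.reg 5) (.reg 7)))).seq <| (vstore d 0 4 8).seq <|
    (kset bas 9 (.sub (.reg 6) (.mul (.reg 1) (.reg 7)))).seq <| (vstore d 1 4 9).seq <|
    kset bas 6 (.reg 7)

theorem set_map_range_ite {α : Type*} (f g : ℕ → α) (N i : ℕ) :
    ((List.range N).map fun t => if t < i then g t else f t).set i (g i) =
      (List.range N).map fun t => if t < i + 1 then g t else f t := by
  apply List.ext_getElem (by simp)
  intro t h1 h2
  rw [List.getElem_set]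
  by_cases h : i = t
  · subst h; simp
  · have h3 : t ≤ i ↔ t < i := by omega
    simp [h, h3]

/-- The update is in place and ascending: entries below `i` are new, the others old. The new nodal
coefficient `i` needs the old one at `i - 1`, which is already overwritten and therefore kept in
register `6`. -/
theorem wp_updateCode {n : ℕ} {f g f' g' : ℕ → K} (hb : n + 2 < b)
    (h0 : s.int 0 = n) (hv0 : s.vec 0 = (List.range (n + 2)).map f)
    (hv1 : s.vec 1 = (List.range (n + 2)).map g)
    (hf' : ∀ i, f i + s.reg 5 * g i = f' i)
    (hg' : ∀ i, (if i = 0 then 0 else g (i - 1)) - s.reg 1 * g i = g' i)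
    (hz : Small bas b (0 : K)) (hsg : ∀ i, Small bas b (g i))
    (hsf' : ∀ i, Small bas b (f' i)) (hsg' : ∀ i, Small bas b (g' i))
    (hQ : ∀ s', s'.vec 0 = (List.range (n + 2)).map f' → s'.vec 1 = (List.range (n + 2)).map g' →
      s'.arr = s.arr → (∀ v < 3, s'.int v = s.int v) → s'.reg 0 = s.reg 0 → Q s') :
    WP bas O b (updateCode bas) Q s := by
  refine wp_seq (wp_kset trivial hz (wp_seq (wp_set (by norm_num) (by simp) ?_
    (wp_repeatDown (by norm_num) (fun i s' =>
      s'.vec 0 = ((List.range (n + 2)).map fun t => if t < i then f' t else f t) ∧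
      s'.vec 1 = ((List.range (n + 2)).map fun t => if t < i then g' t else g t) ∧ s'.arr = s.arr ∧
      (∀ v < 3, s'.int v = s.int v) ∧ s'.reg 0 = s.reg 0 ∧ s'.reg 1 = s.reg 1 ∧
      s'.reg 5 = s.reg 5 ∧ s'.reg 6 = if i = 0 then 0 else g (i - 1))
      (n + 2) ?_ ?_ ?_ ?_))))
  · simp [ArithOp.apply, h0]; omega
  · simp [ArithOp.apply, h0]
  · refine ⟨by simp [hv0], by simp [hv1], rfl, fun v hv => ?_, ?_, ?_, ?_, ?_⟩
    · simp [show v ≠ 3 by omega]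
    all_goals simp
  · rintro i hi s' ⟨g0, g1, g2, g3, g4, g5, g6, g7⟩ h3
    have h0' : s'.int 0 = n := by rw [g3 0 (by norm_num), h0]
    have hidx : ((n : ℤ) + 2) - (((n + 2 : ℕ) : ℤ) - i) = (i : ℤ) := by push_cast; ring
    have hF := hf' i
    have hG := hg' i
    have hsF := hsf' i
    have hsG := hsg' i
    rw [← hF] at hsF
    rw [← hG] at hsG
    refine wp_seq (wp_set (by norm_num) (by simp) ?_ (wp_seq
      (wp_vload (i := i) (z := g i) (by norm_num) ?_ ?_ (wp_seq
      (wp_vload (i := i) (z := f i) (by norm_num) ?_ ?_ (wp_seq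
      (wp_kset (by simp) ?_ (wp_seq (wp_vstore (i := i) (by norm_num) ?_ (wp_seq
      (wp_kset (by simp) ?_ (wp_seq (wp_vstore (i := i) (by norm_num) ?_
      (wp_kset trivial ?_ ⟨?_, ?_, ?_, ?_, ?_, ?_, ?_, ?_, ?_⟩))))))))))))))
    · simp only [ZExpr.eval, ArithOp.apply, h3, h0', hidx, Int.natAbs_natCast]; omega
    · simp only [AState.setInt_int, if_true, ZExpr.eval, ArithOp.apply, h3, h0', hidx]
    · simp only [AState.setInt_vec, g1]
      rw [List.getElem?_map, List.getElem?_range hi]; simp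
    · simp only [AState.setReg_int, AState.setInt_int, if_true, ZExpr.eval, ArithOp.apply, h3, h0',
        hidx]
    · simp only [AState.setReg_vec, AState.setInt_vec, g0]
      rw [List.getElem?_map, List.getElem?_range hi]; simp
    · simpa [g6] using hsF
    · simp only [AState.setReg_int, AState.setInt_int, if_true, ZExpr.eval, ArithOp.apply, h3, h0',
        hidx]
    · simpa [g5, g7] using hsG
    · simp only [AState.setReg_int, AState.setVec_int, AState.setInt_int, if_true, ZExpr.eval,
        ArithOp.apply, h3, h0', hidx]
    · simpa using hsg i
    · simp [h3]
    · simpa [g0, g6, hF] using set_map_range_ite f f' (n + 2) i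
    · simpa [g1, g5, g7, hG] using set_map_range_ite g g' (n + 2) i
    · simp [g2]
    · intro v hv
      simp [show v ≠ 3 by omega, show v ≠ 4 by omega, g3 v hv]
    · simp [g4]
    · simp [g5]
    · simp [g6]
    · simp
  · rintro s' ⟨g0, g1, g2, g3, g4, g5, g6, g7⟩ h3
    refine hQ s' (g0.trans ?_) (g1.trans ?_) g2 g3 g4
    all_goals
      refine List.map_congr_left fun t ht => ?_
      rw [if_pos (List.mem_range.1 ht)]

end Program

section Program

variable {K : IntermediateField ℚ ℝ} {d : ℕ} {bas : Module.Basis (Fin d) ℚ K}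
  {b : ℕ} {s : AState K} {O : List ℤ → List ℤ} {Q : AState K → Prop}

open Code

/-! ### Initialization and output -/

/-- The number of vertices is loaded, and the two vectors are initialized with the polynomials `0`
and `1`. -/
noncomputable def initCode (bas : Module.Basis (Fin d) ℚ K) : Code :=
  (load 0 0 4).seq <| (kset bas 7 (.const 1)).seq <| (vpush d 1 7).seq <|
  (kset bas 7 (.const 0)).seq <| (vpush d 0 7).seq <|
  (Code.set d 3 (.op .plus (.var 0) (.const 1))).seq <|
  (repeatDown d 3 ((vpush d 0 7).seq (vpush d 1 7))).seq <|
  (kset bas 0 (.const 1)).seq (Code.set d 2 (.op .plus (.var 0) (.const 1)))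

/-- There are `n + 1` nodes, so the nodal polynomial finally has degree `n + 1` and the vectors need
`n + 2` entries. -/
theorem wp_initCode {n : ℕ} {G : LoopGraph (Fin n)} (hb : n + 3 < b) (hz : Small bas b (0 : K))
    (h1 : Small bas b (1 : K)) (hi : s.int = fun _ => 0) (hv : s.vec = fun _ => [])
    (ha : s.arr 0 = encGraph ⟨n, G⟩)
    (hQ : ∀ s' : AState K, s'.int 0 = n → s'.int 1 = 0 → s'.int 2 = (n : ℤ) + 1 → s'.arr = s.arr →
      s'.reg 0 = 1 → s'.vec 0 = (List.range (n + 2)).map (0 : K[X]).coeff →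
      s'.vec 1 = (List.range (n + 2)).map (1 : K[X]).coeff → Q s') :
    WP bas O b (initCode bas) Q s := by
  -- Variable `4` is still `0`, so the entry read is the leading one, the number of vertices.
  have hl : (s.arr 0).getD (s.int 4).toNat 0 = n := by simp [ha, hi, encGraph]
  refine wp_seq (wp_load (by norm_num) (by norm_num) (by norm_num) ?_ (wp_seq
    (wp_kset trivial h1 (wp_seq (wp_vpush ?_ (wp_seq (wp_kset trivial hz (wp_seq (wp_vpush ?_ (wp_seq
    (wp_set (by norm_num) (by simp) ?_ (wp_seq (wp_repeatDown (by norm_num) (fun i s' =>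
      s'.vec 0 = List.replicate (i + 1) 0 ∧ s'.vec 1 = 1 :: List.replicate i 0 ∧ s'.arr = s.arr ∧
      s'.int 0 = n ∧ s'.int 1 = 0 ∧ s'.reg 7 = 0) (n + 1) ?_ ?_ ?_ ?_)))))))))))))
  · rw [hl]; simp; omega
  · simp [hv]; omega
  · simp [hv]; omega
  · simp only [ZExpr.eval, ArithOp.apply, AState.setVec_int, AState.setReg_int, AState.setInt_int,
      if_true, hl]
    omega
  · simp only [ZExpr.eval, ArithOp.apply, AState.setVec_int, AState.setReg_int, AState.setInt_int,
      if_true, hl]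
    push_cast; rfl
  · simp only [AState.setVec_int, AState.setReg_int, AState.setInt_int, hl]
    simp [hv, hi]
  · rintro i hi' s' ⟨g0, g1, g2, g3, g4, g5⟩ h3
    refine wp_seq (wp_vpush ?_ (wp_vpush ?_ ⟨?_, ?_, ?_, ?_, ?_, ?_, ?_⟩))
    · simp [g0]; omega
    · simp [g1]; omega
    · simp [h3]
    · simp [g0, g5, List.replicate_succ']
    · simp [g1, g5, List.replicate_succ']
    · simp [g2]
    · simp [g3]
    · simp [g4]
    · simp [g5]
  · rintro s' ⟨g0, g1, g2, g3, g4, g5⟩ h3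
    refine wp_seq (wp_kset trivial h1 (wp_set (by norm_num) (by simp) ?_ (hQ _ ?_ ?_ ?_ ?_ ?_ ?_ ?_)))
    · simp [ArithOp.apply, g3]; omega
    · simp [g3]
    · simp [g4]
    · simp [ArithOp.apply, g3]
    · simp [g2]
    · simp
    · simp only [AState.setInt_vec, AState.setReg_vec, g0]
      apply List.ext_getElem (by simp)
      intro t h1 h2
      simp
    · simp only [AState.setInt_vec, AState.setReg_vec, g1]
      apply List.ext_getElem (by simp)
      intro t h1 h2
      cases t with
      | zero => simp
      | succ t => simp [coeff_one]

/-- The polynomial with the coefficients in the vector `0` is written to the array `1`. -/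
noncomputable def outputCode (d : ℕ) : Code :=
  (Code.set d 6 (.const 0)).seq <| (Code.set d 3 (.op .plus (.var 0) (.const 2))).seq <|
  (repeatDown d 3 <| (Code.set d 4 (.op .minus (.op .plus (.var 0) (.const 2)) (.var 3))).seq <|
    (vload d 7 0 4).seq (setIfNe d 6 4 7)).seq <|
  (Code.set d 3 (.op .plus (.var 6) (.const 1))).seq <|
  repeatDown d 3 <| (Code.set d 4 (.op .minus (.op .plus (.var 6) (.const 1)) (.var 3))).seq <|
    (vload d 7 0 4).seq (encode d 1 7)

/-- The encoding stops at the leading coefficient, so a first pass finds the last nonzero entry and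
a second one writes. For the zero polynomial the initial value `0` of the index agrees with
`natDegree`. -/
theorem wp_outputCode {n : ℕ} {p : K[X]} (hp : p.natDegree ≤ n) (hb : n + 2 < b)
    (hdb : (n + 1) * (d * 2) ≤ b) (h0 : s.int 0 = n)
    (hv : s.vec 0 = (List.range (n + 2)).map p.coeff) (ha : s.arr 1 = [])
    (hQ : ∀ s', s'.arr 1 = encPoly bas p → Q s') : WP bas O b (outputCode d) Q s := by
  classical
  refine wp_seq (wp_set (by norm_num) trivial ?_ (wp_seq (wp_set (by norm_num) (by simp) ?_ (wp_seq
    (wp_repeatDown (by norm_num) (fun i s' => s'.vec = s.vec ∧ s'.arr = s.arr ∧ s'.int 0 = n ∧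
      ∃ m : ℕ, s'.int 6 = m ∧ (m = 0 ∨ p.coeff m ≠ 0) ∧ ∀ t < i, p.coeff t ≠ 0 → t ≤ m)
      (n + 2) ?_ ?_ ?_ ?_)))))
  · simp; omega
  · simp [ArithOp.apply, h0]; omega
  · simp [ArithOp.apply, h0]
  · exact ⟨rfl, rfl, by simp [h0], 0, by simp, Or.inl rfl, fun t ht => absurd ht (Nat.not_lt_zero _)⟩
  · rintro i hi s' ⟨g1, g2, g3, m, g4, g5, g6⟩ h3
    have hidx : ((n : ℤ) + 2) - (((n + 2 : ℕ) : ℤ) - i) = (i : ℤ) := by push_cast; ring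
    refine wp_seq (wp_set (by norm_num) (by simp) ?_ (wp_seq
      (wp_vload (i := i) (z := p.coeff i) (by norm_num) ?_ ?_
      (wp_setIfNe (by norm_num) (by norm_num) ⟨?_, ?_, ?_, ?_, ?_⟩))))
    · simp only [ZExpr.eval, ArithOp.apply, h3, g3, hidx, Int.natAbs_natCast]; omega
    · simp only [AState.setInt_int, if_true, ZExpr.eval, ArithOp.apply, h3, g3, hidx]
    · simp only [AState.setInt_vec, g1, hv]
      rw [List.getElem?_map, List.getElem?_range hi]; rfl
    · simp [h3]
    · simp [g1]
    · simp [g2]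
    · simp [g3]
    · have h6 : (6 : ℕ) ≠ 3 := by norm_num
      have h64 : (6 : ℕ) ≠ 4 := by norm_num
      simp only [AState.setInt_int, AState.setReg_int, AState.setReg_reg, if_true, ZExpr.eval,
        ArithOp.apply, h3, g3, hidx, h6, h64, if_false, g4]
      by_cases hc : p.coeff i = 0
      · refine ⟨m, by simp [hc], g5, fun t ht hne => ?_⟩
        have : t ≠ i := fun h => hne (h ▸ hc)
        exact g6 t (by omega) hne
      · exact ⟨i, by simp [hc], Or.inr hc, fun t ht _ => by omega⟩
  · rintro s' ⟨g1, g2, g3, m, g4, g5, g6⟩ -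
    obtain rfl : m = p.natDegree := by
      apply le_antisymm
      · rcases g5 with rfl | h
        · exact Nat.zero_le _
        · exact le_natDegree_of_ne_zero h
      · by_cases hp0 : p = 0
        · simp [hp0]
        · exact g6 _ (by omega) (by simpa using hp0)
    refine wp_seq (wp_set (by norm_num) (by simp) ?_
      (wp_repeatDown (by norm_num) (fun i s' => s'.vec 0 = s.vec 0 ∧ s'.int 6 = p.natDegree ∧
        s'.arr 1 = ((List.range i).map fun t => encElem bas (p.coeff t)).flatten)
      (p.natDegree + 1) ?_ ?_ ?_ ?_))
    · simp [ArithOp.apply, g4]; omega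
    · simp [ArithOp.apply, g4]
    · exact ⟨by simp [g1], by simp [g4], by simp [g2, ha]⟩
    · rintro i hi s₂ ⟨k1, k2, k3⟩ h3
      have hidx : ((p.natDegree : ℤ) + 1) - (((p.natDegree + 1 : ℕ) : ℤ) - i) = (i : ℤ) := by
        push_cast; ring
      have hlen : (s₂.arr 1).length = i * (d * 2) := by
        simp [k3, List.length_flatten, encElem_length, Function.comp_def]
      refine wp_seq (wp_set (by norm_num) (by simp) ?_ (wp_seq
        (wp_vload (i := i) (z := p.coeff i) (by norm_num) ?_ ?_
        (wp_encode (by norm_num) ?_ ⟨?_, ?_, ?_, ?_⟩))))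
      · simp only [ZExpr.eval, ArithOp.apply, h3, k2, hidx, Int.natAbs_natCast]; omega
      · simp only [AState.setInt_int, if_true, ZExpr.eval, ArithOp.apply, h3, k2, hidx]
      · simp only [AState.setInt_vec, k1, hv]
        rw [List.getElem?_map, List.getElem?_range (by omega)]; rfl
      · simp only [AState.setReg_arr, AState.setInt_arr, hlen]
        refine le_trans ?_ hdb
        rw [← Nat.succ_mul]
        exact Nat.mul_le_mul_right _ (by omega)
      · simp [h3]
      · simp [k1]
      · simp [k2]
      · simp [k3, List.range_succ]
    · rintro s₂ ⟨k1, k2, k3⟩ -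
      refine hQ s₂ ?_
      rw [k3, encPoly]
      congr 1
      apply List.ext_getElem (by simp)
      intro t h1 h2
      rw [List.getElem_map, List.getElem_range, List.getElem_ofFn]

/-! ### The whole program -/

/-- One step of Newton interpolation, at the next power of `w`. -/
noncomputable def newtonStep (bas : Module.Basis (Fin d) ℚ K) (w : K) : Code :=
  (Code.set d 1 (.op .plus (.var 1) (.const 1))).seq <|
  (kset bas 0 (.mul (.reg 0) (.const w))).seq <| (kset bas 1 (.sub (.reg 0) (.const 1))).seq <|
  (cloneQuery d).seq <| (hornerCode bas).seq (updateCode bas)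

/-- The coefficients of the interlace polynomial from its values at the points `w ^ k - 1`. -/
noncomputable def interpolationCode (bas : Module.Basis (Fin d) ℚ K) (w : K) : Code :=
  (initCode bas).seq <| (repeatDown d 2 (newtonStep bas w)).seq (outputCode d)

/-- The points of interpolation. -/
noncomputable def node (w : K) (k : ℕ) : K := w ^ (k + 1) - 1

/-- The field elements that occur in the computation have coordinates of at most `b` bits. -/
structure InterpolationBound (bas : Module.Basis (Fin d) ℚ K) (b n : ℕ) (w : K) (p : K[X]) :
    Prop where
  zero : Small bas b (0 : K)
  one : Small bas b (1 : K)
  pow : ∀ k ≤ n, Small bas b (w ^ (k + 1))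
  node : ∀ k ≤ n, Small bas b (node w k)
  value : ∀ k ≤ n, Small bas b (p.eval (Interlace.node w k))
  nodal : ∀ k ≤ n + 1, ∀ i, Small bas b ((nodalPoly (Interlace.node w) k).coeff i)
  newton : ∀ k ≤ n + 1, ∀ i, Small bas b ((newtonPoly (Interlace.node w) p k).coeff i)
  nodal_horner : ∀ k ≤ n, ∀ i ≤ n + 2, Small bas b
    (horner (nodalPoly (Interlace.node w) k).coeff (Interlace.node w k) (n + 2) i)
  newton_horner : ∀ k ≤ n, ∀ i ≤ n + 2, Small bas b
    (horner (newtonPoly (Interlace.node w) p k).coeff (Interlace.node w k) (n + 2) i)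
  newton_coeff : ∀ k ≤ n, Small bas b
    ((newtonQuot (Interlace.node w) p k).eval (Interlace.node w k))

/-- After `k` rounds the two vectors hold the Newton and nodal polynomials of the first `k` nodes,
and register `0` holds `w ^ k`. After `n + 1` rounds the former is `p`, whose degree is at most `n`.
-/
theorem wp_interpolationCode {n : ℕ} {G : LoopGraph (Fin n)} {w : K} {p : K[X]}
    (hp : p.natDegree ≤ n) (hw : ∀ j k, j < k → node w j ≠ node w k)
    (hO : ∀ k, O (encGraph ⟨n * (k + 1), G.clone (k + 1)⟩) = encElem bas (p.eval (node w k)))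
    (hB : InterpolationBound bas b n w p) (hb : (n + 2) ^ 4 + n * n + 2 < b)
    (hdb : (n + 1) * (d * 2) ≤ b) (hi : s.int = fun _ => 0) (hv : s.vec = fun _ => [])
    (ha : s.arr 0 = encGraph ⟨n, G⟩) (ha1 : s.arr 1 = [])
    (hQ : ∀ s', s'.arr 1 = encPoly bas p → Q s') : WP bas O b (interpolationCode bas w) Q s := by
  have hpow : n + 2 ≤ (n + 2) ^ 4 := Nat.le_self_pow (by norm_num) _
  refine wp_seq (wp_initCode (G := G) (by omega) hB.zero hB.one hi hv ha ?_)
  intro s₁ i0 i1 i2 iarr ireg iv0 iv1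
  refine wp_seq (wp_repeatDown (by norm_num) (fun k s' => s'.int 0 = n ∧ s'.int 1 = k ∧
    s'.reg 0 = w ^ k ∧ s'.vec 0 = (List.range (n + 2)).map (newtonPoly (node w) p k).coeff ∧
    s'.vec 1 = (List.range (n + 2)).map (nodalPoly (node w) k).coeff ∧
    s'.arr 0 = encGraph ⟨n, G⟩ ∧ s'.arr 1 = []) (n + 1) (by simp [i2]) ?_ ?_ ?_)
  · exact ⟨i0, by simp [i1], by simp [ireg], iv0, iv1, by simp [iarr, ha], by simp [iarr, ha1]⟩
  · rintro k hk s' ⟨g0, g1, g2, g3, g4, g5, g6⟩ hc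
    have hkn : k ≤ n := by omega
    have hdeg1 : (newtonPoly (node w) p k).natDegree < n + 2 :=
      natDegree_newtonPoly_lt (by omega) (by omega)
    have hdeg2 : (nodalPoly (node w) k).natDegree < n + 2 := by rw [natDegree_nodalPoly]; omega
    -- At most `n + 1` copies of each vertex are made, which bounds the adjacency matrix in the
    -- query.
    have hsize : n * (k + 1) * (n * (k + 1)) ≤ (n + 2) ^ 4 := by
      calc n * (k + 1) * (n * (k + 1)) ≤ (n + 2) * (n + 2) * ((n + 2) * (n + 2)) := by
            gcongr <;> omega
        _ = _ := by ring
    have hx : s'.reg 0 * w - 1 = node w k := by rw [g2, node, pow_succ]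
    have hnc := newton_coeff (x := node w) (p := p) (k := k) fun j hj => hw j k hj
    have hne := nodalPoly_eval_ne_zero (x := node w) (y := node w k) fun j hj => hw j k hj
    refine wp_seq (wp_set (by norm_num) (by simp) ?_ (wp_seq (wp_kset (by simp) ?_ (wp_seq
      (wp_kset (by simp) ?_ (wp_seq (wp_cloneQuery (n := n) (k := k + 1) (G := G)
        (y := p.eval (node w k)) (by omega) (le_trans (Nat.le_mul_of_pos_left _ (by omega)) hdb)
        (hB.value k hkn) (hO k) ?_ ?_ ?_ ?_)))))))
    · simp [ArithOp.apply, g1]; omega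
    · simpa [g2, ← pow_succ] using hB.pow k hkn
    · simpa [hx] using hB.node k hkn
    · simp [g0]
    · simp [ArithOp.apply, g1]
    · simp [g5]
    intro s₂ v2 a2 n2 r2 y2
    have x2 : s₂.reg 1 = node w k := by rw [r2 1 (by decide)]; simp [hx]
    have w2 : s₂.reg 0 = w ^ (k + 1) := by rw [r2 0 (by decide)]; simp [g2, pow_succ]
    have e1 := horner_eval hdeg1 (node w k)
    have e2 := horner_eval hdeg2 (node w k)
    refine wp_seq (wp_hornerCode (n := n) (f := (newtonPoly (node w) p k).coeff)
      (g := (nodalPoly (node w) k).coeff) (x := node w k) (by omega) ?_ ?_ ?_ x2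
      (hB.newton_horner k hkn) (hB.nodal_horner k hkn) ?_ ?_ ?_)
    · rw [n2 0 (by norm_num)]; simp [g0]
    · simp [v2, g3]
    · simp [v2, g4]
    · rw [e2]; exact hne
    · rw [e1, e2, y2, hnc]; exact hB.newton_coeff k hkn
    rw [e1, e2, y2, hnc]
    intro s₃ v3 a3 n3 r3 c3
    have x3 : s₃.reg 1 = node w k := by rw [r3 1 (by decide), x2]
    refine wp_updateCode (n := n) (f := (newtonPoly (node w) p k).coeff)
      (g := (nodalPoly (node w) k).coeff) (f' := (newtonPoly (node w) p (k + 1)).coeff)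
      (g' := (nodalPoly (node w) (k + 1)).coeff) (by omega) ?_ ?_ ?_ ?_ ?_ hB.zero
      (hB.nodal k (by omega)) (hB.newton (k + 1) (by omega)) (hB.nodal (k + 1) (by omega)) ?_
    · rw [n3 0 (by norm_num), n2 0 (by norm_num)]; simp [g0]
    · simp [v3, v2, g3]
    · simp [v3, v2, g4]
    · intro i
      rw [newtonPoly, coeff_add, coeff_C_mul, c3]
    · intro i
      rw [coeff_nodalPoly_succ, x3]
    intro s₄ v40 v41 a4 n4 r4
    have hint : ∀ v < 3, s₄.int v = s₂.int v := fun v hv => by rw [n4 v hv, n3 v hv]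
    refine ⟨?_, ?_, ?_, ?_, ?_, ?_, ?_, ?_⟩
    · rw [hint 2 (by norm_num), n2 2 (by norm_num)]; simp [hc]
    · simp [hint, n2, g0]
    · simp [hint, n2, g1, ArithOp.apply]
    · simp [r4, r3, w2]
    · simp [v40]
    · simp [v41]
    · simp [a4, a3, a2, g5]
    · simp [a4, a3, a2, g6]
  · rintro s' ⟨g0, g1, g2, g3, g4, g5, g6⟩ -
    rw [newtonPoly_eq (by omega)] at g3
    exact wp_outputCode hp (by omega) hdb g0 g3 g6 hQ

end Program

/-! ### Size bounds, distinct nodes and the reduction -/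

section Main

variable {K : IntermediateField ℚ ℝ} {d : ℕ}

theorem exists_interpolationBound (bas : Module.Basis (Fin d) ℚ K) (u w : K) :
    ∃ B : ℕ[X], ∀ (n b : ℕ) (G : LoopGraph (Fin n)), B.eval n ≤ b →
      InterpolationBound bas b n w (G.P (C u) X) := by
  -- One height suits the whole computation, as every number in it arises from `1`, `u` and `w`.
  obtain ⟨D, c, s, hd, hz⟩ := exists_htData bas ![1, u, w]
  have h1 : Ht bas D c s 1 (1 : K) := hz 0
  have hu : Ht bas D c s 1 u := hz 1
  have hw : Ht bas D c s 1 w := hz 2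
  refine ⟨C (D + 2 * s + 2) * ((2 * X + 1) + (X + 2) * ((X + 2) * (X + 4)) +
    3 * ((X + 2) * (X + 4)) + 1 + (X + 2) + 1), fun n b G hb => ?_⟩
  simp only [eval_mul, eval_add, eval_C, eval_X, eval_one, eval_ofNat] at hb
  have hN : n + 2 ≤ (n + 2) * (n + 4) := Nat.le_mul_of_pos_right _ (by omega)
  set p := G.P (C u) X
  set H := (n + 2) * (n + 4) with hH
  -- Nodes have exponent `n + 3`, so `H = (n + 2) * (n + 4)` is the price of one evaluation with `n
  -- + 2` coefficients. The bound on `a` covers all cases below.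
  have small : ∀ {a : ℕ} {z : K}, Ht bas D c s a z →
      a ≤ (2 * n + 1) + (n + 2) * H + 3 * H + 1 + (n + 2) → Small bas b z := by
    intro a z h ha j
    have h2 := Ht.small hd h j
    have h3 : (D + 2 * s + 2) * (a + 1) ≤ b :=
      (Nat.mul_le_mul_left _ (by omega)).trans hb
    exact ⟨h2.1.trans h3, h2.2.trans h3⟩
  have hpdeg : p.natDegree < n + 2 := by
    have := G.natDegree_P_le u
    rw [Fintype.card_fin] at this
    exact lt_of_le_of_lt this (by omega)
  have hp : ∀ i, Ht bas D c s (2 * n + 1) (p.coeff i) := fun i => G.ht_coeff_P hd h1 hu i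
  have hpow : ∀ k, Ht bas D c s (k + 2) (w ^ (k + 1)) := fun k => Ht.pow hd h1 hw (k + 1)
  have hnode : ∀ k ≤ n, Ht bas D c s (n + 3) (node w k) := fun k hk =>
    (Ht.sub hd (hpow k) (h1.mono hd (by omega))).mono hd (by omega)
  have hkH : ∀ k ≤ n + 2, k * (n + 3 + 1) ≤ H := fun k hk => Nat.mul_le_mul_right _ hk
  have hkH2 : ∀ k ≤ n + 2, k * H ≤ (n + 2) * H := fun k hk => Nat.mul_le_mul_right _ hk
  have hnodal : ∀ k ≤ n + 1, ∀ i, Ht bas D c s (1 + H) ((nodalPoly (node w) k).coeff i) :=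
    fun k hk i => (ht_coeff_nodalPoly hd h1 (fun j hj => hnode j (by omega)) i).mono hd
      (Nat.add_le_add_left (hkH k (by omega)) 1)
  have hnewton : ∀ k ≤ n + 1, ∀ i, Ht bas D c s ((2 * n + 1) + (n + 2) * H + H + 1 + H + (n + 2))
      ((newtonPoly (node w) p k).coeff i) := fun k hk i =>
    (ht_coeff_newtonPoly hd h1 hp hpdeg (k := k) (by omega) (fun j hj => hnode j (by omega)) i).mono
      hd (Nat.add_le_add_left (by omega) _)
  refine ⟨small (Ht.zero 0) (by omega), small h1 (by omega), fun k hk => small (hpow k) (by omega),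
    fun k hk => small (hnode k hk) (by omega), fun k hk => ?_,
    fun k hk i => small (hnodal k hk i) (by omega), fun k hk i => small (hnewton k hk i) (by omega),
    fun k hk i hi => ?_, fun k hk i hi => ?_, fun k hk => ?_⟩
  · exact small (ht_eval hd hp hpdeg (hnode k hk)) (by have := hkH (n + 2) le_rfl; omega)
  · refine small (ht_horner hd (hnodal k (by omega)) (hnode k hk) (n + 2) i) ?_
    have := hkH i hi
    omega
  · refine small (ht_horner hd (hnewton k (by omega)) (hnode k hk) (n + 2) i) ?_
    have := hkH i hi
    omega
  · refine small (ht_eval hd (ht_coeff_newtonQuot hd hp hpdeg fun j hj => hnode j (by omega))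
      (N := n + 2) (by rw [natDegree_newtonQuot]; omega) (hnode k hk)) ?_
    have h2 := hkH (n + 2) le_rfl
    have h3 := hkH2 k (by omega)
    have h4 : (n + 2) * (n + 3 + 1) = H := rfl
    rw [h4]
    omega

/-- The three excluded values are those for which the real number `1 + ξ` has absolute value `1` or
`0`. For every other absolute value the powers are distinct. -/
theorem node_ne {ξ : K} (hξ : ξ ∉ ({0, -1, -2} : Set K)) {j k : ℕ} (hjk : j < k) :
    node (1 + ξ) j ≠ node (1 + ξ) k := by
  simp only [Set.mem_insert_iff, Set.mem_singleton_iff, not_or] at hξ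
  obtain ⟨h0, h1, h2⟩ := hξ
  have hr : ∀ q : K, (1 + ξ) ≠ q → (((1 + ξ : K) : ℝ)) ≠ (q : ℝ) := fun q hq h => hq (Subtype.ext h)
  have a0 := hr 0 fun h => h1 (by linear_combination h)
  have a1 := hr 1 fun h => h0 (by linear_combination h)
  have a2 := hr (-1) fun h => h2 (by linear_combination h)
  simp only [ZeroMemClass.coe_zero, OneMemClass.coe_one, NegMemClass.coe_neg] at a0 a1 a2
  set v : ℝ := ((1 + ξ : K) : ℝ)
  intro h
  have h3 : (1 + ξ) ^ (j + 1) = (1 + ξ) ^ (k + 1) := sub_left_injective h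
  have h4 : v ^ (j + 1) = v ^ (k + 1) := by
    have := congrArg (fun z : K => (z : ℝ)) h3
    simpa [v] using this
  have h5 : |v| ^ (j + 1) = |v| ^ (k + 1) := by rw [← abs_pow, h4, abs_pow]
  have h6 : |v| ≠ 1 := fun h => by
    rcases eq_or_eq_neg_of_abs_eq h with h | h
    · exact a1 h
    · exact a2 h
  have := pow_right_injective₀ (abs_pos.2 a0) h6 h5
  omega

theorem eval_mono_nat (T : ℕ[X]) {a b : ℕ} (h : a ≤ b) : T.eval a ≤ T.eval b := by
  induction T using Polynomial.induction_on' with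
  | add p q hp hq => rw [eval_add, eval_add]; exact Nat.add_le_add hp hq
  | monomial n c =>
    rw [eval_monomial, eval_monomial]
    exact Nat.mul_le_mul_left _ (Nat.pow_le_pow_left h n)

theorem length_le_bitSize (l : List ℤ) : l.length ≤ bitSize l := by
  induction l with
  | nil => simp
  | cons x l ih =>
    have := one_le_bitLen x
    simp only [bitSize, List.map_cons, List.sum_cons, List.length_cons] at ih ⊢
    omega

theorem bitLen_le_of_mem_encGraph {n b : ℕ} {G : LoopGraph (Fin n)} (hb : n + 1 < b) :
    ∀ x ∈ encGraph ⟨n, G⟩, bitLen x ≤ b := by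
  intro x hx
  apply bitLen_le_of_natAbs_lt
  simp only [encGraph, List.mem_cons, List.mem_flatten, List.mem_ofFn] at hx
  rcases hx with rfl | ⟨l, ⟨i, rfl⟩, hx⟩
  · simp; omega
  · obtain ⟨j, rfl⟩ := List.mem_ofFn.1 hx
    split_ifs <;> simp <;> omega

theorem polyProblem_reducible (bas : Module.Basis (Fin d) ℚ K) (u ξ : K)
    (hξ : ξ ∉ ({0, -1, -2} : Set K)) :
    PolyTimeTuringReducible (polyProblem bas u) (evalProblem bas u ξ) := by
  obtain ⟨B₀, hB₀⟩ := exists_interpolationBound bas u (1 + ξ)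
  -- Besides the field elements, `b` must exceed the size of the queries, the input and the encoded
  -- output.
  set B : ℕ[X] := B₀ + (X + 2) ^ 4 + X * X + (X + 1) * C (d * 2) + 10 with hB
  refine ⟨.seq (initProg d) (interpolationCode bas (1 + ξ)).prog,
    C (10 * d * 3 + 1) + (interpolationCode bas (1 + ξ)).time.comp B, fun O hO => ?_⟩
  rintro ⟨n, G⟩
  change ∃ m t, Exec O _ (Memory.start (encGraph ⟨n, G⟩)) m t ∧ t ≤ _ ∧
    m.arr 1 = encPoly bas (G.P (C u) X)
  have hOk : ∀ k, O (encGraph ⟨n * (k + 1), G.clone (k + 1)⟩) =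
      encElem bas ((G.P (C u) X).eval (node (1 + ξ) k)) := by
    intro k
    -- The value at the node is the value of the clone at `ξ`, which is what the oracle answers.
    rw [LoopGraph.eval_P, node, ← LoopGraph.P_clone]
    exact hO ⟨n * (k + 1), G.clone (k + 1)⟩
  set b := B.eval n with hb
  simp only [hB, eval_add, eval_mul, eval_pow, eval_X, eval_C, eval_one, eval_ofNat] at hb
  have hpow : n + 2 ≤ (n + 2) ^ 4 := Nat.le_self_pow (by norm_num) _
  have hp : (G.P (C u) X).natDegree ≤ n := by
    simpa using G.natDegree_P_le u
  have hrun : Runs O (.seq (initProg d) (interpolationCode bas (1 + ξ)).prog)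
      (Memory.start (encGraph ⟨n, G⟩))
      (10 * d * 3 + 1 + (interpolationCode bas (1 + ξ)).time.eval b)
      fun m => m.arr 1 = encPoly bas (G.P (C u) X) := by
    refine Runs.seq ((runs_initProg (bas := bas) (b := b) (by rw [length_encGraph]; omega)
      (bitLen_le_of_mem_encGraph (by omega)) (by omega)).mono le_rfl fun m hm => ?_)
    refine (wp_interpolationCode (Q := fun s' => s'.arr 1 = encPoly bas (G.P (C u) X)) hp
      (fun j k => node_ne hξ) hOk (hB₀ n b G (by omega)) (by omega) (by omega) rfl rfl ?_ ?_
      (fun _ => id) m hm).mono le_rfl ?_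
    · simp
    · simp
    · rintro m' ⟨s', hr, hs⟩
      rw [hr.arr 1 (by norm_num), hs]
  obtain ⟨m, t, hex, ht, hm⟩ := hrun
  refine ⟨m, t, hex, ht.trans ?_, hm⟩
  rw [eval_add, eval_C, eval_comp]
  refine Nat.add_le_add_left (eval_mono_nat _ (eval_mono_nat B ?_)) _
  -- The input contains the `n * n` matrix entries and the vertex count, each of at least one bit,
  -- so `n` is at most its length.
  have h1 := length_le_bitSize (encGraph ⟨n, G⟩)
  rw [length_encGraph] at h1
  have h2 : n ≤ n * n := Nat.le_mul_self n
  exact le_trans (by omega) h1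

end Main

end Interlace

theorem mainTheorem9 (K : IntermediateField ℚ ℝ) [FiniteDimensional ℚ K]
    {d : ℕ} (b : Module.Basis (Fin d) ℚ K)
    (u ξ : K) (hξ : ξ ∉ ({0, -1, -2} : Set K)) :
    Interlace.PolyTimeTuringReducible
      (Interlace.polyProblem b u) (Interlace.evalProblem b u ξ) :=
  Interlace.polyProblem_reducible b u ξ hξ
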